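/- Let $N\ge 1$, let $(d_1,\dots,d_N)$ be strictly positive integers with sum $g$, and put $d_{N+1}=d_0=g$; indices $i$ below run over $\mathbb Z/(N+1)\mathbb Z=\{0,\dots,N\}$. Let $$T=\begin{pmatrix}0&\mathrm{Id}_{2g-1}\\ t&0\end{pmatrix}\in\mathfrak{gl}_{2g}(\mathbb Z[t]),\qquad J=\begin{pmatrix}0&-\Delta\\ \Delta&0\end{pmatrix},$$ where $\Delta$ is the antidiagonal permutation matrix of size $g$, and let $\mathcal V_i=T^{d_1+\cdots+d_i}\,\mathbb Z[t]^{2g}\subset\mathbb Z[t,t^{-1}]^{2g}$ for $0\le i\le N$. Let $\alpha_i:\mathcal V_i\to\mathcal V_{i-1}$ be the inclusion for $1\le i\le N$, and let $\alpha_0:\mathcal V_0\to\mathcal V_N$ be multiplication by $t$. Let $\langle\ ,\ \rangle$ be the symplectic form with matrix $J$ on $\mathbb Z[t,t^{-1}]^{2g}$, let $\langle\ ,\ \rangle_0$ be its restriction to $\mathcal V_0$ and $\langle\ ,\ \rangle_N$ the restriction of $t^{-1}\langle\ ,\ \rangle$ to $\mathcal V_N$; both have values in $\mathbb Z[t]$.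 All schemes are over $\mathbb A^1_t=\operatorname{Spec}\mathbb Z[t]$ and are described by their points in $\mathbb Z[t]$-algebras $R$. Let $\Omega\subset R^{2g}$ be spanned by the first $g$ basis vectors, and let $\mathfrak P$ be the Lie algebra of $2g\times 2g$ matrices preserving $\Omega$. * $\mathcal Q_t(R)$ is the group of families $(\gamma_i)_i$ of automorphisms of the $R\otimes\mathcal V_i$ with $\gamma_{i-1}\alpha_i=\alpha_i\gamma_i$ for all $i$, such that $\gamma_0$ preserves $\langle\ ,\ \rangle_0$ and $\gamma_N$ preserves $\langle\ ,\ \rangle_N$. * $\mathbb M_t^{\rm rig}(\mathrm{Sp}_{2g},(d_i))(R)$ is the set of families $(\omega_i,\varphi_i)_i$, where $\omega_i\subset R\otimes\mathcal V_i$ is locally a direct factor of rank $g$, $\alpha_i(\omega_i)\subset\omega_{i-1}$ for all $i$, $\omega_0$ and $\omega_N$ are totally isotropic for $\langle\ ,\ \rangle_0$ and $\langle\ ,\ \rangle_N$ respectively, and $\varphi_i:R\otimes\mathcal V_i\to R^{2g}$ is an isomorphism with $\varphi_i(\omega_i)=\Omega$. The group $\mathcal Q_t$ acts on it on the left by $\gamma\cdot(\omega_i,\varphi_i)_i=(\gamma_i(\omega_i),\varphi_i\gamma_i^{-1})_i$.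 * $\Sigma^{g,N}_{(d_i)}(R)$ is the set of triples $((\Pi_i)_{0\le i\le N},(\ ,\ )_0,(\ ,\ )_N)$, where: the $\Pi_i\in\mathfrak P(R)$ are matrices whose entries generate the unit ideal; $\Pi_i\Pi_{i+1}\cdots\Pi_{i+N}=t\,\mathrm{Id}_{2g}$ for all $i$; for all $i$ the minors of size $2g-d_i$ of $\Pi_i$ generate the unit ideal; $(\ ,\ )_0$ and $(\ ,\ )_N$ are nondegenerate (i.e. perfect) symplectic pairings on $R^{2g}$ for which $\Omega$ is totally isotropic; and $(\Pi_0x,y)_N=(x,\Pi_1\cdots\Pi_N\,y)_0$ for all $x,y$. **Proposition.** These three functors are representable by schemes over $\mathbb A^1_t$, $\mathcal Q_t$ being a group scheme. Transport of structure along the $\varphi_i$, that is $$(\omega_i,\varphi_i)_i\longmapsto\bigl((\varphi_{i-1}\alpha_i\varphi_i^{-1})_i,\ \langle\varphi_0^{-1}\cdot,\varphi_0^{-1}\cdot\rangle_0,\ \langle\varphi_N^{-1}\cdot,\varphi_N^{-1}\cdot\rangle_N\bigr),$$ defines a morphism $\pi:\mathbb M_t^{\rm rig}(\mathrm{Sp}_{2g},(d_i))\to\Sigma^{g,N}_{(d_i)}$,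 and, with the above action of $\mathcal Q_t$, the $\Sigma^{g,N}_{(d_i)}$-scheme $\mathbb M_t^{\rm rig}(\mathrm{Sp}_{2g},(d_i))$ is a (Zariski-locally trivial) $\mathcal Q_t$-principal homogeneous space: $\pi$ is $\mathcal Q_t$-invariant, $(\gamma,x)\mapsto(\gamma x,x)$ is an isomorphism $\mathcal Q_t\times_{\mathbb A^1_t}\mathbb M_t^{\rm rig}\to\mathbb M_t^{\rm rig}\times_{\Sigma^{g,N}_{(d_i)}}\mathbb M_t^{\rm rig}$, and $\pi$ has sections Zariski-locally on $\Sigma^{g,N}_{(d_i)}$. -/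

import Mathlib

open CategoryTheory AlgebraicGeometry MonoidalCategory CartesianMonoidalCategory
open scoped Polynomial LaurentPolynomial TensorProduct

noncomputable section

namespace SymplecticLocalModel

/-! ### The lattices and the symplectic form over `ℤ[t, t⁻¹]` (here `t` is `X : ℤ[X]`) -/

/-- The `n × n` matrix `(0, Id_{n-1}; t, 0)`. -/
def shiftMatrix (n : ℕ) : Matrix (Fin n) (Fin n) ℤ[X] :=
  Matrix.of fun i j =>
    if j.val = i.val + 1 then 1
    else if i.val + 1 = n ∧ j.val = 0 then Polynomial.X else 0

/-- The `2g × 2g` matrix `(0, -Δ; Δ, 0)`, where `Δ` is the antidiagonal permutation matrix. -/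
def symplecticMatrix (g : ℕ) : Matrix (Fin (2 * g)) (Fin (2 * g)) ℤ[X] :=
  Matrix.of fun i j =>
    if i.val + j.val + 1 = 2 * g then (if i.val < g then -1 else 1) else 0

/-- The symplectic form on `ℤ[t, t⁻¹]^{2g}` with matrix `symplecticMatrix g`. -/
def laurentForm (g : ℕ) : LinearMap.BilinForm ℤ[T;T⁻¹] (Fin (2 * g) → ℤ[T;T⁻¹]) :=
  Matrix.toBilin' ((symplecticMatrix g).map (algebraMap ℤ[X] ℤ[T;T⁻¹]))

/-- The map `v ↦ T ^ k v` from `ℤ[t]^n` to `ℤ[t, t⁻¹]^n`, with `T` the matrix `shiftMatrix n`. -/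
def latticeMap (n k : ℕ) : (Fin n → ℤ[X]) →ₗ[ℤ[X]] (Fin n → ℤ[T;T⁻¹]) :=
  (Algebra.linearMap ℤ[X] ℤ[T;T⁻¹]).compLeft (Fin n) ∘ₗ (shiftMatrix n ^ k).mulVecLin

/-- The lattice `T ^ k ℤ[t]^n ⊆ ℤ[t, t⁻¹]^n`. -/
def lattice (n k : ℕ) : Submodule ℤ[X] (Fin n → ℤ[T;T⁻¹]) := LinearMap.range (latticeMap n k)

theorem shiftMatrix_pow_apply (n k : ℕ) (hk : k ≤ n) (i j : Fin n) :
    (shiftMatrix n ^ k) i j =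
      if j.val = i.val + k then 1
      else if j.val + n = i.val + k then Polynomial.X else 0 := by
  induction k generalizing i j with
  | zero =>
    rw [pow_zero, Matrix.one_apply]
    have hi := i.isLt
    have hj := j.isLt
    by_cases h : i = j
    · subst h; simp
    · have h' : j.val ≠ i.val := fun e => h (Fin.ext e.symm)
      have h'' : j.val + n ≠ i.val := by omega
      simp [h, h', h'']
  | succ k ih =>
    rw [pow_succ', Matrix.mul_apply]
    have hi := i.isLt
    have hj := j.isLt
    have key : ∀ l : Fin n, l.val = (if i.val + 1 = n then 0 else i.val + 1) →
        ∑ x, shiftMatrix n i x * (shiftMatrix n ^ k) x j =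
          shiftMatrix n i l * (shiftMatrix n ^ k) l j := by
      intro l hl
      refine Finset.sum_eq_single l (fun b _ hb => ?_) (fun h => absurd (Finset.mem_univ l) h)
      have hb' : b.val ≠ l.val := fun e => hb (Fin.ext e)
      have hbl := b.isLt
      have : shiftMatrix n i b = 0 := by
        simp only [shiftMatrix, Matrix.of_apply]
        split_ifs at hl with h
        · rw [if_neg (by omega), if_neg (by omega)]
        · rw [if_neg (by omega), if_neg (by omega)]
      rw [this, zero_mul]
    by_cases h : i.val + 1 = n
    · have hn : 0 < n := by omega
      rw [key ⟨0, hn⟩ (by simp [h]), ih (by omega)]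
      have hs : shiftMatrix n i ⟨0, hn⟩ = Polynomial.X := by
        simp only [shiftMatrix, Matrix.of_apply]
        rw [if_neg (by omega), if_pos (by simp [h])]
      rw [hs]
      simp only [zero_add]
      rw [if_neg (c := j.val = i.val + (k + 1)) (by omega),
        if_neg (c := j.val + n = k) (by omega)]
      by_cases hjk : j.val = k
      · rw [if_pos hjk, if_pos (by omega), mul_one]
      · rw [if_neg hjk, if_neg (by omega), mul_zero]
    · have hl : i.val + 1 < n := by omega
      rw [key ⟨i.val + 1, hl⟩ (by simp [h]), ih (by omega)]
      have hs : shiftMatrix n i ⟨i.val + 1, hl⟩ = 1 := by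
        simp [shiftMatrix]
      rw [hs, one_mul]
      simp only [show i.val + 1 + k = i.val + (k + 1) by omega]

theorem shiftMatrix_pow_self (n : ℕ) :
    shiftMatrix n ^ n = (Polynomial.X : ℤ[X]) • (1 : Matrix (Fin n) (Fin n) ℤ[X]) := by
  ext1 i j
  rw [shiftMatrix_pow_apply n n le_rfl, Matrix.smul_apply, Matrix.one_apply]
  have hi := i.isLt
  have hj := j.isLt
  rw [if_neg (by omega)]
  by_cases h : i = j
  · subst h; simp
  · have h' : j.val ≠ i.val := fun e => h (Fin.ext e.symm)
    simp [h, h']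

theorem lattice_anti (n : ℕ) {k l : ℕ} (h : k ≤ l) : lattice n l ≤ lattice n k := by
  rintro _ ⟨v, rfl⟩
  refine ⟨(shiftMatrix n ^ (l - k)).mulVec v, ?_⟩
  simp only [latticeMap, LinearMap.comp_apply, Matrix.mulVecLin_apply, Matrix.mulVec_mulVec,
    ← pow_add, Nat.add_sub_cancel' h]

theorem X_smul_mem_lattice (n : ℕ) {k : ℕ} (h : k ≤ n) {x : Fin n → ℤ[T;T⁻¹]}
    (hx : x ∈ lattice n 0) : (Polynomial.X : ℤ[X]) • x ∈ lattice n k := by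
  obtain ⟨v, rfl⟩ := hx
  refine lattice_anti n h ⟨v, ?_⟩
  rw [latticeMap, latticeMap, LinearMap.comp_apply, LinearMap.comp_apply, ← map_smul]
  congr 1
  rw [Matrix.mulVecLin_apply, Matrix.mulVecLin_apply, shiftMatrix_pow_self, pow_zero,
    Matrix.smul_mulVec, Matrix.one_mulVec]

theorem transpose_shift_mul_symplectic (g : ℕ) :
    (shiftMatrix (2 * g) ^ g).transpose * symplecticMatrix g * shiftMatrix (2 * g) ^ g =
      (Polynomial.X : ℤ[X]) • (-symplecticMatrix g) := by
  let σ : Fin (2 * g) → Fin (2 * g) := fun i =>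
    if h : i.val < g then ⟨i.val + g, by omega⟩ else ⟨i.val - g, by omega⟩
  let c : Fin (2 * g) → ℤ[X] := fun i => if i.val < g then Polynomial.X else 1
  have hT : ∀ a i, (shiftMatrix (2 * g) ^ g) a i = if a = σ i then c i else 0 := by
    intro a i
    rw [shiftMatrix_pow_apply _ _ (by omega)]
    have ha := a.isLt
    have hi := i.isLt
    simp only [σ, c, Fin.ext_iff]
    by_cases h : i.val < g
    · simp only [h, dite_true, if_true]
      rw [if_neg (by omega)]
      by_cases h2 : a.val = i.val + g
      · rw [if_pos (by omega), if_pos h2]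
      · rw [if_neg (by omega), if_neg h2]
    · simp only [h, dite_false, if_false]
      by_cases h2 : a.val = i.val - g
      · rw [if_pos (by omega), if_pos h2]
      · rw [if_neg (by omega), if_neg (by omega), if_neg h2]
  ext1 i j
  have h1 : ((shiftMatrix (2 * g) ^ g).transpose * symplecticMatrix g * shiftMatrix (2 * g) ^ g)
      i j = c i * symplecticMatrix g (σ i) (σ j) * c j := by
    simp only [Matrix.mul_apply, Matrix.transpose_apply, hT]
    simp
  rw [h1, Matrix.smul_apply, Matrix.neg_apply, smul_eq_mul]
  have hi := i.isLt
  have hj := j.isLt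
  simp only [symplecticMatrix, Matrix.of_apply, σ, c]
  by_cases h : i.val < g <;> by_cases h' : j.val < g
  · simp only [h, h', dite_true, if_true]
    rw [if_neg (by omega), if_neg (by omega)]; simp
  · simp only [h, h', dite_true, dite_false, if_true, if_false]
    by_cases h2 : i.val + j.val + 1 = 2 * g
    · rw [if_pos (by omega), if_pos h2, if_neg (by omega)]; simp
    · rw [if_neg (by omega), if_neg h2]; simp
  · simp only [h, h', dite_true, dite_false, if_true, if_false]
    by_cases h2 : i.val + j.val + 1 = 2 * g
    · rw [if_pos (by omega), if_pos h2, if_pos (by omega)]; simp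
    · rw [if_neg (by omega), if_neg h2]; simp
  · simp only [h, h', dite_false, if_false]
    rw [if_neg (by omega), if_neg (by omega)]; simp

theorem laurentForm_latticeMap (g k : ℕ) (v w : Fin (2 * g) → ℤ[X]) :
    laurentForm g (latticeMap (2 * g) k v) (latticeMap (2 * g) k w) =
      algebraMap ℤ[X] ℤ[T;T⁻¹] (v ⬝ᵥ ((shiftMatrix (2 * g) ^ k).transpose * symplecticMatrix g *
        shiftMatrix (2 * g) ^ k).mulVec w) := by
  have h : ∀ u : Fin (2 * g) → ℤ[X], latticeMap (2 * g) k u =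
      algebraMap ℤ[X] ℤ[T;T⁻¹] ∘ ((shiftMatrix (2 * g) ^ k).mulVec u) := fun u => rfl
  have h' : ((symplecticMatrix g).map (algebraMap ℤ[X] ℤ[T;T⁻¹])).mulVec
      (algebraMap ℤ[X] ℤ[T;T⁻¹] ∘ ((shiftMatrix (2 * g) ^ k).mulVec w)) =
      algebraMap ℤ[X] ℤ[T;T⁻¹] ∘
        ((symplecticMatrix g).mulVec ((shiftMatrix (2 * g) ^ k).mulVec w)) :=
    funext fun i => (RingHom.map_mulVec _ _ _ i).symm
  rw [h, h, laurentForm, Matrix.toBilin'_apply', h', ← RingHom.map_dotProduct]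
  refine congrArg _ ?_
  rw [← Matrix.mulVec_mulVec, ← Matrix.mulVec_mulVec, Matrix.dotProduct_mulVec _ (Matrix.transpose _),
    Matrix.vecMul_transpose]

/-- The `ℤ[t]`-valued bilinear form on a `ℤ[t]`-submodule `W` of `ℤ[t, t⁻¹]^{2g}` obtained by
multiplying the symplectic form of `ℤ[t, t⁻¹]^{2g}` by `c`, when the values lie in `ℤ[t]`. -/
def integralForm (g : ℕ) (W : Submodule ℤ[X] (Fin (2 * g) → ℤ[T;T⁻¹])) (c : ℤ[T;T⁻¹])
    (h : ∀ x y : W, ∃ p : ℤ[X], algebraMap ℤ[X] ℤ[T;T⁻¹] p = c * laurentForm g x y) :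
    LinearMap.BilinForm ℤ[X] W :=
  have inj : Function.Injective (algebraMap ℤ[X] ℤ[T;T⁻¹]) := Polynomial.toLaurent_injective
  have spec : ∀ x y : W, algebraMap ℤ[X] ℤ[T;T⁻¹] (h x y).choose = c * laurentForm g x y :=
    fun x y => (h x y).choose_spec
  LinearMap.mk₂ ℤ[X] (fun x y => (h x y).choose)
    (fun x x' y => inj <| by
      rw [map_add, spec, spec, spec, Submodule.coe_add, map_add, LinearMap.add_apply, mul_add])
    (fun p x y => inj <| by
      rw [smul_eq_mul, map_mul, spec, spec, Submodule.coe_smul,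
        ← algebraMap_smul ℤ[T;T⁻¹] p (x : Fin (2 * g) → ℤ[T;T⁻¹]), map_smul, LinearMap.smul_apply,
        smul_eq_mul]
      ring)
    (fun x y y' => inj <| by
      rw [map_add, spec, spec, spec, Submodule.coe_add, map_add, mul_add])
    (fun p x y => inj <| by
      rw [smul_eq_mul, map_mul, spec, spec, Submodule.coe_smul,
        ← algebraMap_smul ℤ[T;T⁻¹] p (y : Fin (2 * g) → ℤ[T;T⁻¹]), map_smul, smul_eq_mul]
      ring)

theorem algebraMap_integralForm (g : ℕ) (W : Submodule ℤ[X] (Fin (2 * g) → ℤ[T;T⁻¹]))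
    (c : ℤ[T;T⁻¹])
    (h : ∀ x y : W, ∃ p : ℤ[X], algebraMap ℤ[X] ℤ[T;T⁻¹] p = c * laurentForm g x y) (x y : W) :
    algebraMap ℤ[X] ℤ[T;T⁻¹] (integralForm g W c h x y) = c * laurentForm g x y :=
  (h x y).choose_spec

/-! ### Base change along a morphism of `ℤ[t]`-algebras -/

section BaseChange

variable {M M' : Type} [AddCommGroup M] [Module ℤ[X] M] [AddCommGroup M'] [Module ℤ[X] M']
  {R S U : Type} [CommRing R] [Algebra ℤ[X] R] [CommRing S] [Algebra ℤ[X] S]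
  [CommRing U] [Algebra ℤ[X] U]

/-- The map `R ⊗ M → S ⊗ M` induced by `f : R → S`. -/
def scalarMap (f : R →ₐ[ℤ[X]] S) : (R ⊗[ℤ[X]] M) →ₗ[ℤ[X]] (S ⊗[ℤ[X]] M) :=
  f.toLinearMap.rTensor M

@[simp] theorem scalarMap_tmul (f : R →ₐ[ℤ[X]] S) (r : R) (m : M) :
    scalarMap f (r ⊗ₜ[ℤ[X]] m) = f r ⊗ₜ[ℤ[X]] m := rfl

theorem scalarMap_smul (f : R →ₐ[ℤ[X]] S) (r : R) (x : R ⊗[ℤ[X]] M) :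
    scalarMap f (r • x) = f r • scalarMap f x := by
  induction x using TensorProduct.induction_on with
  | zero => simp
  | tmul a m => simp [TensorProduct.smul_tmul']
  | add x y hx hy => rw [smul_add, map_add, hx, hy, map_add, smul_add]

theorem scalarMap_id (x : R ⊗[ℤ[X]] M) : scalarMap (AlgHom.id ℤ[X] R) x = x := by
  induction x using TensorProduct.induction_on with
  | zero => simp
  | tmul a m => simp
  | add x y hx hy => rw [map_add, hx, hy]

theorem scalarMap_comp (f : R →ₐ[ℤ[X]] S) (h : S →ₐ[ℤ[X]] U) (x : R ⊗[ℤ[X]] M) :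
    scalarMap (h.comp f) x = scalarMap h (scalarMap f x) := by
  induction x using TensorProduct.induction_on with
  | zero => simp
  | tmul a m => simp
  | add x y hx hy => simp only [map_add, hx, hy]

theorem baseChange_scalarMap (f : R →ₐ[ℤ[X]] S) (β : M →ₗ[ℤ[X]] M') (x : R ⊗[ℤ[X]] M) :
    β.baseChange S (scalarMap f x) = scalarMap f (β.baseChange R x) := by
  induction x using TensorProduct.induction_on with
  | zero => simp
  | tmul a m => simp
  | add x y hx hy => simp only [map_add, hx, hy]

theorem form_scalarMap (f : R →ₐ[ℤ[X]] S) (B : LinearMap.BilinForm ℤ[X] M)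
    (x y : R ⊗[ℤ[X]] M) :
    B.baseChange S (scalarMap f x) (scalarMap f y) = f (B.baseChange R x y) := by
  induction x using TensorProduct.induction_on with
  | zero => simp
  | add x x' hx hx' => simp only [map_add, LinearMap.add_apply, hx, hx']
  | tmul a m =>
    induction y using TensorProduct.induction_on with
    | zero => simp
    | add y y' hy hy' => simp only [map_add, hy, hy']
    | tmul b n => simp [LinearMap.BilinForm.baseChange_tmul]

theorem ext_scalarMap {P : Type} [AddCommGroup P] [Module S P] (f : R →ₐ[ℤ[X]] S)
    {l l' : (S ⊗[ℤ[X]] M) →ₗ[S] P}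
    (h : ∀ x : R ⊗[ℤ[X]] M, l (scalarMap f x) = l' (scalarMap f x)) : l = l' := by
  refine LinearMap.ext fun z => ?_
  induction z using TensorProduct.induction_on with
  | zero => simp
  | tmul s m =>
    have h1 := h (1 ⊗ₜ m)
    rw [scalarMap_tmul, map_one] at h1
    rw [← mul_one s, ← smul_eq_mul, ← TensorProduct.smul_tmul', map_smul, map_smul, h1]
  | add x y hx hy => rw [map_add, map_add, hx, hy]

theorem cancelBaseChange_one_tmul (f : R →ₐ[ℤ[X]] S) (x : R ⊗[ℤ[X]] M) :
    letI : Algebra R S := f.toAlgebra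
    letI : IsScalarTower ℤ[X] R S := IsScalarTower.of_algebraMap_eq' f.comp_algebraMap.symm
    TensorProduct.AlgebraTensorModule.cancelBaseChange ℤ[X] R S S M ((1 : S) ⊗ₜ[R] x) =
      scalarMap f x := by
  let : Algebra R S := f.toAlgebra
  have : IsScalarTower ℤ[X] R S := IsScalarTower.of_algebraMap_eq' f.comp_algebraMap.symm
  induction x using TensorProduct.induction_on with
  | zero => simp
  | tmul a m =>
    rw [TensorProduct.AlgebraTensorModule.cancelBaseChange_tmul, scalarMap_tmul, Algebra.smul_def,
      mul_one]
    rfl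
  | add x y hx hy => rw [TensorProduct.tmul_add, map_add, map_add, hx, hy]

/-- The base change along `f : R → S` of an isomorphism `R ⊗ M ≃ R ⊗ M'`. -/
def mapEquiv (f : R →ₐ[ℤ[X]] S) (e : (R ⊗[ℤ[X]] M) ≃ₗ[R] (R ⊗[ℤ[X]] M')) :
    (S ⊗[ℤ[X]] M) ≃ₗ[S] (S ⊗[ℤ[X]] M') :=
  letI : Algebra R S := f.toAlgebra
  letI : IsScalarTower ℤ[X] R S := IsScalarTower.of_algebraMap_eq' f.comp_algebraMap.symm
  (TensorProduct.AlgebraTensorModule.cancelBaseChange ℤ[X] R S S M).symm ≪≫ₗ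
    e.baseChange R S _ _ ≪≫ₗ TensorProduct.AlgebraTensorModule.cancelBaseChange ℤ[X] R S S M'

theorem mapEquiv_scalarMap (f : R →ₐ[ℤ[X]] S) (e : (R ⊗[ℤ[X]] M) ≃ₗ[R] (R ⊗[ℤ[X]] M'))
    (x : R ⊗[ℤ[X]] M) : mapEquiv f e (scalarMap f x) = scalarMap f (e x) := by
  let : Algebra R S := f.toAlgebra
  have : IsScalarTower ℤ[X] R S := IsScalarTower.of_algebraMap_eq' f.comp_algebraMap.symm
  have h : (TensorProduct.AlgebraTensorModule.cancelBaseChange ℤ[X] R S S M).symm (scalarMap f x) =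
      (1 : S) ⊗ₜ[R] x := by
    rw [LinearEquiv.symm_apply_eq]
    exact (cancelBaseChange_one_tmul f x).symm
  change TensorProduct.AlgebraTensorModule.cancelBaseChange ℤ[X] R S S M' (e.baseChange R S _ _
    ((TensorProduct.AlgebraTensorModule.cancelBaseChange ℤ[X] R S S M).symm (scalarMap f x))) = _
  rw [h, LinearEquiv.baseChange_tmul]
  exact cancelBaseChange_one_tmul f (e x)

/-- The base change along `f : R → S` of a trivialisation `R ⊗ M ≃ R ^ n`. -/
def mapFraming {n : ℕ} (f : R →ₐ[ℤ[X]] S) (e : (R ⊗[ℤ[X]] M) ≃ₗ[R] (Fin n → R)) :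
    (S ⊗[ℤ[X]] M) ≃ₗ[S] (Fin n → S) :=
  letI : Algebra R S := f.toAlgebra
  letI : IsScalarTower ℤ[X] R S := IsScalarTower.of_algebraMap_eq' f.comp_algebraMap.symm
  (TensorProduct.AlgebraTensorModule.cancelBaseChange ℤ[X] R S S M).symm ≪≫ₗ
    e.baseChange R S _ _ ≪≫ₗ TensorProduct.piScalarRight R S S (Fin n)

theorem mapFraming_scalarMap {n : ℕ} (f : R →ₐ[ℤ[X]] S) (e : (R ⊗[ℤ[X]] M) ≃ₗ[R] (Fin n → R))
    (x : R ⊗[ℤ[X]] M) : mapFraming f e (scalarMap f x) = f ∘ e x := by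
  let : Algebra R S := f.toAlgebra
  have : IsScalarTower ℤ[X] R S := IsScalarTower.of_algebraMap_eq' f.comp_algebraMap.symm
  have h : (TensorProduct.AlgebraTensorModule.cancelBaseChange ℤ[X] R S S M).symm (scalarMap f x) =
      (1 : S) ⊗ₜ[R] x := by
    rw [LinearEquiv.symm_apply_eq]
    exact (cancelBaseChange_one_tmul f x).symm
  change TensorProduct.piScalarRight R S S (Fin n) (e.baseChange R S _ _
    ((TensorProduct.AlgebraTensorModule.cancelBaseChange ℤ[X] R S S M).symm (scalarMap f x))) = _
  rw [h, LinearEquiv.baseChange_tmul, TensorProduct.piScalarRight_apply,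
    TensorProduct.piScalarRightHom_tmul]
  funext i
  rw [Algebra.smul_def, mul_one]
  rfl

theorem exists_of_lTensor_mkQ_eq_zero {A K : Type} [CommRing A] [AddCommGroup K] [Module A K]
    (Q : Type) [AddCommGroup Q] [Module A Q] (W : Submodule A K) (z : Q ⊗[A] K)
    (hz : W.mkQ.lTensor Q z = 0) : ∃ y, W.subtype.lTensor Q y = z :=
  ((lTensor_exact Q (LinearMap.exact_subtype_mkQ W) W.mkQ_surjective) z).1 hz

theorem grassmannian_map_eq_span {k : ℕ} (f : R →ₐ[ℤ[X]] S)
    (W : Module.Grassmannian R (R ⊗[ℤ[X]] M) k) :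
    (Module.Grassmannian.map f W).toSubmodule =
      Submodule.span S (scalarMap f '' (W.toSubmodule : Set (R ⊗[ℤ[X]] M))) := by
  let : Algebra R S := f.toAlgebra
  have : IsScalarTower ℤ[X] R S := IsScalarTower.of_algebraMap_eq' f.comp_algebraMap.symm
  let c := TensorProduct.AlgebraTensorModule.cancelBaseChange ℤ[X] R S S M
  have h : ∀ x : R ⊗[ℤ[X]] M, c ((1 : S) ⊗ₜ[R] x) = scalarMap f x :=
    cancelBaseChange_one_tmul f
  have hq : ∀ z, Module.Grassmannian.baseChangeMkQ S W.toSubmodule z =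
      W.toSubmodule.mkQ.baseChange S (c.symm z) := fun z => rfl
  rw [Module.Grassmannian.map_toSubmodule]
  apply le_antisymm
  · intro z hz
    replace hz : W.toSubmodule.mkQ.lTensor S (c.symm z) = 0 := hz
    obtain ⟨y, hy⟩ := exists_of_lTensor_mkQ_eq_zero S W.toSubmodule _ hz
    rw [LinearEquiv.eq_symm_apply] at hy
    rw [← hy]
    clear hy hz z
    induction y using TensorProduct.induction_on with
    | zero => simp
    | tmul s w =>
      rw [LinearMap.lTensor_tmul, ← mul_one s, ← smul_eq_mul, ← TensorProduct.smul_tmul', map_smul,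
        h]
      exact Submodule.smul_mem _ _ (Submodule.subset_span ⟨_, w.2, rfl⟩)
    | add x y hx hy => rw [map_add, map_add]; exact add_mem hx hy
  · rw [Submodule.span_le]
    rintro _ ⟨w, hw, rfl⟩
    have : c.symm (scalarMap f w) = (1 : S) ⊗ₜ[R] w := by rw [LinearEquiv.symm_apply_eq, h]
    rw [SetLike.mem_coe, LinearMap.mem_ker, hq, this, LinearMap.baseChange_tmul,
      Submodule.mkQ_apply, (Submodule.Quotient.mk_eq_zero _).2 hw, TensorProduct.tmul_zero]

/-- The image of a point of a Grassmannian under a linear automorphism. -/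
def mapGrassmannian {k : ℕ} {K : Type} [AddCommGroup K] [Module R K] (e : K ≃ₗ[R] K)
    (W : Module.Grassmannian R K k) : Module.Grassmannian R K k where
  toSubmodule := W.toSubmodule.map e.toLinearMap
  finite_quotient := Module.Finite.equiv (Submodule.Quotient.equiv W.toSubmodule _ e rfl)
  projective_quotient := Module.Projective.of_equiv (Submodule.Quotient.equiv W.toSubmodule _ e rfl)
  rankAtStalk_eq p := by
    refine Eq.trans ?_ (W.rankAtStalk_eq p)
    rw [Module.rankAtStalk_eq_of_equiv (Submodule.Quotient.equiv W.toSubmodule _ e rfl)]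

end BaseChange

/-! ### The chain of lattices with its two forms -/

/-- An `N`-tuple `(d_1, …, d_N)` of strictly positive integers with sum `g`. The entry `d_{j+1}`
is `d j`; the convention `d_{N+1} = g` completes it to a partition of `2g`. -/
structure SymplecticPartition (g N : ℕ) where
  d : Fin N → ℕ
  d_pos : ∀ j, 0 < d j
  sum_d : ∑ j, d j = g

namespace SymplecticPartition

variable {g N : ℕ} (D : SymplecticPartition g N)

/-- `d_1 + ⋯ + d_i` for `0 ≤ i ≤ N`. -/
def offset (i : Fin (N + 1)) : ℕ := ∑ j : Fin N with j.val < i.val, D.d j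

/-- `d_i` for `i ∈ ℤ/(N+1)ℤ`, where `d_0 = d_{N+1} = g`. -/
def step : Fin (N + 1) → ℕ := Fin.cons g D.d

/-- The lattice `𝒱_i = T ^ (d_1 + ⋯ + d_i) ℤ[t]^{2g}`, for `0 ≤ i ≤ N`. -/
def V (i : Fin (N + 1)) : Submodule ℤ[X] (Fin (2 * g) → ℤ[T;T⁻¹]) := lattice (2 * g) (D.offset i)

theorem offset_zero : D.offset 0 = 0 := by simp [offset]

theorem offset_last : D.offset (Fin.last N) = g := by
  refine Eq.trans ?_ D.sum_d
  rw [offset, Finset.filter_true_of_mem]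
  intro j _
  exact j.isLt

theorem offset_le {i j : Fin (N + 1)} (h : i.val ≤ j.val) : D.offset i ≤ D.offset j :=
  Finset.sum_le_sum_of_subset fun x hx => by
    simp only [Finset.mem_filter, Finset.mem_univ, true_and] at hx ⊢
    omega

theorem alpha_mem (i : Fin (N + 1)) (x : Fin (2 * g) → ℤ[T;T⁻¹]) (hx : x ∈ D.V i) :
    (if i = 0 then (Polynomial.X : ℤ[X]) else 1) • x ∈ D.V (i - 1) := by
  split_ifs with h
  · subst h
    rw [V, offset_zero] at hx
    refine X_smul_mem_lattice _ ?_ hx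
    refine (D.offset_le (j := Fin.last N) (Nat.lt_succ_iff.1 (Fin.isLt _))).trans ?_
    rw [offset_last]
    omega
  · rw [one_smul]
    refine lattice_anti _ (D.offset_le ?_) hx
    rw [Fin.coe_sub_one, if_neg h]
    omega

/-- The maps `α_i : 𝒱_i → 𝒱_{i-1}`, with `i ∈ ℤ/(N+1)ℤ`: the inclusion if `i ≠ 0`; the map `α_0` is
the composite of the identification `𝒱_0 ≃ 𝒱_{N+1} = t 𝒱_0` and the inclusion of `𝒱_{N+1}` in
`𝒱_N`, i.e. it is the multiplication by `t`. -/
def α (i : Fin (N + 1)) : D.V i →ₗ[ℤ[X]] D.V (i - 1) :=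
  (LinearMap.lsmul ℤ[X] (Fin (2 * g) → ℤ[T;T⁻¹])
    (if i = 0 then (Polynomial.X : ℤ[X]) else 1)).restrict (D.alpha_mem i)

/-- The form `⟨ , ⟩_0`: the restriction of the symplectic form to `𝒱_0`. -/
def formZero : LinearMap.BilinForm ℤ[X] (D.V 0) :=
  integralForm g (D.V 0) 1 <| by
    rintro ⟨x, hx⟩ ⟨y, hy⟩
    obtain ⟨v, rfl⟩ := hx
    obtain ⟨w, rfl⟩ := hy
    exact ⟨_, by rw [one_mul, laurentForm_latticeMap]⟩

/-- The form `⟨ , ⟩_N`: the restriction to `𝒱_N` of `t⁻¹` times the symplectic form. -/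
def formLast : LinearMap.BilinForm ℤ[X] (D.V (Fin.last N)) :=
  integralForm g (D.V (Fin.last N)) (LaurentPolynomial.T (-1)) <| by
    rintro ⟨x, hx⟩ ⟨y, hy⟩
    rw [V, offset_last] at hx hy
    obtain ⟨v, rfl⟩ := hx
    obtain ⟨w, rfl⟩ := hy
    refine ⟨v ⬝ᵥ (-symplecticMatrix g).mulVec w, ?_⟩
    rw [laurentForm_latticeMap, transpose_shift_mul_symplectic, Matrix.smul_mulVec,
      dotProduct_smul, smul_eq_mul, map_mul, ← mul_assoc,
      LaurentPolynomial.algebraMap_eq_toLaurent Polynomial.X, Polynomial.toLaurent_X,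
      ← LaurentPolynomial.T_add]
    simp

theorem algebraMap_formZero (x y : D.V 0) :
    algebraMap ℤ[X] ℤ[T;T⁻¹] (D.formZero x y) = laurentForm g x y := by
  rw [formZero, algebraMap_integralForm, one_mul]

theorem algebraMap_formLast (x y : D.V (Fin.last N)) :
    algebraMap ℤ[X] ℤ[T;T⁻¹] (D.formLast x y) = LaurentPolynomial.T (-1) * laurentForm g x y :=
  algebraMap_integralForm _ _ _ _ x y

end SymplecticPartition

/-! ### The local models, as functors of points on `ℤ[t]`-algebras -/

section LocalModels

variable {g N : ℕ} (D : SymplecticPartition g N)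
  (R : Type) [CommRing R] [Algebra ℤ[X] R]

/-- The `R`-points of the local model for `GL_{2g}`: families `(ω_i ⊆ R ⊗ 𝒱_i)_i` of local direct
factors of rank `g` such that `α_i(ω_i) ⊆ ω_{i-1}` for all `i ∈ ℤ/(N+1)ℤ`. (A point of
`Module.Grassmannian` is a submodule with locally free quotient of the given rank; since
`R ⊗ 𝒱_i` is free of rank `2g`, the submodules with locally free quotient of rank `g` are the local
direct factors of rank `g`.) -/
@[ext]
structure LocalModelGL where
  ω : ∀ i, Module.Grassmannian R (R ⊗[ℤ[X]] D.V i) g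
  map_le : ∀ i, (ω i).toSubmodule.map ((D.α i).baseChange R) ≤ (ω (i - 1)).toSubmodule

/-- The `R`-points of the local model for `Sp_{2g}`: the points of the local model for `GL_{2g}` for
which `ω_0` and `ω_N` are totally isotropic. -/
@[ext]
structure LocalModelSp extends LocalModelGL D R where
  isotropic_zero : ∀ x ∈ (ω 0).toSubmodule, ∀ y ∈ (ω 0).toSubmodule,
    D.formZero.baseChange R x y = 0
  isotropic_last : ∀ x ∈ (ω (Fin.last N)).toSubmodule, ∀ y ∈ (ω (Fin.last N)).toSubmodule,
    D.formLast.baseChange R x y = 0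

/-- The direct factor `Ω = R ^ g` of `R ^ {2g}`, spanned by the first `g` basis vectors. -/
def standardFactor (g : ℕ) : Submodule R (Fin (2 * g) → R) where
  carrier := {v | ∀ j : Fin (2 * g), g ≤ j.val → v j = 0}
  add_mem' hv hw j hj := by rw [Pi.add_apply, hv j hj, hw j hj, add_zero]
  zero_mem' _ _ := rfl
  smul_mem' c v hv j hj := by rw [Pi.smul_apply, hv j hj, smul_zero]

/-- The `R`-points of the rigidified local model for `GL_{2g}`: a point of the local model together
with isomorphisms `φ_i` of the filtered module `ω_i ⊆ R ⊗ 𝒱_i` with `Ω ⊆ R ^ {2g}`. -/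
@[ext]
structure RigidifiedGL extends LocalModelGL D R where
  φ : ∀ i, (R ⊗[ℤ[X]] D.V i) ≃ₗ[R] (Fin (2 * g) → R)
  map_φ : ∀ i, (ω i).toSubmodule.map (φ i).toLinearMap = standardFactor R g

/-- The `R`-points of the rigidified local model for `Sp_{2g}`: the fibre product of the local
model for `Sp_{2g}` and the rigidified local model for `GL_{2g}` over the local model for
`GL_{2g}`. -/
@[ext]
structure RigidifiedSp extends LocalModelSp D R, RigidifiedGL D R

/-- The `R`-points of the group `𝒫_t` of automorphisms of the system `(𝒱_i, α_i)`. -/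
def groupP : Subgroup (∀ i, (R ⊗[ℤ[X]] D.V i) ≃ₗ[R] (R ⊗[ℤ[X]] D.V i)) where
  carrier := {γ | ∀ i x, γ (i - 1) ((D.α i).baseChange R x) = (D.α i).baseChange R (γ i x)}
  mul_mem' {γ δ} hγ hδ i x := by
    simp only [Pi.mul_apply, LinearEquiv.mul_apply, hδ i x, hγ i (δ i x)]
  one_mem' _ _ := rfl
  inv_mem' {γ} hγ i x := by
    have h := hγ i ((γ i).symm x)
    rw [LinearEquiv.apply_symm_apply] at h
    exact (LinearEquiv.symm_apply_eq _).2 h.symm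

/-- The `R`-points of the group `𝒬_t` of automorphisms of `(𝒱_i, α_i, ⟨ , ⟩_0, ⟨ , ⟩_N)`. -/
def groupQ : Subgroup (∀ i, (R ⊗[ℤ[X]] D.V i) ≃ₗ[R] (R ⊗[ℤ[X]] D.V i)) where
  carrier := {γ | γ ∈ groupP D R ∧
    (∀ x y, D.formZero.baseChange R (γ 0 x) (γ 0 y) = D.formZero.baseChange R x y) ∧
    (∀ x y, D.formLast.baseChange R (γ (Fin.last N) x) (γ (Fin.last N) y) =
      D.formLast.baseChange R x y)}
  mul_mem' {γ δ} hγ hδ := ⟨mul_mem hγ.1 hδ.1,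
    fun x y => (hγ.2.1 _ _).trans (hδ.2.1 x y), fun x y => (hγ.2.2 _ _).trans (hδ.2.2 x y)⟩
  one_mem' := ⟨one_mem _, fun _ _ => rfl, fun _ _ => rfl⟩
  inv_mem' {γ} hγ := by
    refine ⟨inv_mem hγ.1, fun x y => ?_, fun x y => ?_⟩
    · have h := hγ.2.1 ((γ 0).symm x) ((γ 0).symm y)
      rw [LinearEquiv.apply_symm_apply, LinearEquiv.apply_symm_apply] at h
      exact h.symm
    · have h := hγ.2.2 ((γ (Fin.last N)).symm x) ((γ (Fin.last N)).symm y)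
      rw [LinearEquiv.apply_symm_apply, LinearEquiv.apply_symm_apply] at h
      exact h.symm

variable {D R} in
/-- The left action of `𝒬_t` on the rigidified local model:
`γ · (ω_i, φ_i)_i = (γ_i(ω_i), φ_i ∘ γ_i⁻¹)_i`. -/
def RigidifiedSp.act (γ : groupQ D R) (x : RigidifiedSp D R) : RigidifiedSp D R where
  ω i := mapGrassmannian (γ.1 i) (x.ω i)
  map_le i := by
    rintro _ ⟨_, ⟨v, hv, rfl⟩, rfl⟩
    exact ⟨_, x.map_le i ⟨v, hv, rfl⟩, γ.2.1 i v⟩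
  isotropic_zero := by
    rintro _ ⟨v, hv, rfl⟩ _ ⟨w, hw, rfl⟩
    exact (γ.2.2.1 v w).trans (x.isotropic_zero v hv w hw)
  isotropic_last := by
    rintro _ ⟨v, hv, rfl⟩ _ ⟨w, hw, rfl⟩
    exact (γ.2.2.2 v w).trans (x.isotropic_last v hv w hw)
  φ i := (γ.1 i).symm ≪≫ₗ x.φ i
  map_φ i := by
    rw [← x.map_φ i]
    change ((x.ω i).toSubmodule.map (γ.1 i).toLinearMap).map _ = _
    rw [← Submodule.map_comp]
    congr 1
    ext v
    simp

/-! ### The schemes `μ` and `Σ` -/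

/-- The `R`-points of `μ^{P,N}`: families `(Π_0, …, Π_N)` of `2g × 2g` matrices, indexed by
`ℤ/(N+1)ℤ`, with `Π_i` in the Lie algebra `𝔓` of `P` (block upper triangular matrices with blocks
of size `g`) minus its zero section, such that `Π_i Π_{i+1} ⋯ Π_{i+N} = t Id` for all `i`. -/
@[ext]
structure MuPoint (g N : ℕ) (R : Type) [CommRing R] [Algebra ℤ[X] R] where
  mat : Fin (N + 1) → Matrix (Fin (2 * g)) (Fin (2 * g)) R
  parabolic : ∀ i (r c : Fin (2 * g)), g ≤ r.val → c.val < g → mat i r c = 0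
  nowhere_zero : ∀ i, Ideal.span {a | ∃ r c, a = mat i r c} = ⊤
  prod_eq : ∀ i, (List.ofFn fun k : Fin (N + 1) => mat (i + k)).prod =
    algebraMap ℤ[X] R Polynomial.X • (1 : Matrix (Fin (2 * g)) (Fin (2 * g)) R)

/-- The `R`-points of the open subscheme `μ^{P,N}_{(d_i)}` of `μ^{P,N}`, where for all
`i ∈ ℤ/(N+1)ℤ` the minors of size `2g - d_i` of `Π_i` generate the unit ideal. -/
@[ext]
structure MuDPoint extends MuPoint g N R where
  minors : ∀ i, Ideal.span {a | ∃ r c : Fin (2 * g - D.step i) → Fin (2 * g),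
    a = ((mat i).submatrix r c).det} = ⊤

/-- The matrix `A` is the Gram matrix of a nondegenerate symplectic (i.e. perfect alternating)
pairing on `R ^ {2g}`, for which `Ω` is totally isotropic. -/
structure IsSymplecticGram (g : ℕ) {R : Type} [CommRing R]
    (A : Matrix (Fin (2 * g)) (Fin (2 * g)) R) : Prop where
  diag : ∀ i, A i i = 0
  skew : A.transpose = -A
  nondegenerate : IsUnit A.det
  isotropic : ∀ i j : Fin (2 * g), i.val < g → j.val < g → A i j = 0

/-- The `R`-points of `Σ^{g,N}`: a point `(Π_i)` of `μ^{P,N}` together with nondegenerate symplectic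
pairings `(x, y)_0 = xᵀ A₀ y` on `V_0 = R ^ {2g}` and `(x, y)_N = xᵀ A_N y` on `V_N = R ^ {2g}`, for
which `Ω` is totally isotropic, such that `(Π_0 x, y)_N = (x, Π_1 ⋯ Π_N y)_0` for `x ∈ V_0` and
`y ∈ V_N`, i.e. such that `Π_0ᵀ A_N = A₀ Π_1 ⋯ Π_N`. -/
@[ext]
structure SigmaPoint (g N : ℕ) (R : Type) [CommRing R] [Algebra ℤ[X] R] extends MuPoint g N R where
  A₀ : Matrix (Fin (2 * g)) (Fin (2 * g)) R
  A_N : Matrix (Fin (2 * g)) (Fin (2 * g)) R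
  symplectic_zero : IsSymplecticGram g A₀
  symplectic_last : IsSymplecticGram g A_N
  adjoint : (mat 0).transpose * A_N = A₀ * (List.ofFn fun k : Fin N => mat k.succ).prod

/-- The `R`-points of the fibre product `Σ^{g,N}_{(d_i)}` of `Σ^{g,N}` and `μ^{P,N}_{(d_i)}` over
`μ^{P,N}`. -/
@[ext]
structure SigmaDPoint extends SigmaPoint g N R, MuDPoint D R

variable {D R} in
/-- The system `σ = ((Π_i)_i, ( , )_0, ( , )_N)` is the one deduced from
`((𝒱_i)_i, (α_i)_i, ⟨ , ⟩_0, ⟨ , ⟩_N)` by transport of structure along the isomorphisms `φ_i` of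
the point `x` of the rigidified local model: `Π_i = φ_{i-1} α_i φ_i⁻¹`,
`(φ_0 v, φ_0 w)_0 = ⟨v, w⟩_0` and `(φ_N v, φ_N w)_N = ⟨v, w⟩_N`. -/
structure IsTransport (x : RigidifiedSp D R) (σ : SigmaDPoint D R) : Prop where
  mat_eq : ∀ i v, (σ.mat i).mulVec (x.φ i v) = x.φ (i - 1) ((D.α i).baseChange R v)
  zero_eq : ∀ v w, x.φ 0 v ⬝ᵥ σ.A₀.mulVec (x.φ 0 w) = D.formZero.baseChange R v w
  last_eq : ∀ v w, x.φ (Fin.last N) v ⬝ᵥ σ.A_N.mulVec (x.φ (Fin.last N) w) =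
    D.formLast.baseChange R v w

end LocalModels

/-! ### Functoriality in the `ℤ[t]`-algebra -/

section Functoriality

variable {g N : ℕ} {D : SymplecticPartition g N}
  {R S : Type} [CommRing R] [Algebra ℤ[X] R] [CommRing S] [Algebra ℤ[X] S]

theorem form_eq_zero_of_mem_span {M : Type} [AddCommGroup M] [Module ℤ[X] M]
    (f : R →ₐ[ℤ[X]] S) (B : LinearMap.BilinForm ℤ[X] M) (W : Submodule R (R ⊗[ℤ[X]] M))
    (h : ∀ x ∈ W, ∀ y ∈ W, B.baseChange R x y = 0) :
    ∀ x ∈ Submodule.span S (scalarMap f '' (W : Set (R ⊗[ℤ[X]] M))),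
      ∀ y ∈ Submodule.span S (scalarMap f '' (W : Set (R ⊗[ℤ[X]] M))),
        B.baseChange S x y = 0 := by
  intro x hx y hy
  induction hx, hy using Submodule.span_induction₂ with
  | mem_mem x y hx hy =>
    obtain ⟨v, hv, rfl⟩ := hx
    obtain ⟨w, hw, rfl⟩ := hy
    rw [form_scalarMap, h v hv w hw, map_zero]
  | zero_left => simp
  | zero_right => simp
  | add_left x y z _ _ _ h₁ h₂ => rw [map_add, LinearMap.add_apply, h₁, h₂, add_zero]
  | add_right x y z _ _ _ h₁ h₂ => rw [map_add, h₁, h₂, add_zero]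
  | smul_left r x y _ _ h₁ => rw [map_smul, LinearMap.smul_apply, h₁, smul_zero]
  | smul_right r x y _ _ h₁ => rw [map_smul, h₁, smul_zero]

theorem span_image_standardFactor (f : R →ₐ[ℤ[X]] S) (g : ℕ) :
    Submodule.span S ((fun v => f ∘ v) '' (standardFactor R g : Set (Fin (2 * g) → R))) =
      standardFactor S g := by
  apply le_antisymm
  · rw [Submodule.span_le]
    rintro _ ⟨v, hv, rfl⟩ j hj
    change f (v j) = 0
    rw [hv j hj, map_zero]
  · intro v hv
    rw [pi_eq_sum_univ' v]
    refine Submodule.sum_mem _ fun j _ => ?_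
    by_cases hj : g ≤ j.val
    · rw [hv j hj, zero_smul]
      exact Submodule.zero_mem _
    · refine Submodule.smul_mem _ _ (Submodule.subset_span ⟨Pi.single j 1, ?_, ?_⟩)
      · intro i hi
        rw [Pi.single_eq_of_ne]
        rintro rfl
        exact hj hi
      · funext i
        by_cases h : i = j
        · subst h; simp
        · simp [h]

/-- Base change of points of the rigidified local model. -/
def RigidifiedSp.map (f : R →ₐ[ℤ[X]] S) (x : RigidifiedSp D R) : RigidifiedSp D S where
  ω i := Module.Grassmannian.map f (x.ω i)
  map_le i := by
    rw [grassmannian_map_eq_span, grassmannian_map_eq_span, Submodule.map_span_le]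
    rintro _ ⟨v, hv, rfl⟩
    rw [baseChange_scalarMap]
    exact Submodule.subset_span ⟨_, x.map_le i ⟨v, hv, rfl⟩, rfl⟩
  isotropic_zero := by
    rw [grassmannian_map_eq_span]
    exact form_eq_zero_of_mem_span f D.formZero _ x.isotropic_zero
  isotropic_last := by
    rw [grassmannian_map_eq_span]
    exact form_eq_zero_of_mem_span f D.formLast _ x.isotropic_last
  φ i := mapFraming f (x.φ i)
  map_φ i := by
    rw [grassmannian_map_eq_span, Submodule.map_span, ← span_image_standardFactor f g,
      ← x.map_φ i]
    congr 1
    ext v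
    constructor
    · rintro ⟨_, ⟨w, hw, rfl⟩, rfl⟩
      exact ⟨x.φ i w, ⟨w, hw, rfl⟩, (mapFraming_scalarMap f (x.φ i) w).symm⟩
    · rintro ⟨_, ⟨w, hw, rfl⟩, rfl⟩
      exact ⟨_, ⟨w, hw, rfl⟩, mapFraming_scalarMap f (x.φ i) w⟩

/-- Base change of points of `𝒬_t`. -/
def groupQMap (f : R →ₐ[ℤ[X]] S) (γ : groupQ D R) : groupQ D S :=
  ⟨fun i => mapEquiv f (γ.1 i), by
    refine ⟨fun i x => ?_, fun x y => ?_, fun x y => ?_⟩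
    · refine LinearMap.congr_fun (f := (mapEquiv f (γ.1 (i - 1))).toLinearMap ∘ₗ
        (D.α i).baseChange S) (g := (D.α i).baseChange S ∘ₗ (mapEquiv f (γ.1 i)).toLinearMap)
        (ext_scalarMap f fun v => ?_) x
      simp only [LinearMap.comp_apply, LinearEquiv.coe_coe, baseChange_scalarMap,
        mapEquiv_scalarMap, γ.2.1 i v]
    · refine LinearMap.congr_fun₂ (f := (D.formZero.baseChange S).compl₁₂
        (mapEquiv f (γ.1 0)).toLinearMap (mapEquiv f (γ.1 0)).toLinearMap)
        (g := D.formZero.baseChange S) (ext_scalarMap f fun v => ext_scalarMap f fun w => ?_) x y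
      simp only [LinearMap.compl₁₂_apply, LinearEquiv.coe_coe, mapEquiv_scalarMap, form_scalarMap,
        γ.2.2.1 v w]
    · refine LinearMap.congr_fun₂ (f := (D.formLast.baseChange S).compl₁₂
        (mapEquiv f (γ.1 (Fin.last N))).toLinearMap (mapEquiv f (γ.1 (Fin.last N))).toLinearMap)
        (g := D.formLast.baseChange S) (ext_scalarMap f fun v => ext_scalarMap f fun w => ?_) x y
      simp only [LinearMap.compl₁₂_apply, LinearEquiv.coe_coe, mapEquiv_scalarMap, form_scalarMap,
        γ.2.2.2 v w]⟩

theorem RigidifiedSp.map_id (x : RigidifiedSp D R) :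
    RigidifiedSp.map (AlgHom.id ℤ[X] R) x = x := by
  apply RigidifiedSp.ext
  · funext i
    exact Module.Grassmannian.map_id g (CommAlgCat.of ℤ[X] R) (x.ω i)
  · funext i
    refine LinearEquiv.ext fun v => ?_
    have h := mapFraming_scalarMap (AlgHom.id ℤ[X] R) (x.φ i) v
    rw [scalarMap_id] at h
    exact h

theorem RigidifiedSp.map_comp {U : Type} [CommRing U] [Algebra ℤ[X] U] (f : R →ₐ[ℤ[X]] S)
    (h : S →ₐ[ℤ[X]] U) (x : RigidifiedSp D R) :
    RigidifiedSp.map (h.comp f) x = RigidifiedSp.map h (RigidifiedSp.map f x) := by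
  apply RigidifiedSp.ext
  · funext i
    exact Module.Grassmannian.map_comp g f h (x.ω i)
  · funext i
    refine LinearEquiv.toLinearMap_injective (ext_scalarMap (h.comp f) fun v => ?_)
    refine (mapFraming_scalarMap (h.comp f) (x.φ i) v).trans ?_
    rw [scalarMap_comp]
    refine Eq.trans ?_ (mapFraming_scalarMap h (mapFraming f (x.φ i)) (scalarMap f v)).symm
    rw [mapFraming_scalarMap]
    rfl

theorem groupQMap_id (γ : groupQ D R) : groupQMap (AlgHom.id ℤ[X] R) γ = γ := by
  refine Subtype.ext (funext fun i => LinearEquiv.ext fun v => ?_)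
  have h := mapEquiv_scalarMap (AlgHom.id ℤ[X] R) (γ.1 i) v
  rw [scalarMap_id, scalarMap_id] at h
  exact h

theorem groupQMap_comp {U : Type} [CommRing U] [Algebra ℤ[X] U] (f : R →ₐ[ℤ[X]] S)
    (h : S →ₐ[ℤ[X]] U) (γ : groupQ D R) :
    groupQMap (h.comp f) γ = groupQMap h (groupQMap f γ) := by
  refine Subtype.ext (funext fun i => LinearEquiv.toLinearMap_injective
    (ext_scalarMap (h.comp f) fun v => ?_))
  refine (mapEquiv_scalarMap (h.comp f) (γ.1 i) v).trans ?_
  rw [scalarMap_comp, scalarMap_comp]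
  refine Eq.trans ?_ (mapEquiv_scalarMap h (mapEquiv f (γ.1 i)) (scalarMap f v)).symm
  rw [mapEquiv_scalarMap]

theorem map_ideal_span_eq_top (f : R →ₐ[ℤ[X]] S) {s : Set R} {t : Set S}
    (h : Ideal.span s = ⊤) (hst : ∀ a ∈ s, f a ∈ t) : Ideal.span t = ⊤ := by
  rw [eq_top_iff, ← Ideal.map_top f, ← h, Ideal.map_span, Ideal.span_le]
  rintro _ ⟨a, ha, rfl⟩
  exact Ideal.subset_span (hst a ha)

theorem IsSymplecticGram.map {A : Matrix (Fin (2 * g)) (Fin (2 * g)) R}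
    (hA : IsSymplecticGram g A) (f : R →ₐ[ℤ[X]] S) : IsSymplecticGram g (A.map f) where
  diag i := by rw [Matrix.map_apply, hA.diag, map_zero]
  skew := by
    rw [← Matrix.transpose_map, hA.skew]
    ext i j
    simp
  nondegenerate := by
    have h := hA.nondegenerate.map f
    rwa [AlgHom.map_det] at h
  isotropic i j hi hj := by rw [Matrix.map_apply, hA.isotropic i j hi hj, map_zero]

theorem map_list_prod_ofFn (f : R →ₐ[ℤ[X]] S) {m k : ℕ} (P : Fin k → Matrix (Fin m) (Fin m) R) :
    (List.ofFn fun i => (P i).map f).prod = ((List.ofFn P).prod).map f := by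
  have h := map_list_prod (f.mapMatrix (m := Fin m)) (List.ofFn P)
  rw [List.map_ofFn] at h
  exact h.symm

/-- Base change of points of `Σ^{g,N}_{(d_i)}`. -/
def SigmaDPoint.map (f : R →ₐ[ℤ[X]] S) (σ : SigmaDPoint D R) : SigmaDPoint D S where
  mat i := (σ.mat i).map f
  parabolic i r c hr hc := by rw [Matrix.map_apply, σ.parabolic i r c hr hc, map_zero]
  nowhere_zero i := map_ideal_span_eq_top f (σ.nowhere_zero i) <| by
    rintro _ ⟨r, c, rfl⟩
    exact ⟨r, c, rfl⟩
  prod_eq i := by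
    rw [map_list_prod_ofFn f (fun k => σ.mat (i + k)), σ.prod_eq i]
    ext r c
    by_cases h : r = c
    · subst h
      rw [Matrix.map_apply, Matrix.smul_apply, Matrix.smul_apply, Matrix.one_apply_eq,
        Matrix.one_apply_eq, smul_eq_mul, smul_eq_mul, mul_one, mul_one, AlgHom.commutes]
    · rw [Matrix.map_apply, Matrix.smul_apply, Matrix.smul_apply, Matrix.one_apply_ne h,
        Matrix.one_apply_ne h, smul_zero, smul_zero, map_zero]
  minors i := map_ideal_span_eq_top f (σ.minors i) <| by
    rintro _ ⟨r, c, rfl⟩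
    exact ⟨r, c, by rw [AlgHom.map_det]; rfl⟩
  A₀ := σ.A₀.map f
  A_N := σ.A_N.map f
  symplectic_zero := σ.symplectic_zero.map f
  symplectic_last := σ.symplectic_last.map f
  adjoint := by
    rw [map_list_prod_ofFn f (fun k : Fin N => σ.mat k.succ), ← Matrix.transpose_map]
    have h := congrArg (f.mapMatrix (m := Fin (2 * g))) σ.adjoint
    rwa [map_mul, map_mul] at h

variable (D)

/-- The functor of points of the rigidified local model for `Sp_{2g}`. -/
def rigidifiedFunctor : CommAlgCat.{0} ℤ[X] ⥤ Type where
  obj R := RigidifiedSp D R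
  map f := ↾(RigidifiedSp.map f.hom)
  map_id R := by
    refine ConcreteCategory.hom_ext _ _ fun x => ?_
    exact RigidifiedSp.map_id x
  map_comp f h := by
    refine ConcreteCategory.hom_ext _ _ fun x => ?_
    exact RigidifiedSp.map_comp f.hom h.hom x

/-- The functor of points of `𝒬_t`. -/
def groupQFunctor : CommAlgCat.{0} ℤ[X] ⥤ Type where
  obj R := groupQ D R
  map f := ↾(groupQMap f.hom)
  map_id R := by
    refine ConcreteCategory.hom_ext _ _ fun x => ?_
    exact groupQMap_id x
  map_comp f h := by
    refine ConcreteCategory.hom_ext _ _ fun x => ?_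
    exact groupQMap_comp f.hom h.hom x

/-- The functor of points of `Σ^{g,N}_{(d_i)}`. -/
def sigmaDFunctor : CommAlgCat.{0} ℤ[X] ⥤ Type where
  obj R := SigmaDPoint D R
  map f := ↾(SigmaDPoint.map f.hom)
  map_id _ := rfl
  map_comp _ _ := rfl

end Functoriality

/-! ### Schemes over the affine line and principal homogeneous spaces -/

/-- The functor of points, on `ℤ[t]`-algebras, of a scheme over the affine line `Spec ℤ[t]`. -/
def pointsFunctor (Y : Over (Spec (CommRingCat.of ℤ[X]))) : CommAlgCat.{0} ℤ[X] ⥤ Type :=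
  (algSpec (CommRingCat.of ℤ[X])).rightOp ⋙ yoneda.obj Y

section Points

variable {g N : ℕ} {D : SymplecticPartition g N} {Y : Over (Spec (CommRingCat.of ℤ[X]))}
  {R : CommAlgCat.{0} ℤ[X]}

/-- The element of `𝒬_t(R)` corresponding to a morphism `Spec R ⟶ Y`, when `Y` represents `𝒬_t`. -/
def toGroupQ (ρ : pointsFunctor Y ≅ groupQFunctor D)
    (y : (algSpec (CommRingCat.of ℤ[X])).obj (.op R) ⟶ Y) : groupQ D R :=
  ρ.hom.app R y

/-- The `R`-point of the rigidified local model corresponding to a morphism `Spec R ⟶ Y`, when `Y`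
represents the rigidified local model. -/
def toRigidified (ρ : pointsFunctor Y ≅ rigidifiedFunctor D)
    (y : (algSpec (CommRingCat.of ℤ[X])).obj (.op R) ⟶ Y) : RigidifiedSp D R :=
  ρ.hom.app R y

/-- The `R`-point of `Σ^{g,N}_{(d_i)}` corresponding to a morphism `Spec R ⟶ Y`, when `Y`
represents `Σ^{g,N}_{(d_i)}`. -/
def toSigmaD (ρ : pointsFunctor Y ≅ sigmaDFunctor D)
    (y : (algSpec (CommRingCat.of ℤ[X])).obj (.op R) ⟶ Y) : SigmaDPoint D R :=
  ρ.hom.app R y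

end Points

/-- Let `G` be a group scheme over a base `B`, let `π : Y ⟶ Z` be a morphism of `B`-schemes and let
`a : G ×_B Y ⟶ Y` be a morphism. This says that `a` is a left action of `G` on the `Z`-scheme `Y`
which makes it a (Zariski locally trivial) principal homogeneous space: `(γ, y) ↦ (γ y, y)` is
an isomorphism of `G ×_B Y` with `Y ×_Z Y`, and `π` has sections locally on `Z`. -/
structure IsPrincipalHomogeneousSpace {B : Scheme.{0}} {G Y Z : Over B} [GrpObj G]
    (a : G ⊗ Y ⟶ Y) (π : Y ⟶ Z) : Prop where
  one_act : lift (toUnit Y ≫ MonObj.one) (𝟙 Y) ≫ a = 𝟙 Y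
  mul_act : (MonObj.mul ▷ Y) ≫ a = (α_ G G Y).hom ≫ (G ◁ a) ≫ a
  act_comp : a ≫ π = snd G Y ≫ π
  isPullback : IsPullback a (snd G Y) π π
  exists_section : ∀ z : Z.left, ∃ U : Z.left.Opens, z ∈ U ∧
    ∃ s : (U : Scheme) ⟶ Y.left, s ≫ π.left = U.ι

end SymplecticLocalModel
end

open SymplecticLocalModel

/-!
The three functors are described by matrices. In the bases `T ^ (d_1 + ⋯ + d_i) e_c` of the lattices
`𝒱_i`, the map `α_i` has the matrix `T ^ d_i`, and both forms have the Gram matrix `± J`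
(`SymplecticPartition.coord_α`, `formZero_eq`, `formLast_eq`). A point of `𝒬_t` or of the rigidified
local model is then a family of matrices, together with their inverses, which satisfies polynomial
equations: indeed the subspace `ω_i = φ_i⁻¹(Ω)` is determined by `φ_i`. So these two functors are
represented by affine schemes of finite type (`exists_corepresentableBy`). The functor
`Σ^{g,N}_{(d_i)}` is represented by the open subscheme of an affine scheme on which the minors of the
`Π_i` and the determinants of the two forms generate the unit ideal
(`IsOpenSubfunctor.exists_pointsIso`). A morphism from a scheme `Y` to an affine scheme is a point
with values in the global functions of `Y`, so the group law, the action and the morphism `π` are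
obtained from their descriptions on points.

If `(ω_i, φ_i)` and `(ω'_i, φ'_i)` have the same image under `π`, then `(φ_i⁻¹ φ'_i)_i` is the unique
element of `𝒬_t` which takes the second point to the first (`RigidifiedSp.existsUnique_act`); this
gives the isomorphism of `𝒬_t × M` with `M ×_Σ M`, where `M` is the rigidified local model.

The remaining point is the existence of local sections. As the source of `π` is of finite type and
`Σ^{g,N}_{(d_i)}` is noetherian, a section over the spectrum of a local ring of `Σ^{g,N}_{(d_i)}`
spreads out to a neighbourhood (`exists_section_of_stalk`), so that it suffices to show that each
point of `Σ^{g,N}_{(d_i)}` over a local ring `R` lifts (`SigmaDPoint.exists_isTransport`), i.e. that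
all chains `R^{2g} → ⋯ → R^{2g}` with forms as in the definition are isomorphic to the chain of the
`R ⊗ 𝒱_i` (`PolarizedChain.exists_isTrivialization`).

* If `t` is invertible in `R`, the maps `Π_i` are isomorphisms, the chain is determined by its term of
  index `0`, and a symplectic basis of this term adapted to `Ω` gives the trivialisation.
* If `t` is in the maximal ideal, the condition on minors says that the cokernel of `Π_i` is generated
  by `d_i` elements. Lifts of generators of the cokernels provide `g` vectors of the term of index `0`
  which, together with the image of the term of index `N`, generate it
  (`PolarizedChain.exists_isAdapted`). The adjunction between the two halves `Π_0` and `Π_1 ⋯ Π_N` of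
  the chain shows that these vectors have a dual family in the term of index `N`; as the form on
  vectors coming from this term is divisible by `t`, a Gram–Schmidt process in which all the pivots
  are invertible makes both families isotropic (`exists_isotropic_correction`,
  `exists_isotropic_dual`). The two families together form the symplectic bases that define the
  trivialisation.
-/

noncomputable section

namespace SymplecticLocalModel

/-! ### Alternating forms over local rings -/

section AlternatingForms

variable {R : Type} [CommRing R]

theorem toBilin'_isAlt {n : ℕ} {A : Matrix (Fin n) (Fin n) R} (hd : ∀ i, A i i = 0)
    (hs : A.transpose = -A) : (Matrix.toBilin' A).IsAlt := by
  intro x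
  rw [Matrix.toBilin'_apply, ← Finset.sum_product']
  refine Finset.sum_involution (fun p _ => p.swap) ?_ ?_ (fun _ _ => Finset.mem_univ _)
    (fun _ _ => Prod.swap_swap _)
  · rintro ⟨i, j⟩ -
    have h := congrFun (congrFun hs i) j
    rw [Matrix.transpose_apply, Matrix.neg_apply] at h
    simp only [Prod.swap, h]
    ring
  · rintro ⟨i, j⟩ - h e
    obtain rfl : j = i := congrArg Prod.fst e
    exact h (by simp [hd])

theorem isUnit_det_of_sub_one_mem [IsLocalRing R] {n : ℕ} (M : Matrix (Fin n) (Fin n) R)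
    (h : ∀ i j, M i j - (1 : Matrix (Fin n) (Fin n) R) i j ∈ IsLocalRing.maximalIdeal R) :
    IsUnit M.det := by
  have h1 : M.map (IsLocalRing.residue R) = 1 := by
    ext i j
    have h2 : IsLocalRing.residue R (M i j - (1 : Matrix (Fin n) (Fin n) R) i j) = 0 :=
      Ideal.Quotient.eq_zero_iff_mem.2 (h i j)
    rw [map_sub, sub_eq_zero] at h2
    rw [Matrix.map_apply, h2, Matrix.one_apply, Matrix.one_apply]
    split_ifs <;> simp
  refine (isUnit_map_iff (IsLocalRing.residue R) _).1 ?_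
  rw [RingHom.map_det, RingHom.mapMatrix_apply, h1, Matrix.det_one]
  exact isUnit_one

/-- Gram–Schmidt against a family `b` which is dual to `f` and isotropic modulo the maximal ideal:
`f` becomes isotropic after adding combinations of the `b j`. -/
theorem exists_isotropic_correction [IsLocalRing R] {V : Type} [AddCommGroup V] [Module R V]
    (ω : LinearMap.BilinForm R V) (hω : ω.IsAlt) {n : ℕ} (f b : Fin n → V)
    (hfb : ∀ i j, ω (f i) (b j) - (1 : Matrix (Fin n) (Fin n) R) i j ∈ IsLocalRing.maximalIdeal R)
    (hbb : ∀ i j, ω (b i) (b j) ∈ IsLocalRing.maximalIdeal R) :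
    ∃ f' : Fin n → V, (∀ i, f' i - f i ∈ Submodule.span R (Set.range b)) ∧
      ∀ i j, ω (f' i) (f' j) = 0 := by
  induction n with
  | zero => exact ⟨f, fun i => i.elim0, fun i => i.elim0⟩
  | succ n ih =>
    obtain ⟨f', hf', h0⟩ := ih (fun i => f i.castSucc) (fun i => b i.castSucc)
      (fun i j => by simpa [Matrix.one_apply] using hfb i.castSucc j.castSucc)
      (fun i j => hbb _ _)
    let M : Matrix (Fin n) (Fin n) R := Matrix.of fun i j => ω (f' i) (b j.castSucc)
    have hM : IsUnit M.det := by
      refine isUnit_det_of_sub_one_mem M fun i j => ?_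
      have h1 : ∀ x ∈ Submodule.span R (Set.range fun i : Fin n => b i.castSucc),
          ω x (b j.castSucc) ∈ IsLocalRing.maximalIdeal R := by
        intro x hx
        induction hx using Submodule.span_induction with
        | mem x hx => obtain ⟨k, rfl⟩ := hx; exact hbb _ _
        | zero => simp
        | add x y _ _ hx hy => rw [map_add, LinearMap.add_apply]; exact add_mem hx hy
        | smul r x _ hx =>
          rw [map_smul, LinearMap.smul_apply]; exact Ideal.mul_mem_left _ _ hx
      have h2 := add_mem (h1 _ (hf' i)) (hfb i.castSucc j.castSucc)
      simpa [M, Matrix.one_apply] using h2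
    let c : Fin n → R := M⁻¹.mulVec fun i => -ω (f' i) (f (Fin.last n))
    let x : V := f (Fin.last n) + ∑ j, c j • b j.castSucc
    have hx : ∀ i, ω (f' i) x = 0 := by
      intro i
      have h1 : M.mulVec c = fun i => -ω (f' i) (f (Fin.last n)) := by
        rw [Matrix.mulVec_mulVec, Matrix.mul_nonsing_inv _ hM, Matrix.one_mulVec]
      have h2 := congrFun h1 i
      rw [map_add, map_sum, ← neg_eq_iff_add_eq_zero, ← h2]
      simp only [map_smul, smul_eq_mul, Matrix.mulVec, dotProduct, M, Matrix.of_apply]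
      exact Finset.sum_congr rfl fun j _ => mul_comm _ _
    refine ⟨Fin.snoc f' x, fun i => ?_, fun i j => ?_⟩
    · refine Fin.lastCases ?_ (fun i => ?_) i
      · rw [Fin.snoc_last, add_sub_cancel_left]
        exact Submodule.sum_mem _ fun j _ =>
          Submodule.smul_mem _ _ (Submodule.subset_span ⟨_, rfl⟩)
      · rw [Fin.snoc_castSucc]
        refine Submodule.span_mono ?_ (hf' i)
        rintro _ ⟨k, rfl⟩
        exact ⟨_, rfl⟩
    · refine Fin.lastCases ?_ (fun i => ?_) i <;> refine Fin.lastCases ?_ (fun j => ?_) j <;>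
        simp only [Fin.snoc_last, Fin.snoc_castSucc]
      · exact hω x
      · rw [← hω.neg_eq, hx, neg_zero]
      · exact hx i
      · exact h0 i j

theorem exists_dual_family {n k : ℕ} (A : Matrix (Fin n) (Fin n) R) (hA : IsUnit A.det)
    (b : Fin k → Fin n → R) (r : Fin k → Fin n)
    (hb : IsUnit (Matrix.of fun i j => b j (r i)).det) :
    ∃ h : Fin k → Fin n → R, ∀ j i,
      Matrix.toBilin' A (b j) (h i) = (1 : Matrix (Fin k) (Fin k) R) j i := by
  set M : Matrix (Fin k) (Fin k) R := Matrix.of fun i j => b j (r i) with hM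
  refine ⟨fun i => A⁻¹.mulVec (∑ l, M⁻¹ i l • Pi.single (r l) 1), fun j i => ?_⟩
  have h1 : (M⁻¹ * M) i j = (1 : Matrix (Fin k) (Fin k) R) i j := by
    rw [Matrix.nonsing_inv_mul _ hb]
  rw [Matrix.toBilin'_apply', Matrix.mulVec_mulVec, Matrix.mul_nonsing_inv _ hA,
    Matrix.one_mulVec, dotProduct_sum]
  rw [Matrix.mul_apply] at h1
  rw [show (1 : Matrix (Fin k) (Fin k) R) j i = (1 : Matrix (Fin k) (Fin k) R) i j by
    simp [Matrix.one_apply, eq_comm], ← h1]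
  refine Finset.sum_congr rfl fun l _ => ?_
  rw [dotProduct_smul, dotProduct_single, mul_one, smul_eq_mul]
  rfl

/-- A family dual to an isotropic family `b` becomes isotropic after adding combinations of `b`. -/
theorem exists_isotropic_dual {V : Type} [AddCommGroup V] [Module R V]
    (ω : LinearMap.BilinForm R V) (hω : ω.IsAlt) {k : ℕ} (b h : Fin k → V)
    (hb : ∀ i j, ω (b i) (b j) = 0)
    (hbh : ∀ j i, ω (b j) (h i) = (1 : Matrix (Fin k) (Fin k) R) j i) :
    ∃ h' : Fin k → V, (∀ j i, ω (b j) (h' i) = (1 : Matrix (Fin k) (Fin k) R) j i) ∧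
      ∀ i j, ω (h' i) (h' j) = 0 := by
  let y : Fin k → Fin k → R := fun i l => if i < l then -ω (h i) (h l) else 0
  have hsum : ∀ i j, ω (b j) (∑ l, y i l • b l) = 0 := fun i j => by
    simp [map_sum, hb]
  have hsum' : ∀ i j, ω (∑ l, y i l • b l) (h j) = y i j := fun i j => by
    simp [map_sum, LinearMap.sum_apply, hbh, Matrix.one_apply]
  have hsum2 : ∀ i j, ω (h i) (∑ l, y j l • b l) = -y j i := fun i j => by
    rw [← hω.neg_eq, hsum']
  have hsum3 : ∀ i j, ω (∑ l, y i l • b l) (∑ l, y j l • b l) = 0 := fun i j => by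
    simp [map_sum, LinearMap.sum_apply, hb]
  refine ⟨fun i => h i + ∑ l, y i l • b l, fun j i => ?_, fun i j => ?_⟩
  · rw [map_add, hsum, add_zero, hbh]
  · rw [map_add, map_add, LinearMap.add_apply, LinearMap.add_apply, hsum3, hsum', hsum2]
    have h1 : ω (h j) (h i) = -ω (h i) (h j) := (hω.neg_eq _ _).symm
    rcases lt_trichotomy i j with h2 | h2 | h2
    · simp [y, h2, h2.not_gt]
    · subst h2
      simp [y, hω (h i)]
    · simp [y, h2, h2.not_gt, h1]

theorem transpose_mul_mul_of_apply {n : ℕ} (A : Matrix (Fin n) (Fin n) R)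
    (x : Fin n → Fin n → R) (i j : Fin n) :
    ((Matrix.of fun r c => x c r).transpose * A * (Matrix.of fun r c => x c r)) i j =
      Matrix.toBilin' A (x i) (x j) := by
  rw [Matrix.toBilin'_apply', Matrix.mul_assoc, Matrix.mul_apply_eq_vecMul]
  rfl

/-- The `2g` vectors made of an isotropic family `b` and of an isotropic family `h` dual to `b`, taken
in reverse order, have the antidiagonal Gram matrix, up to sign. -/
theorem gram_of_dual_families [Algebra ℤ[X] R] {g : ℕ}
    (A : Matrix (Fin (2 * g)) (Fin (2 * g)) R) (hA : (Matrix.toBilin' A).IsAlt) (ε : R)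
    (b h : Fin g → Fin (2 * g) → R) (hb : ∀ i j, Matrix.toBilin' A (b i) (b j) = 0)
    (hh : ∀ i j, Matrix.toBilin' A (h i) (h j) = 0)
    (hbh : ∀ j i, Matrix.toBilin' A (b j) (h i) = -ε * (1 : Matrix (Fin g) (Fin g) R) j i)
    (x : Fin (2 * g) → Fin (2 * g) → R)
    (hx₁ : ∀ (c : Fin (2 * g)) (hc : c.val < g), x c = b ⟨c.val, hc⟩)
    (hx₂ : ∀ (c : Fin (2 * g)) (hc : g ≤ c.val), x c = h ⟨2 * g - 1 - c.val, by omega⟩) :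
    (Matrix.of fun r c => x c r).transpose * A * (Matrix.of fun r c => x c r) =
      ε • (symplecticMatrix g).map (algebraMap ℤ[X] R) := by
  ext i j
  rw [transpose_mul_mul_of_apply, Matrix.smul_apply, Matrix.map_apply, symplecticMatrix,
    Matrix.of_apply, smul_eq_mul]
  have hi := i.isLt
  have hj := j.isLt
  rcases lt_or_ge i.val g with h1 | h1 <;> rcases lt_or_ge j.val g with h2 | h2
  · rw [hx₁ i h1, hx₁ j h2, hb, if_neg (by omega), map_zero, mul_zero]
  · rw [hx₁ i h1, hx₂ j h2, hbh, if_pos h1, Matrix.one_apply]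
    by_cases h3 : i.val + j.val + 1 = 2 * g
    · rw [if_pos h3, if_pos (Fin.ext (by simp only; omega))]; simp
    · rw [if_neg h3, if_neg (fun h => h3 (by have := congrArg Fin.val h; simp only at this; omega))]
      simp
  · rw [hx₂ i h1, hx₁ j h2, ← hA.neg_eq, hbh, if_neg h1.not_gt, Matrix.one_apply]
    by_cases h3 : i.val + j.val + 1 = 2 * g
    · rw [if_pos h3, if_pos (Fin.ext (by simp only; omega))]; simp
    · rw [if_neg h3, if_neg (fun h => h3 (by have := congrArg Fin.val h; simp only at this; omega))]
      simp
  · rw [hx₂ i h1, hx₂ j h2, hh, if_neg (by omega), map_zero, mul_zero]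

/-- A square matrix with an invertible minor of size `n - d` has cokernel generated by `d` vectors of
the standard basis. The generators are indexed by `d` consecutive integers. -/
theorem exists_generators_coker [Nontrivial R] {n a d : ℕ} (hd : d ≤ n) (M : Matrix (Fin n) (Fin n) R)
    (r c : Fin (n - d) → Fin n) (h : IsUnit (M.submatrix r c).det) :
    ∃ w : ℕ → Fin n → R, LinearMap.range M.mulVecLin ⊔
      Submodule.span R (w '' Set.Ico a (a + d)) = ⊤ := by
  classical
  have hr : Function.Injective r := by
    intro i j hij
    by_contra hne
    have : (M.submatrix r c).det = 0 := Matrix.det_zero_of_row_eq hne (by ext; simp [hij])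
    rw [this] at h
    exact not_isUnit_zero h
  let s : Finset (Fin n) := (Finset.univ.image r)ᶜ
  have hs : (Finset.Ico a (a + d)).card = s.card := by
    rw [Nat.card_Ico, Finset.card_compl, Finset.card_image_of_injective _ hr]
    simp
    omega
  let e : Finset.Ico a (a + d) ≃ s := Finset.equivOfCardEq hs
  let w : ℕ → Fin n → R := fun q =>
    if hq : q ∈ Finset.Ico a (a + d) then Pi.single (e ⟨q, hq⟩).1 1 else 0
  refine ⟨w, eq_top_iff.2 fun v _ => ?_⟩
  have hw : ∀ i ∈ s, (Pi.single i 1 : Fin n → R) ∈ Submodule.span R (w '' Set.Ico a (a + d)) := by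
    intro i hi
    refine Submodule.subset_span ⟨(e.symm ⟨i, hi⟩).1, ?_, ?_⟩
    · exact Finset.mem_coe.2 (e.symm ⟨i, hi⟩).2 |> fun h => by simpa using h
    · exact (dif_pos (e.symm ⟨i, hi⟩).2).trans (by rw [Subtype.coe_eta, Equiv.apply_symm_apply])
  let S := M.submatrix r c
  let y : Fin (n - d) → R := S⁻¹.mulVec (v ∘ r)
  let u : Fin n → R := ∑ j, y j • Pi.single (c j) 1
  have hu : ∀ i, M.mulVec u (r i) = v (r i) := by
    intro i
    have h1 : S.mulVec y = v ∘ r := by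
      rw [Matrix.mulVec_mulVec, Matrix.mul_nonsing_inv _ h, Matrix.one_mulVec]
    have h2 := congrFun h1 i
    rw [Function.comp_apply] at h2
    rw [← h2]
    simp only [u, Matrix.mulVec_sum, Matrix.mulVec_smul, Finset.sum_apply, Pi.smul_apply,
      Matrix.mulVec_single_one, smul_eq_mul]
    exact Finset.sum_congr rfl fun j _ => mul_comm _ _
  rw [← add_sub_cancel (M.mulVec u) v]
  refine Submodule.add_mem_sup ⟨u, rfl⟩ ?_
  rw [pi_eq_sum_univ' (v - M.mulVec u)]
  refine Submodule.sum_mem _ fun i _ => ?_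
  by_cases hi : i ∈ s
  · exact Submodule.smul_mem _ _ (by
      simpa [Pi.single_apply, eq_comm, funext_iff, Pi.single] using hw i hi)
  · have : i ∈ Finset.univ.image r := by simpa [s] using hi
    obtain ⟨j, -, rfl⟩ := Finset.mem_image.1 this
    rw [Pi.sub_apply, hu, sub_self, zero_smul]
    exact Submodule.zero_mem _

end AlternatingForms

/-! ### Polarized chains of matrices over a local ring -/

section PolarizedChains

variable {R : Type} [CommRing R]

/-- The product `P i * P (i + 1) * ⋯ * P (i + m - 1)`. -/
def segmentProd {n : ℕ} (P : ℕ → Matrix (Fin n) (Fin n) R) (i m : ℕ) : Matrix (Fin n) (Fin n) R :=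
  ((List.range m).map fun k => P (i + k)).prod

section SegmentProd

variable {n : ℕ} (P : ℕ → Matrix (Fin n) (Fin n) R)

@[simp] theorem segmentProd_zero (i : ℕ) : segmentProd P i 0 = 1 := rfl

theorem segmentProd_succ (i m : ℕ) :
    segmentProd P i (m + 1) = segmentProd P i m * P (i + m) := by
  simp [segmentProd, List.range_succ]

theorem segmentProd_one (i : ℕ) : segmentProd P i 1 = P i := by
  rw [segmentProd_succ, segmentProd_zero, one_mul, add_zero]

theorem segmentProd_add (i m l : ℕ) :
    segmentProd P i (m + l) = segmentProd P i m * segmentProd P (i + m) l := by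
  induction l with
  | zero => simp
  | succ l ih => rw [← add_assoc, segmentProd_succ, ih, segmentProd_succ, mul_assoc, add_assoc]

theorem segmentProd_congr {P Q : ℕ → Matrix (Fin n) (Fin n) R} {i j m : ℕ}
    (h : ∀ k < m, P (i + k) = Q (j + k)) : segmentProd P i m = segmentProd Q j m := by
  unfold segmentProd
  congr 1
  exact List.map_congr_left fun k hk => h k (List.mem_range.1 hk)

end SegmentProd

/-- The matrix `T ^ k` over a `ℤ[t]`-algebra, where `T` is `shiftMatrix n`. -/
def shiftPow (R : Type) [CommRing R] [Algebra ℤ[X] R] (n k : ℕ) : Matrix (Fin n) (Fin n) R :=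
  (shiftMatrix n ^ k).map (algebraMap ℤ[X] R)

/-- The matrix of the symplectic form over a `ℤ[t]`-algebra. -/
def gramMatrix (R : Type) [CommRing R] [Algebra ℤ[X] R] (g : ℕ) :
    Matrix (Fin (2 * g)) (Fin (2 * g)) R :=
  (symplecticMatrix g).map (algebraMap ℤ[X] R)

theorem mul_of_columns {n : ℕ} (M : Matrix (Fin n) (Fin n) R) (x : ℕ → Fin n → R) :
    M * (Matrix.of fun r (c : Fin n) => x c r) =
      Matrix.of fun r (c : Fin n) => M.mulVec (x c) r := rfl

variable [Algebra ℤ[X] R]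

theorem shiftPow_add (n k l : ℕ) : shiftPow R n (k + l) = shiftPow R n k * shiftPow R n l := by
  rw [shiftPow, pow_add, Matrix.map_mul]
  rfl

theorem shiftPow_zero (n : ℕ) : shiftPow R n 0 = 1 := by
  rw [shiftPow, pow_zero, Matrix.map_one _ (map_zero _) (map_one _)]

theorem shiftPow_self (n : ℕ) :
    shiftPow R n n = algebraMap ℤ[X] R Polynomial.X • (1 : Matrix (Fin n) (Fin n) R) := by
  ext i j
  rw [shiftPow, shiftMatrix_pow_self, Matrix.map_apply, Matrix.smul_apply, Matrix.smul_apply,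
    Matrix.one_apply, Matrix.one_apply]
  split_ifs <;> simp

theorem mul_shiftPow {n k : ℕ} (hk : k ≤ n) (x : ℕ → Fin n → R) :
    (Matrix.of fun r (c : Fin n) => x c r) * shiftPow R n k =
      Matrix.of fun r (c : Fin n) => if k ≤ c.val then x (c - k) r
        else algebraMap ℤ[X] R Polynomial.X * x (c + n - k) r := by
  ext r c
  have hc := c.isLt
  rw [Matrix.mul_apply]
  simp only [shiftPow, Matrix.of_apply, Matrix.map_apply, shiftMatrix_pow_apply n k hk]
  by_cases h : k ≤ c.val
  · rw [if_pos h, Finset.sum_eq_single (⟨c - k, by omega⟩ : Fin n)]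
    · rw [if_pos (by simp only; omega), map_one, mul_one]
    · intro s _ hs
      have hs' : s.val ≠ c - k := fun e => hs (Fin.ext e)
      have := s.isLt
      rw [if_neg (by omega), if_neg (by omega), map_zero, mul_zero]
    · exact fun h => absurd (Finset.mem_univ _) h
  · rw [if_neg h, Finset.sum_eq_single (⟨c + n - k, by omega⟩ : Fin n)]
    · rw [if_neg (by simp only; omega), if_pos (by simp only; omega), mul_comm]
    · intro s _ hs
      have hs' : s.val ≠ c + n - k := fun e => hs (Fin.ext e)
      have := s.isLt
      rw [if_neg (by omega), if_neg (by omega), map_zero, mul_zero]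
    · exact fun h => absurd (Finset.mem_univ _) h

theorem isUnit_det_gramMatrix (g : ℕ) : IsUnit (gramMatrix R g).det := by
  have h : gramMatrix R g * gramMatrix R g = -1 := by
    ext i j
    have hi := i.isLt
    have hj := j.isLt
    rw [Matrix.mul_apply, Finset.sum_eq_single (⟨2 * g - 1 - i, by omega⟩ : Fin (2 * g))]
    · simp only [gramMatrix, symplecticMatrix, Matrix.map_apply, Matrix.of_apply, Matrix.neg_apply,
        Matrix.one_apply]
      rw [if_pos (show i.val + (2 * g - 1 - i.val) + 1 = 2 * g by omega)]
      by_cases h : i = j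
      · subst h
        rw [if_pos (show 2 * g - 1 - i.val + i.val + 1 = 2 * g by omega), if_pos rfl]
        by_cases h' : i.val < g
        · rw [if_pos h', if_neg (show ¬ 2 * g - 1 - i.val < g by omega)]; simp
        · rw [if_neg h', if_pos (show 2 * g - 1 - i.val < g by omega)]; simp
      · have h' : i.val ≠ j.val := fun e => h (Fin.ext e)
        rw [if_neg (show ¬ 2 * g - 1 - i.val + j.val + 1 = 2 * g by omega), if_neg h]; simp
    · intro s _ hs
      have hs' : s.val ≠ 2 * g - 1 - i := fun e => hs (Fin.ext e)
      simp only [gramMatrix, symplecticMatrix, Matrix.map_apply, Matrix.of_apply]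
      rw [if_neg (by omega), map_zero, zero_mul]
    · exact fun h => absurd (Finset.mem_univ _) h
  have h1 := congrArg Matrix.det h
  rw [Matrix.det_mul, Matrix.det_neg, Matrix.det_one, mul_one] at h1
  exact isUnit_of_mul_isUnit_left (h1 ▸ (isUnit_one.neg.pow _))

/-- A cyclic chain of `2g × 2g` matrices with total product `t`, with perfect alternating forms `A₀`
and `A_N` on its terms of indices `0` and `N` for which the two halves `P 0` and `P 1 ⋯ P N` of the
chain are adjoint, and with cokernels which are as small as those of the chain `(𝒱_i)_i`. The
indices `i ∈ ℤ/(N+1)ℤ` are encoded as natural numbers, with `P` periodic, and `o i` stands for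
`d_1 + ⋯ + d_i`. -/
structure PolarizedChain (g N : ℕ) (R : Type) [CommRing R] [Algebra ℤ[X] R] where
  P : ℕ → Matrix (Fin (2 * g)) (Fin (2 * g)) R
  o : ℕ → ℕ
  A₀ : Matrix (Fin (2 * g)) (Fin (2 * g)) R
  A_N : Matrix (Fin (2 * g)) (Fin (2 * g)) R
  periodic : ∀ i, P (i + (N + 1)) = P i
  prod_eq : ∀ i, segmentProd P i (N + 1) = algebraMap ℤ[X] R Polynomial.X • 1
  o_zero : o 0 = 0
  o_le_succ : ∀ i < N, o i ≤ o (i + 1)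
  o_last : o N = g
  minor : ∀ i < N, ∃ r c : Fin (2 * g - (o (i + 1) - o i)) → Fin (2 * g),
    IsUnit ((P (i + 1)).submatrix r c).det
  minor_zero : ∃ r c : Fin g → Fin (2 * g), IsUnit ((P 0).submatrix r c).det
  symplectic_zero : IsSymplecticGram g A₀
  symplectic_last : IsSymplecticGram g A_N
  adjoint : (P 0).transpose * A_N = A₀ * segmentProd P 1 N

namespace PolarizedChain

variable {g N : ℕ} (K : PolarizedChain g N R)

/-- The composite `P (i + 1) ⋯ P N` from the term of index `N` to the term of index `i`. -/
abbrev fromLast (i : ℕ) : Matrix (Fin (2 * g)) (Fin (2 * g)) R := segmentProd K.P (i + 1) (N - i)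

/-- The composite `P 1 ⋯ P i` from the term of index `i` to the term of index `0`. -/
abbrev toZero (i : ℕ) : Matrix (Fin (2 * g)) (Fin (2 * g)) R := segmentProd K.P 1 i

theorem o_mono {i j : ℕ} (hij : i ≤ j) (hj : j ≤ N) : K.o i ≤ K.o j := by
  induction j, hij using Nat.le_induction with
  | base => exact le_rfl
  | succ j h ih => exact (ih (by omega)).trans (K.o_le_succ j (by omega))

theorem o_le {i : ℕ} (hi : i ≤ N) : K.o i ≤ g := (K.o_mono hi le_rfl).trans K.o_last.le

theorem fromLast_last : K.fromLast N = 1 := by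
  rw [fromLast, Nat.sub_self, segmentProd_zero]

theorem fromLast_of_lt {i : ℕ} (hi : i < N) : K.fromLast i = K.P (i + 1) * K.fromLast (i + 1) := by
  rw [fromLast, show N - i = 1 + (N - (i + 1)) by omega, segmentProd_add, segmentProd_one]

theorem toZero_succ (i : ℕ) : K.toZero (i + 1) = K.toZero i * K.P (i + 1) := by
  rw [toZero, segmentProd_succ, add_comm 1 i]

theorem fromLast_zero : K.fromLast 0 = K.toZero N := rfl

theorem toZero_mul_fromLast {i : ℕ} (hi : i ≤ N) : K.toZero i * K.fromLast i = K.toZero N := by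
  rw [toZero, fromLast, add_comm i 1, ← segmentProd_add, Nat.add_sub_cancel' hi]

theorem fromLast_mul_toZero {i : ℕ} (hi : i ≤ N) :
    K.fromLast i * K.P 0 * K.toZero i = algebraMap ℤ[X] R Polynomial.X • 1 := by
  have h0 : K.P 0 = segmentProd K.P (i + 1 + (N - i)) 1 := by
    rw [segmentProd_one, show i + 1 + (N - i) = 0 + (N + 1) by omega, K.periodic]
  have h1 : K.toZero i = segmentProd K.P (i + 1 + (N - i + 1)) i :=
    segmentProd_congr fun k _ => by
      rw [show i + 1 + (N - i + 1) + k = (1 + k) + (N + 1) by omega, K.periodic]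
  rw [← K.prod_eq (i + 1), show N + 1 = N - i + 1 + i by omega, segmentProd_add _ _ (N - i + 1),
    segmentProd_add _ _ (N - i), ← h0, ← h1]

theorem zero_mul_toZero : K.P 0 * K.toZero N = algebraMap ℤ[X] R Polynomial.X • 1 := by
  have h := K.fromLast_mul_toZero le_rfl
  rwa [K.fromLast_last, one_mul] at h

theorem toZero_mul_zero : K.toZero N * K.P 0 = algebraMap ℤ[X] R Polynomial.X • 1 := by
  have h := K.fromLast_mul_toZero (Nat.zero_le N)
  rwa [toZero, segmentProd_zero, mul_one] at h

/-- The form on the term of index `0`. -/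
abbrev ω₀ : LinearMap.BilinForm R (Fin (2 * g) → R) := Matrix.toBilin' K.A₀

/-- The form on the term of index `N`. -/
abbrev ωN : LinearMap.BilinForm R (Fin (2 * g) → R) := Matrix.toBilin' K.A_N

theorem isAlt_zero : K.ω₀.IsAlt := toBilin'_isAlt K.symplectic_zero.diag K.symplectic_zero.skew

theorem isAlt_last : K.ωN.IsAlt := toBilin'_isAlt K.symplectic_last.diag K.symplectic_last.skew

theorem adjoint_apply (x y : Fin (2 * g) → R) :
    K.ωN ((K.P 0).mulVec x) y = K.ω₀ x ((K.toZero N).mulVec y) := by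
  rw [Matrix.toBilin'_apply', Matrix.toBilin'_apply', Matrix.mulVec_mulVec, ← K.adjoint,
    ← Matrix.mulVec_mulVec, Matrix.dotProduct_mulVec x, Matrix.vecMul_transpose]

theorem form_toZero (x y : Fin (2 * g) → R) :
    K.ω₀ ((K.toZero N).mulVec x) ((K.toZero N).mulVec y) =
      algebraMap ℤ[X] R Polynomial.X * K.ωN x y := by
  rw [← adjoint_apply, Matrix.mulVec_mulVec, zero_mul_toZero, Matrix.smul_mulVec,
    Matrix.one_mulVec, map_smul, LinearMap.smul_apply, smul_eq_mul]

theorem form_zero (x y : Fin (2 * g) → R) :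
    K.ωN ((K.P 0).mulVec x) ((K.P 0).mulVec y) =
      algebraMap ℤ[X] R Polynomial.X * K.ω₀ x y := by
  rw [adjoint_apply, Matrix.mulVec_mulVec, toZero_mul_zero, Matrix.smul_mulVec,
    Matrix.one_mulVec, map_smul, smul_eq_mul]

/-- A family of vectors `E q i`, where `q` runs over `[g, 2g)` and `E q i` lies in the term of index
`i` whenever `q < 2g - o i`, compatible with the maps of the chain, such that the `E q i` with
`2g - o (i + 1) ≤ q` generate the cokernel of `P (i + 1)`. In the chain `(𝒱_i)_i` the `q`-th vector of
the standard basis, seen in all the `𝒱_i` that contain it, gives such a family. -/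
structure IsAdapted (E : ℕ → ℕ → Fin (2 * g) → R) : Prop where
  map_eq : ∀ i < N, ∀ q < 2 * g - K.o (i + 1), (K.P (i + 1)).mulVec (E q (i + 1)) = E q i
  sup_eq_top : ∀ i < N, LinearMap.range (K.P (i + 1)).mulVecLin ⊔
    Submodule.span R ((fun q => E q i) '' Set.Ico (2 * g - K.o (i + 1)) (2 * g - K.o i)) = ⊤

theorem exists_isAdapted [Nontrivial R] : ∃ E, K.IsAdapted E := by
  have h : ∀ i, ∃ w : ℕ → Fin (2 * g) → R, i < N → LinearMap.range (K.P (i + 1)).mulVecLin ⊔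
      Submodule.span R (w '' Set.Ico (2 * g - K.o (i + 1)) (2 * g - K.o i)) = ⊤ := by
    intro i
    by_cases hi : i < N
    · obtain ⟨r, c, hrc⟩ := K.minor i hi
      have h1 := K.o_le_succ i hi
      have h2 := K.o_le (show i + 1 ≤ N from hi)
      obtain ⟨w, hw⟩ := exists_generators_coker (a := 2 * g - K.o (i + 1)) (by omega) _ r c hrc
      refine ⟨w, fun _ => ?_⟩
      rwa [show 2 * g - K.o (i + 1) + (K.o (i + 1) - K.o i) = 2 * g - K.o i by omega] at hw
    · exact ⟨0, fun h => absurd h hi⟩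
  choose w hw using h
  let E' : ℕ → ℕ → Fin (2 * g) → R := fun q m => Nat.rec 0 (fun m x =>
    if q < 2 * g - K.o (N - m) then (K.P (N - m)).mulVec x else w (N - (m + 1)) q) m
  have hE' : ∀ q m, E' q (m + 1) = if q < 2 * g - K.o (N - m) then (K.P (N - m)).mulVec (E' q m)
    else w (N - (m + 1)) q := fun q m => rfl
  have hE : ∀ q i, i < N → E' q (N - i) = if q < 2 * g - K.o (i + 1) then
      (K.P (i + 1)).mulVec (E' q (N - (i + 1))) else w i q := by
    intro q i hi
    rw [show N - i = (N - (i + 1)) + 1 by omega, hE', show N - (N - (i + 1)) = i + 1 by omega,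
      show N - (N - (i + 1) + 1) = i by omega]
  refine ⟨fun q i => E' q (N - i), fun i hi q hq => ?_, fun i hi => ?_⟩
  · rw [hE q i hi, if_pos hq]
  · rw [← hw i hi]
    congr 2
    refine Set.image_congr fun q hq => ?_
    rw [hE q i hi, if_neg (not_lt.2 hq.1)]

variable {K}

theorem IsAdapted.add {E : ℕ → ℕ → Fin (2 * g) → R} (hE : K.IsAdapted E)
    (u : ℕ → Fin (2 * g) → R) :
    K.IsAdapted fun q i => E q i + (K.fromLast i).mulVec (u q) := by
  refine ⟨fun i hi q hq => ?_, fun i hi => eq_top_iff.2 ?_⟩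
  · rw [Matrix.mulVec_add, hE.map_eq i hi q hq, Matrix.mulVec_mulVec, ← K.fromLast_of_lt hi]
  · rw [← hE.sup_eq_top i hi, sup_le_iff]
    refine ⟨le_sup_left, Submodule.span_le.2 ?_⟩
    rintro _ ⟨q, hq, rfl⟩
    have h1 : (K.fromLast i).mulVec (u q) ∈ LinearMap.range (K.P (i + 1)).mulVecLin :=
      ⟨(K.fromLast (i + 1)).mulVec (u q), by
        rw [Matrix.mulVecLin_apply, Matrix.mulVec_mulVec, ← K.fromLast_of_lt hi]⟩
    have h2 := Submodule.sub_mem _ (Submodule.mem_sup_right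
      (S := LinearMap.range (K.P (i + 1)).mulVecLin) (Submodule.subset_span
        (Set.mem_image_of_mem (fun q => E q i + (K.fromLast i).mulVec (u q)) hq)))
      (Submodule.mem_sup_left h1)
    simpa using h2

theorem IsAdapted.toZero_mulVec {E : ℕ → ℕ → Fin (2 * g) → R} (hE : K.IsAdapted E) {i : ℕ}
    (hi : i ≤ N) {q : ℕ} (hq : q < 2 * g - K.o i) : (K.toZero i).mulVec (E q i) = E q 0 := by
  induction i with
  | zero => simp
  | succ i ih =>
    rw [toZero_succ, ← Matrix.mulVec_mulVec, hE.map_eq i hi q hq, ih (by omega)]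
    have := K.o_le_succ i hi
    omega

theorem IsAdapted.span_sup_range {E : ℕ → ℕ → Fin (2 * g) → R} (hE : K.IsAdapted E) {i : ℕ}
    (hi : i ≤ N) : Submodule.span R ((fun q => E q 0) '' Set.Ico (2 * g - K.o i) (2 * g)) ⊔
      LinearMap.range (K.toZero i).mulVecLin = ⊤ := by
  induction i with
  | zero => simp
  | succ i ih =>
    have h1 := K.o_le_succ i hi
    rw [eq_top_iff, ← ih (by omega), sup_le_iff]
    refine ⟨le_sup_of_le_left (Submodule.span_mono (Set.image_mono
      (Set.Ico_subset_Ico_left (by omega)))), ?_⟩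
    rw [LinearMap.range_eq_map, ← hE.sup_eq_top i hi, Submodule.map_sup, sup_le_iff]
    constructor
    · refine le_sup_of_le_right ?_
      rw [← LinearMap.range_comp, ← Matrix.mulVecLin_mul, ← toZero_succ]
    · refine le_sup_of_le_left ?_
      rw [Submodule.map_span, Submodule.span_le]
      rintro _ ⟨_, ⟨q, hq, rfl⟩, rfl⟩
      refine Submodule.subset_span ⟨q, ⟨hq.1, hq.2.trans_le (Nat.sub_le _ _)⟩, ?_⟩
      rw [Matrix.mulVecLin_apply, hE.toZero_mulVec (by omega) hq.2]

/-- When `t` is not invertible, the images under `P 0` of the `g` vectors `E q 0` are part of a basis,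
since `P 0` has rank at least `g` over the residue field and kills there the range of `P 1 ⋯ P N`. -/
theorem IsAdapted.exists_dual [IsLocalRing R]
    (ht : algebraMap ℤ[X] R Polynomial.X ∈ IsLocalRing.maximalIdeal R)
    {E : ℕ → ℕ → Fin (2 * g) → R} (hE : K.IsAdapted E) :
    ∃ h : Fin g → Fin (2 * g) → R, ∀ j i, K.ωN ((K.P 0).mulVec (E (g + j.val) 0)) (h i) =
      (1 : Matrix (Fin g) (Fin g) R) j i := by
  obtain ⟨r, c, hrc⟩ := K.minor_zero
  refine exists_dual_family K.A_N K.symplectic_last.nondegenerate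
    (fun j => (K.P 0).mulVec (E (g + j.val) 0)) r ?_
  set M : Matrix (Fin g) (Fin g) R :=
    Matrix.of fun i j => (K.P 0).mulVec (E (g + j.val) 0) (r i) with hM
  have hspan : ∀ v : Fin (2 * g) → R, ∃ (y : Fin g → R) (z : Fin (2 * g) → R),
      v = ∑ k, y k • E (g + k.val) 0 + (K.toZero N).mulVec z := by
    intro v
    have hv : v ∈ (⊤ : Submodule R (Fin (2 * g) → R)) := trivial
    rw [← hE.span_sup_range le_rfl, K.o_last] at hv
    obtain ⟨a, ha, _, ⟨z, rfl⟩, rfl⟩ := Submodule.mem_sup.1 hv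
    have h1 : (fun q => E q 0) '' Set.Ico (2 * g - g) (2 * g) =
        Set.range fun k : Fin g => E (g + k.val) 0 := by
      ext x
      constructor
      · rintro ⟨q, hq, rfl⟩
        have := hq.1
        have := hq.2
        refine ⟨⟨q - g, by omega⟩, ?_⟩
        simp only
        rw [show g + (q - g) = q by omega]
      · rintro ⟨k, rfl⟩
        exact ⟨g + k.val, ⟨by omega, by omega⟩, rfl⟩
    rw [h1, Submodule.mem_span_range_iff_exists_fun] at ha
    obtain ⟨y, rfl⟩ := ha
    exact ⟨y, z, rfl⟩
  choose y z hyz using fun j => hspan (Pi.single (c j) 1)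
  have hS : (K.P 0).submatrix r c = M * (Matrix.of fun k j => y j k) +
      algebraMap ℤ[X] R Polynomial.X • Matrix.of fun i j => z j (r i) := by
    ext i j
    have h1 := congrFun (congrArg (K.P 0).mulVec (hyz j)) (r i)
    rw [Matrix.mulVec_single_one, Matrix.mulVec_add, Matrix.mulVec_mulVec, zero_mul_toZero,
      Matrix.smul_mulVec, Matrix.one_mulVec, Matrix.mulVec_sum] at h1
    rw [Matrix.submatrix_apply, Matrix.add_apply, Matrix.mul_apply]
    refine h1.trans ?_
    simp only [Pi.add_apply, Finset.sum_apply, Matrix.mulVec_smul, Pi.smul_apply, smul_eq_mul, hM,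
      Matrix.of_apply, Matrix.smul_apply]
    congr 1
    exact Finset.sum_congr rfl fun k _ => mul_comm _ _
  have hS' := hrc.map (IsLocalRing.residue R)
  have ht' : IsLocalRing.residue R (algebraMap ℤ[X] R Polynomial.X) = 0 :=
    Ideal.Quotient.eq_zero_iff_mem.2 ht
  rw [hS, RingHom.map_det, map_add, map_mul, RingHom.mapMatrix_apply _ (_ • _),
    Matrix.map_smul' _ _ _ (map_mul _), ht', zero_smul, add_zero, Matrix.det_mul,
    ← RingHom.map_det] at hS'
  exact (isUnit_map_iff (IsLocalRing.residue R) _).1 (isUnit_of_mul_isUnit_left hS')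

end PolarizedChain
end PolarizedChains

section PolarizedChains
variable {R : Type} [CommRing R] [Algebra ℤ[X] R]
namespace PolarizedChain
variable {g N : ℕ} {K : PolarizedChain g N R}

variable (K) in
/-- A trivialisation of a polarized chain: matrices `Φ i` which identify it with the chain of the
lattices `𝒱_i`, and the two forms with `⟨ , ⟩_0` and `⟨ , ⟩_N`. -/
structure IsTrivialization (Φ : ℕ → Matrix (Fin (2 * g)) (Fin (2 * g)) R) : Prop where
  isUnit : ∀ i ≤ N, IsUnit (Φ i).det
  mul_eq : ∀ i < N, K.P (i + 1) * Φ (i + 1) = Φ i * shiftPow R (2 * g) (K.o (i + 1) - K.o i)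
  mul_zero_eq : K.P 0 * Φ 0 = Φ N * shiftPow R (2 * g) g
  gram_zero : (Φ 0).transpose * K.A₀ * Φ 0 = gramMatrix R g
  gram_last : (Φ N).transpose * K.A_N * Φ N = -gramMatrix R g

variable (K) in
/-- The columns of the trivialisation given by an adapted family `E` and vectors `h p` of the term of
index `N`. In `𝒱_i`, with basis `T ^ (o i) e_c`, the vector of index `c` is the image from `𝒱_N` of `t`
times a standard vector of `𝒱_0` if `c < o i`, it is the image of one of the last `g` basis vectors
of `𝒱_N` if `o i ≤ c < g + o i`, and else it is a standard vector of `𝒱_0` lying in `𝒱_i`. -/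
def column (E : ℕ → ℕ → Fin (2 * g) → R) (h : ℕ → Fin (2 * g) → R) (i c : ℕ) : Fin (2 * g) → R :=
  if c < K.o i then (K.fromLast i).mulVec ((K.P 0).mulVec (E (c + 2 * g - K.o i) 0))
  else if c < g + K.o i then (K.fromLast i).mulVec (h (c - K.o i))
  else E (c - K.o i) i

theorem IsAdapted.mulVec_column {E : ℕ → ℕ → Fin (2 * g) → R} (hE : K.IsAdapted E)
    (h : ℕ → Fin (2 * g) → R) {i : ℕ} (hi : i < N) {c : ℕ} (hc : c < 2 * g) :
    (K.P (i + 1)).mulVec (K.column E h (i + 1) c) = if K.o (i + 1) - K.o i ≤ c then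
      K.column E h i (c - (K.o (i + 1) - K.o i)) else
      algebraMap ℤ[X] R Polynomial.X • K.column E h i (c + 2 * g - (K.o (i + 1) - K.o i)) := by
  have h1 := K.o_le_succ i hi
  have h2 := K.o_le (show i + 1 ≤ N from hi)
  unfold column
  by_cases hd : K.o (i + 1) - K.o i ≤ c
  · rw [if_pos hd]
    by_cases h3 : c < K.o (i + 1)
    · rw [if_pos h3, if_pos (by omega), Matrix.mulVec_mulVec, ← K.fromLast_of_lt hi,
        show c - (K.o (i + 1) - K.o i) + 2 * g - K.o i = c + 2 * g - K.o (i + 1) by omega]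
    · rw [if_neg h3, if_neg (show ¬ c - (K.o (i + 1) - K.o i) < K.o i by omega)]
      by_cases h4 : c < g + K.o (i + 1)
      · rw [if_pos h4, if_pos (by omega), Matrix.mulVec_mulVec, ← K.fromLast_of_lt hi,
          show c - (K.o (i + 1) - K.o i) - K.o i = c - K.o (i + 1) by omega]
      · rw [if_neg h4, if_neg (by omega), hE.map_eq i hi _ (by omega),
          show c - (K.o (i + 1) - K.o i) - K.o i = c - K.o (i + 1) by omega]
  · rw [if_neg hd, if_pos (by omega), if_neg (by omega), if_neg (by omega),
      show c + 2 * g - (K.o (i + 1) - K.o i) - K.o i = c + 2 * g - K.o (i + 1) by omega,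
      Matrix.mulVec_mulVec, ← K.fromLast_of_lt hi,
      ← hE.toZero_mulVec hi.le (show c + 2 * g - K.o (i + 1) < 2 * g - K.o i by omega),
      Matrix.mulVec_mulVec, Matrix.mulVec_mulVec, K.fromLast_mul_toZero hi.le, Matrix.smul_mulVec,
      Matrix.one_mulVec]

theorem zero_mulVec_column (E : ℕ → ℕ → Fin (2 * g) → R)
    (h : ℕ → Fin (2 * g) → R) {c : ℕ} (hc : c < 2 * g) :
    (K.P 0).mulVec (K.column E h 0 c) = if g ≤ c then K.column E h N (c - g) else
      algebraMap ℤ[X] R Polynomial.X • K.column E h N (c + 2 * g - g) := by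
  unfold column
  simp only [K.o_zero, K.o_last, fromLast_last, Matrix.one_mulVec, add_zero, Nat.sub_zero]
  rw [if_neg (by omega)]
  by_cases hd : g ≤ c
  · rw [if_pos hd, if_neg (by omega), if_pos (by omega), show c - g + 2 * g - g = c by omega]
  · rw [if_neg hd, if_pos (by omega), if_neg (by omega), if_pos (by omega), Matrix.mulVec_mulVec,
      fromLast_zero, zero_mul_toZero, Matrix.smul_mulVec, Matrix.one_mulVec,
      show c + 2 * g - g - g = c by omega]

/-- Over a local ring, a matrix whose columns span is invertible; and the matrices of a family of
compatible columns which is adapted are invertible as soon as the last one is. -/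
theorem IsAdapted.isUnit_det {E : ℕ → ℕ → Fin (2 * g) → R} (hE : K.IsAdapted E)
    (h : ℕ → Fin (2 * g) → R)
    (hN : IsUnit (Matrix.of fun r (c : Fin (2 * g)) => K.column E h N c r).det) {i : ℕ}
    (hi : i ≤ N) : IsUnit (Matrix.of fun r (c : Fin (2 * g)) => K.column E h i c r).det := by
  induction hk : N - i generalizing i with
  | zero => rwa [show i = N by omega]
  | succ k ih =>
    have hi' : i < N := by omega
    have h0 := ih (show i + 1 ≤ N from hi') (by omega)
    have h1 := K.o_le_succ i hi'
    have h2 := K.o_le (show i + 1 ≤ N from hi')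
    rw [← Matrix.isUnit_iff_isUnit_det, ← Matrix.mulVec_surjective_iff_isUnit] at h0 ⊢
    set Φ := Matrix.of fun r (c : Fin (2 * g)) => K.column E h i c r with hΦ
    set Φ' := Matrix.of fun r (c : Fin (2 * g)) => K.column E h (i + 1) c r with hΦ'
    have hcol : ∀ c : ℕ, c < 2 * g → K.column E h i c ∈ LinearMap.range Φ.mulVecLin := by
      intro c hc
      refine ⟨Pi.single ⟨c, hc⟩ 1, ?_⟩
      rw [Matrix.mulVecLin_apply, Matrix.mulVec_single_one]
      rfl
    suffices hs : LinearMap.range Φ.mulVecLin = ⊤ from LinearMap.range_eq_top.1 hs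
    rw [eq_top_iff, ← hE.sup_eq_top i hi', sup_le_iff]
    constructor
    · rintro _ ⟨v, rfl⟩
      obtain ⟨w, rfl⟩ := h0 v
      rw [Matrix.mulVecLin_apply, Matrix.mulVec_mulVec, Matrix.mulVec_eq_sum]
      refine Submodule.sum_mem _ fun c _ => ?_
      rw [op_smul_eq_smul]
      refine Submodule.smul_mem _ _ ?_
      have h3 : (K.P (i + 1) * Φ').transpose c = (K.P (i + 1)).mulVec (K.column E h (i + 1) c) :=
        rfl
      rw [h3, hE.mulVec_column h hi' c.isLt]
      have hc := c.isLt
      split_ifs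
      · exact hcol _ (by omega)
      · exact Submodule.smul_mem _ _ (hcol _ (by omega))
    · rw [Submodule.span_le]
      rintro _ ⟨q, hq, rfl⟩
      have hq1 := hq.1
      have hq2 := hq.2
      have h3 := hcol (q + K.o i) (by omega)
      rw [column, if_neg (by omega), if_neg (by omega), Nat.add_sub_cancel] at h3
      exact h3

/-- Over a local ring where `t` is not invertible, the `E q 0` can be made isotropic by adding to them
vectors coming from the term of index `N`. -/
theorem exists_isAdapted_isotropic [IsLocalRing R]
    (ht : algebraMap ℤ[X] R Polynomial.X ∈ IsLocalRing.maximalIdeal R) :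
    ∃ E, K.IsAdapted E ∧ ∀ i j : Fin g, K.ω₀ (E (g + i.val) 0) (E (g + j.val) 0) = 0 := by
  obtain ⟨E, hE⟩ := K.exists_isAdapted
  obtain ⟨h, hh⟩ := hE.exists_dual ht
  obtain ⟨f', hf', h0⟩ := exists_isotropic_correction K.ω₀ K.isAlt_zero
    (fun j : Fin g => E (g + j.val) 0) (fun j => (K.toZero N).mulVec (h j))
    (fun i j => by rw [← adjoint_apply, hh, sub_self]; exact zero_mem _)
    (fun i j => by rw [form_toZero]; exact Ideal.mul_mem_right _ _ ht)
  have hu : ∀ i, ∃ u, f' i = E (g + i.val) 0 + (K.toZero N).mulVec u := by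
    intro i
    have h1 : Submodule.span R (Set.range fun j => (K.toZero N).mulVec (h j)) ≤
        LinearMap.range (K.toZero N).mulVecLin := by
      rw [Submodule.span_le]
      rintro _ ⟨j, rfl⟩
      exact ⟨h j, rfl⟩
    obtain ⟨u, hu⟩ := h1 (hf' i)
    exact ⟨u, by rw [← Matrix.mulVecLin_apply, hu, add_sub_cancel]⟩
  choose u hu using hu
  refine ⟨_, hE.add fun q => if hq : q - g < g then u ⟨q - g, hq⟩ else 0, fun i j => ?_⟩
  have h1 : ∀ i : Fin g, E (g + i.val) 0 + (K.fromLast 0).mulVec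
      (if hq : g + i.val - g < g then u ⟨g + i.val - g, hq⟩ else 0) = f' i := by
    intro i
    have h2 : g + i.val - g = i.val := by omega
    rw [dif_pos (by omega), hu i, fromLast_zero]
    simp only [h2]
  rw [h1, h1, h0]

/-- If `t` is not invertible, isotropic lifts to the term of index `0` of a basis of the cokernel of
the chain, and a family of the term of index `N` which is isotropic and dual to their images, give
the columns of a trivialisation. -/
theorem exists_isTrivialization_of_mem [IsLocalRing R]
    (ht : algebraMap ℤ[X] R Polynomial.X ∈ IsLocalRing.maximalIdeal R) :
    ∃ Φ, K.IsTrivialization Φ := by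
  obtain ⟨E, hE, hE0⟩ := K.exists_isAdapted_isotropic ht
  obtain ⟨h₁, hh₁⟩ := hE.exists_dual ht
  obtain ⟨h, hEh, hh⟩ := exists_isotropic_dual K.ωN K.isAlt_last
    (fun j : Fin g => (K.P 0).mulVec (E (g + j.val) 0)) h₁
    (fun i j => by rw [form_zero, hE0, mul_zero]) hh₁
  let h' : ℕ → Fin (2 * g) → R := fun p => if hp : p < g then h ⟨g - 1 - p, by omega⟩ else 0
  have hgram_zero : (Matrix.of fun r (c : Fin (2 * g)) => K.column E h' 0 c r).transpose * K.A₀ *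
      (Matrix.of fun r (c : Fin (2 * g)) => K.column E h' 0 c r) = gramMatrix R g := by
    rw [gram_of_dual_families K.A₀ K.isAlt_zero 1
      (fun p => (K.toZero N).mulVec (h ⟨g - 1 - p, by omega⟩))
      (fun j => E (g + (g - 1 - j.val)) 0) ?_ ?_ ?_ (fun c => K.column E h' 0 c) ?_ ?_, one_smul]
    · rfl
    · intro i j
      rw [form_toZero, hh, mul_zero]
    · intro i j
      exact hE0 ⟨g - 1 - i, by omega⟩ ⟨g - 1 - j, by omega⟩
    · intro j i
      have h2 := hEh ⟨g - 1 - i, by omega⟩ ⟨g - 1 - j, by omega⟩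
      rw [← K.isAlt_zero.neg_eq, ← adjoint_apply, neg_mul, one_mul]
      refine (congrArg Neg.neg h2).trans ?_
      rw [Matrix.one_apply, Matrix.one_apply]
      have := i.isLt
      have := j.isLt
      by_cases h3 : j = i
      · rw [if_pos h3, if_pos (by rw [h3])]
      · rw [if_neg h3, if_neg]
        intro e
        have e' := congrArg Fin.val e
        simp only at e'
        exact h3 (Fin.ext (by omega))
    · intro c hc
      simp only [column, K.o_zero, fromLast_zero]
      rw [if_neg (by omega), if_pos (by omega)]
      simp only [h', Nat.sub_zero]
      rw [dif_pos hc]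
    · intro c hc
      have := c.isLt
      simp only [column, K.o_zero]
      rw [if_neg (by omega), if_neg (by omega)]
      congr 1
      omega
  have hgram_last : (Matrix.of fun r (c : Fin (2 * g)) => K.column E h' N c r).transpose * K.A_N *
      (Matrix.of fun r (c : Fin (2 * g)) => K.column E h' N c r) = -gramMatrix R g := by
    rw [gram_of_dual_families K.A_N K.isAlt_last (-1)
      (fun j : Fin g => (K.P 0).mulVec (E (g + j.val) 0)) h ?_ hh ?_
      (fun c => K.column E h' N c) ?_ ?_, neg_one_smul]
    · rfl
    · intro i j
      rw [form_zero, hE0, mul_zero]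
    · intro j i
      rw [neg_neg, one_mul]
      exact hEh j i
    · intro c hc
      simp only [column, K.o_last, fromLast_last, Matrix.one_mulVec]
      rw [if_pos hc, show c.val + 2 * g - g = g + c.val by omega]
    · intro c hc
      have := c.isLt
      simp only [column, K.o_last, fromLast_last, Matrix.one_mulVec]
      rw [if_neg (by omega), if_pos (by omega)]
      simp only [h']
      rw [dif_pos (by omega)]
      congr 1
      exact Fin.ext (by simp only; omega)
  refine ⟨fun i => Matrix.of fun r (c : Fin (2 * g)) => K.column E h' i c r, ?_, ?_, ?_,
    hgram_zero, hgram_last⟩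
  · intro i hi
    refine hE.isUnit_det h' ?_ hi
    have h1 := congrArg Matrix.det hgram_last
    rw [Matrix.det_mul, Matrix.det_neg] at h1
    have h2 := (isUnit_one.neg.pow (Fintype.card (Fin (2 * g)))).mul
      (isUnit_det_gramMatrix (R := R) g)
    rw [← h1] at h2
    exact isUnit_of_mul_isUnit_right h2
  · intro i hi
    have h1 := K.o_le (show i + 1 ≤ N from hi)
    rw [mul_of_columns, mul_shiftPow (by omega)]
    ext r c
    rw [Matrix.of_apply, Matrix.of_apply, hE.mulVec_column h' hi c.isLt]
    split_ifs <;> rfl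
  · rw [mul_of_columns, mul_shiftPow (by omega)]
    ext r c
    rw [Matrix.of_apply, Matrix.of_apply, zero_mulVec_column E h' c.isLt]
    split_ifs <;> rfl

theorem transpose_shiftPow_mul_gramMatrix (g : ℕ) :
    (shiftPow R (2 * g) g).transpose * gramMatrix R g * shiftPow R (2 * g) g =
      algebraMap ℤ[X] R Polynomial.X • (-gramMatrix R g) := by
  have h := congrArg (fun M => M.map (algebraMap ℤ[X] R)) (transpose_shift_mul_symplectic g)
  simp only [Matrix.map_mul] at h
  refine h.trans ?_
  ext i j
  simp [gramMatrix]

/-- The direct factor `Ω` is Lagrangian for `A₀`, hence has an isotropic complement in duality with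
it. No condition on `t` is needed. -/
theorem exists_symplectic_basis {A : Matrix (Fin (2 * g)) (Fin (2 * g)) R}
    (hA : IsSymplecticGram g A) :
    ∃ Φ : Matrix (Fin (2 * g)) (Fin (2 * g)) R, Φ.transpose * A * Φ = gramMatrix R g := by
  have halt := toBilin'_isAlt hA.diag hA.skew
  let b : Fin g → Fin (2 * g) → R := fun j => Pi.single (Fin.castLE (by omega) j) 1
  have hb : ∀ i j, Matrix.toBilin' A (b i) (b j) = 0 := by
    intro i j
    rw [Matrix.toBilin'_single]
    exact hA.isotropic _ _ i.isLt j.isLt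
  obtain ⟨h₁, hh₁⟩ := exists_dual_family A hA.nondegenerate b (Fin.castLE (by omega)) (by
    convert isUnit_one
    rw [← Matrix.det_one (n := Fin g) (R := R)]
    congr 1
    ext i j
    simp [b, Pi.single_apply, Matrix.one_apply])
  obtain ⟨h, hbh, hh⟩ := exists_isotropic_dual _ halt b h₁ hb hh₁
  refine ⟨Matrix.of fun r (c : Fin (2 * g)) => (if hc : c.val < g then b ⟨c.val, hc⟩ else
    -h ⟨2 * g - 1 - c.val, by omega⟩) r, ?_⟩
  rw [gram_of_dual_families A halt 1 b (fun j => -h j) hb ?_ ?_ (fun c : Fin (2 * g) =>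
    (if hc : c.val < g then b ⟨c.val, hc⟩ else -h ⟨2 * g - 1 - c.val, by omega⟩)) ?_ ?_, one_smul]
  · rfl
  · intro i j
    simp [hh]
  · intro j i
    simp [hbh]
  · intro c hc
    exact dif_pos hc
  · intro c hc
    exact dif_neg (not_lt.2 hc)

/-- If `t` is invertible, all the maps of the chain are isomorphisms: the chain and both forms are
determined by a symplectic basis of the term of index `0`. -/
theorem exists_isTrivialization_of_isUnit
    (ht : IsUnit (algebraMap ℤ[X] R Polynomial.X)) : ∃ Φ, K.IsTrivialization Φ := by
  obtain ⟨Φ₀, hΦ₀⟩ := exists_symplectic_basis K.symplectic_zero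
  have hu : IsUnit Φ₀.det := by
    have h1 := congrArg Matrix.det hΦ₀
    rw [Matrix.det_mul] at h1
    exact isUnit_of_mul_isUnit_right (h1 ▸ isUnit_det_gramMatrix g)
  have htn : IsUnit (algebraMap ℤ[X] R Polynomial.X •
      (1 : Matrix (Fin (2 * g)) (Fin (2 * g)) R)).det := by
    rw [Matrix.det_smul, Matrix.det_one, mul_one]
    exact ht.pow _
  have hC : ∀ i ≤ N, IsUnit (K.toZero i).det := by
    intro i hi
    rw [← K.toZero_mul_zero, ← K.toZero_mul_fromLast hi, Matrix.mul_assoc, Matrix.det_mul] at htn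
    exact isUnit_of_mul_isUnit_left htn
  have hT : ∀ k ≤ 2 * g, IsUnit (shiftPow R (2 * g) k).det := by
    intro k hk
    rw [← shiftPow_self, show 2 * g = k + (2 * g - k) by omega, shiftPow_add, Matrix.det_mul] at htn
    rw [show 2 * g = k + (2 * g - k) by omega]
    exact isUnit_of_mul_isUnit_left htn
  have hlast : (K.P 0).transpose * K.A_N = K.A₀ * K.toZero N := K.adjoint
  have hPt : K.P 0 * K.toZero N = algebraMap ℤ[X] R Polynomial.X • 1 := K.zero_mul_toZero
  have hP : K.P 0 = algebraMap ℤ[X] R Polynomial.X • (K.toZero N)⁻¹ := by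
    rw [← Matrix.mul_nonsing_inv_cancel_right _ (K.P 0) (hC N le_rfl), hPt, Matrix.smul_mul,
      Matrix.one_mul]
  refine ⟨fun i => (K.toZero i)⁻¹ * Φ₀ * shiftPow R (2 * g) (K.o i), ?_, ?_, ?_, ?_, ?_⟩
  · intro i hi
    have h1 := K.o_le hi
    rw [Matrix.det_mul, Matrix.det_mul]
    exact (((Matrix.isUnit_nonsing_inv_det_iff).2 (hC i hi)).mul hu).mul (hT _ (by omega))
  · intro i hi
    have h1 := K.o_le_succ i hi
    have h2 : (K.toZero i)⁻¹ = K.P (i + 1) * (K.toZero (i + 1))⁻¹ := by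
      calc (K.toZero i)⁻¹ = (K.toZero i)⁻¹ * (K.toZero (i + 1) * (K.toZero (i + 1))⁻¹) := by
            rw [Matrix.mul_nonsing_inv _ (hC _ hi), Matrix.mul_one]
        _ = _ := by
            rw [K.toZero_succ, Matrix.mul_assoc (K.toZero i), ← Matrix.mul_assoc (K.toZero i)⁻¹,
              Matrix.nonsing_inv_mul _ (hC _ hi.le), Matrix.one_mul]
    rw [h2, Matrix.mul_assoc _ (shiftPow _ _ _), ← shiftPow_add, Nat.add_sub_cancel' h1]
    simp only [Matrix.mul_assoc]
  · rw [hP, K.o_zero, K.o_last, shiftPow_zero, show K.toZero 0 = 1 from rfl, inv_one, Matrix.one_mul,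
      Matrix.mul_one, Matrix.mul_assoc _ (shiftPow _ _ _), ← shiftPow_add, ← two_mul, shiftPow_self,
      Matrix.mul_smul, Matrix.mul_one, Matrix.smul_mul]
  · simp [K.o_zero, shiftPow_zero, hΦ₀]
  · refine ht.smul_left_cancel.1 ?_
    rw [smul_neg, ← smul_neg, ← transpose_shiftPow_mul_gramMatrix, ← hΦ₀, ← Matrix.smul_mul,
      ← Matrix.smul_mul, ← Matrix.transpose_smul, ← Matrix.smul_mul, ← Matrix.smul_mul, ← hP,
      K.o_last, Matrix.transpose_mul, Matrix.transpose_mul, Matrix.mul_assoc _ _ K.A_N]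
    rw [Matrix.mul_assoc _ _ K.A_N, hlast]
    simp only [Matrix.mul_assoc]
    rw [Matrix.mul_nonsing_inv_cancel_left _ _ (hC N le_rfl)]

/-- Over a local ring, all polarized chains are isomorphic to the chain of the lattices `𝒱_i`. -/
theorem exists_isTrivialization [IsLocalRing R] (K : PolarizedChain g N R) :
    ∃ Φ, K.IsTrivialization Φ := by
  by_cases ht : IsUnit (algebraMap ℤ[X] R Polynomial.X)
  · exact exists_isTrivialization_of_isUnit ht
  · exact exists_isTrivialization_of_mem ((IsLocalRing.mem_maximalIdeal _).2 ht)

end PolarizedChain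
end PolarizedChains

/-! ### Coordinates on the lattices -/

theorem latticeMap_injective {n k : ℕ} (hk : k ≤ n) : Function.Injective (latticeMap n k) := by
  intro v w h
  have h1 : (shiftMatrix n ^ k).mulVec v = (shiftMatrix n ^ k).mulVec w := by
    funext i
    exact Polynomial.toLaurent_injective (congrFun h i)
  have h2 := congrArg (shiftMatrix n ^ (n - k)).mulVec h1
  rw [Matrix.mulVec_mulVec, Matrix.mulVec_mulVec, ← pow_add, Nat.sub_add_cancel hk,
    shiftMatrix_pow_self, Matrix.smul_mulVec, Matrix.smul_mulVec, Matrix.one_mulVec,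
    Matrix.one_mulVec] at h2
  funext i
  exact mul_left_cancel₀ Polynomial.X_ne_zero (congrFun h2 i)

theorem matrix_ext_of_surjective {R : Type} [CommRing R] {n : ℕ} {X : Type*} {e : X → Fin n → R}
    (he : Function.Surjective e) {A B : Matrix (Fin n) (Fin n) R}
    (h : ∀ x, A.mulVec (e x) = B.mulVec (e x)) : A = B := by
  refine Matrix.toLin'.injective (LinearMap.ext fun v => ?_)
  obtain ⟨x, rfl⟩ := he v
  exact h x

namespace SymplecticPartition

variable {g N : ℕ} (D : SymplecticPartition g N)

theorem offset_le_g (i : Fin (N + 1)) : D.offset i ≤ g :=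
  (D.offset_le (Nat.lt_succ_iff.1 i.isLt)).trans D.offset_last.le

theorem offset_succ (j : Fin N) : D.offset j.succ = D.offset j.castSucc + D.d j := by
  unfold offset
  rw [← Finset.sum_filter_add_sum_filter_not _ (fun x : Fin N => x.val < j.val), Finset.filter_filter,
    Finset.filter_filter]
  congr 1
  · congr 1
    ext x
    simp only [Finset.mem_filter, Finset.mem_univ, true_and, Fin.val_succ, Fin.val_castSucc]
    omega
  · rw [← Finset.sum_singleton D.d j]
    congr 1
    ext x
    simp only [Finset.mem_filter, Finset.mem_univ, true_and, Fin.val_succ, Finset.mem_singleton,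
      Fin.ext_iff]
    omega

/-- `T ^ (d_1 + ⋯ + d_i)` as an isomorphism of `ℤ[t]^{2g}` with `𝒱_i`. -/
def latticeEquiv (i : Fin (N + 1)) : (Fin (2 * g) → ℤ[X]) ≃ₗ[ℤ[X]] D.V i :=
  LinearEquiv.ofInjective (latticeMap (2 * g) (D.offset i))
    (latticeMap_injective ((D.offset_le_g i).trans (by omega)))

theorem coe_latticeEquiv (i : Fin (N + 1)) (v : Fin (2 * g) → ℤ[X]) :
    (D.latticeEquiv i v : Fin (2 * g) → ℤ[T;T⁻¹]) = latticeMap (2 * g) (D.offset i) v := rfl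

theorem α_latticeEquiv (i : Fin (N + 1)) (v : Fin (2 * g) → ℤ[X]) :
    D.α i (D.latticeEquiv i v) =
      D.latticeEquiv (i - 1) ((shiftMatrix (2 * g) ^ D.step i).mulVec v) := by
  refine Subtype.ext ?_
  have h1 : (D.α i (D.latticeEquiv i v) : Fin (2 * g) → ℤ[T;T⁻¹]) =
      (if i = 0 then (Polynomial.X : ℤ[X]) else 1) • latticeMap (2 * g) (D.offset i) v := rfl
  have hadd : ∀ k l : ℕ, latticeMap (2 * g) k ((shiftMatrix (2 * g) ^ l).mulVec v) =
      latticeMap (2 * g) (k + l) v := by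
    intro k l
    simp only [latticeMap, LinearMap.comp_apply, Matrix.mulVecLin_apply, Matrix.mulVec_mulVec,
      ← pow_add]
  rw [h1, coe_latticeEquiv, hadd]
  refine Fin.cases ?_ (fun j => ?_) i
  · have h0 : (0 : Fin (N + 1)) - 1 = Fin.last N := Fin.ext (by simp)
    rw [if_pos rfl, h0, offset_last, offset_zero, ← map_smul]
    have h2 : D.step 0 = g := rfl
    rw [h2, ← two_mul]
    simp only [latticeMap, LinearMap.comp_apply, shiftMatrix_pow_self, pow_zero,
      Matrix.mulVecLin_apply, Matrix.one_mulVec, Matrix.smul_mulVec]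
  · have h0 : j.succ - 1 = j.castSucc := Fin.ext (by simp [Fin.coe_sub_one])
    rw [if_neg (Fin.succ_ne_zero j), one_smul, h0, offset_succ]
    rfl

theorem formZero_latticeEquiv (v w : Fin (2 * g) → ℤ[X]) :
    D.formZero (D.latticeEquiv 0 v) (D.latticeEquiv 0 w) =
      v ⬝ᵥ (symplecticMatrix g).mulVec w := by
  refine Polynomial.toLaurent_injective ?_
  refine (D.algebraMap_formZero _ _).trans ?_
  rw [coe_latticeEquiv, coe_latticeEquiv, laurentForm_latticeMap, offset_zero, pow_zero,
    Matrix.transpose_one, Matrix.one_mul, Matrix.mul_one]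
  rfl

theorem formLast_latticeEquiv (v w : Fin (2 * g) → ℤ[X]) :
    D.formLast (D.latticeEquiv (Fin.last N) v) (D.latticeEquiv (Fin.last N) w) =
      v ⬝ᵥ (-symplecticMatrix g).mulVec w := by
  refine Polynomial.toLaurent_injective ?_
  refine (D.algebraMap_formLast _ _).trans ?_
  rw [coe_latticeEquiv, coe_latticeEquiv, laurentForm_latticeMap, offset_last,
    transpose_shift_mul_symplectic, Matrix.smul_mulVec, dotProduct_smul, smul_eq_mul, map_mul,
    ← mul_assoc, LaurentPolynomial.algebraMap_eq_toLaurent Polynomial.X, Polynomial.toLaurent_X,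
    ← LaurentPolynomial.T_add]
  simp

section Coord

variable (R : Type) [CommRing R] [Algebra ℤ[X] R]

/-- The coordinates on `R ⊗ 𝒱_i` in the image by `T ^ (d_1 + ⋯ + d_i)` of the standard basis. -/
def coord (i : Fin (N + 1)) : (R ⊗[ℤ[X]] D.V i) ≃ₗ[R] (Fin (2 * g) → R) :=
  (D.latticeEquiv i).symm.baseChange ℤ[X] R _ _ ≪≫ₗ
    TensorProduct.piScalarRight ℤ[X] R R (Fin (2 * g))

theorem coord_tmul (i : Fin (N + 1)) (r : R) (v : Fin (2 * g) → ℤ[X]) :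
    D.coord R i (r ⊗ₜ D.latticeEquiv i v) = r • (algebraMap ℤ[X] R ∘ v) := by
  funext j
  rw [coord, LinearEquiv.trans_apply, LinearEquiv.baseChange_tmul, LinearEquiv.symm_apply_apply,
    TensorProduct.piScalarRight_apply, TensorProduct.piScalarRightHom_tmul]
  simp only [Algebra.smul_def, Pi.smul_apply, Function.comp_apply]
  exact mul_comm _ _

variable {R} in
theorem tensor_induction {i : Fin (N + 1)} {p : R ⊗[ℤ[X]] D.V i → Prop} (zero : p 0)
    (tmul : ∀ r v, p (r ⊗ₜ D.latticeEquiv i v)) (add : ∀ x y, p x → p y → p (x + y)) (x) : p x := by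
  induction x using TensorProduct.induction_on with
  | zero => exact zero
  | tmul r m =>
    obtain ⟨v, rfl⟩ := (D.latticeEquiv i).surjective m
    exact tmul r v
  | add x y hx hy => exact add x y hx hy

theorem coord_scalarMap {R S : Type} [CommRing R] [Algebra ℤ[X] R] [CommRing S] [Algebra ℤ[X] S]
    (f : R →ₐ[ℤ[X]] S) (i : Fin (N + 1)) (x : R ⊗[ℤ[X]] D.V i) :
    D.coord S i (scalarMap f x) = f ∘ D.coord R i x := by
  induction x using D.tensor_induction with
  | zero => funext j; simp
  | tmul r v => rw [scalarMap_tmul, coord_tmul, coord_tmul]; funext j; simp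
  | add x y hx hy => rw [map_add, map_add, hx, hy, map_add]; funext j; simp

theorem coord_α (i : Fin (N + 1)) (x : R ⊗[ℤ[X]] D.V i) :
    D.coord R (i - 1) ((D.α i).baseChange R x) =
      (shiftPow R (2 * g) (D.step i)).mulVec (D.coord R i x) := by
  induction x using D.tensor_induction with
  | zero => simp
  | tmul r v =>
    rw [LinearMap.baseChange_tmul, α_latticeEquiv, coord_tmul, coord_tmul, Matrix.mulVec_smul]
    congr 1
    funext j
    exact RingHom.map_mulVec _ _ _ j
  | add x y hx hy => rw [map_add, map_add, hx, hy, map_add, Matrix.mulVec_add]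

theorem baseChange_form_eq (i : Fin (N + 1)) (B : LinearMap.BilinForm ℤ[X] (D.V i))
    (M : Matrix (Fin (2 * g)) (Fin (2 * g)) ℤ[X])
    (h : ∀ v w, B (D.latticeEquiv i v) (D.latticeEquiv i w) = v ⬝ᵥ M.mulVec w)
    (x y : R ⊗[ℤ[X]] D.V i) :
    B.baseChange R x y =
      D.coord R i x ⬝ᵥ (M.map (algebraMap ℤ[X] R)).mulVec (D.coord R i y) := by
  induction x using D.tensor_induction with
  | zero => simp
  | add x y hx hy => rw [map_add, map_add, LinearMap.add_apply, hx, hy, add_dotProduct]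
  | tmul r v =>
    induction y using D.tensor_induction with
    | zero => simp
    | add x y hx hy => rw [map_add, map_add, hx, hy, Matrix.mulVec_add, dotProduct_add]
    | tmul s w =>
      rw [LinearMap.BilinForm.baseChange_tmul, h, coord_tmul, coord_tmul, Matrix.mulVec_smul,
        smul_dotProduct, dotProduct_smul]
      have h1 : (M.map (algebraMap ℤ[X] R)).mulVec (algebraMap ℤ[X] R ∘ w) =
          algebraMap ℤ[X] R ∘ M.mulVec w := funext fun j => (RingHom.map_mulVec _ _ _ j).symm
      rw [h1, ← RingHom.map_dotProduct, Algebra.smul_def, smul_eq_mul, smul_eq_mul]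
      ring

theorem formZero_eq (x y : R ⊗[ℤ[X]] D.V 0) : D.formZero.baseChange R x y =
    D.coord R 0 x ⬝ᵥ (gramMatrix R g).mulVec (D.coord R 0 y) :=
  D.baseChange_form_eq R 0 _ _ D.formZero_latticeEquiv x y

theorem formLast_eq (x y : R ⊗[ℤ[X]] D.V (Fin.last N)) : D.formLast.baseChange R x y =
    D.coord R (Fin.last N) x ⬝ᵥ (-gramMatrix R g).mulVec (D.coord R (Fin.last N) y) := by
  rw [D.baseChange_form_eq R (Fin.last N) _ _ D.formLast_latticeEquiv x y]
  congr 2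
  ext r c
  simp [gramMatrix]

end Coord

section Frames

variable {R S : Type} [CommRing R] [Algebra ℤ[X] R] [CommRing S] [Algebra ℤ[X] S]
  {i : Fin (N + 1)}

/-- The matrix, in the coordinates `coord`, of a trivialisation of `R ⊗ 𝒱_i`. -/
def frameMatrix (φ : (R ⊗[ℤ[X]] D.V i) ≃ₗ[R] (Fin (2 * g) → R)) :
    Matrix (Fin (2 * g)) (Fin (2 * g)) R :=
  LinearMap.toMatrix' (φ.toLinearMap ∘ₗ (D.coord R i).symm.toLinearMap)

/-- The inverse of `frameMatrix`. -/
def frameInvMatrix (φ : (R ⊗[ℤ[X]] D.V i) ≃ₗ[R] (Fin (2 * g) → R)) :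
    Matrix (Fin (2 * g)) (Fin (2 * g)) R :=
  LinearMap.toMatrix' ((D.coord R i).toLinearMap ∘ₗ φ.symm.toLinearMap)

theorem frameMatrix_mulVec (φ : (R ⊗[ℤ[X]] D.V i) ≃ₗ[R] (Fin (2 * g) → R)) (x) :
    (D.frameMatrix φ).mulVec (D.coord R i x) = φ x := by
  rw [frameMatrix, ← Matrix.toLin'_apply, Matrix.toLin'_toMatrix']
  simp

theorem frameInvMatrix_mulVec (φ : (R ⊗[ℤ[X]] D.V i) ≃ₗ[R] (Fin (2 * g) → R)) (x) :
    (D.frameInvMatrix φ).mulVec (φ x) = D.coord R i x := by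
  rw [frameInvMatrix, ← Matrix.toLin'_apply, Matrix.toLin'_toMatrix']
  simp

theorem frameMatrix_mul_inv (φ : (R ⊗[ℤ[X]] D.V i) ≃ₗ[R] (Fin (2 * g) → R)) :
    D.frameMatrix φ * D.frameInvMatrix φ = 1 :=
  matrix_ext_of_surjective φ.surjective fun x => by
    rw [← Matrix.mulVec_mulVec, frameInvMatrix_mulVec, frameMatrix_mulVec, Matrix.one_mulVec]

theorem frameInvMatrix_mul (φ : (R ⊗[ℤ[X]] D.V i) ≃ₗ[R] (Fin (2 * g) → R)) :
    D.frameInvMatrix φ * D.frameMatrix φ = 1 :=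
  mul_eq_one_comm.1 (D.frameMatrix_mul_inv φ)

theorem frameMatrix_injective {φ ψ : (R ⊗[ℤ[X]] D.V i) ≃ₗ[R] (Fin (2 * g) → R)}
    (h : D.frameMatrix φ = D.frameMatrix ψ) : φ = ψ :=
  LinearEquiv.ext fun x => by rw [← frameMatrix_mulVec, h, frameMatrix_mulVec]

theorem frameMatrix_mapFraming (f : R →ₐ[ℤ[X]] S)
    (φ : (R ⊗[ℤ[X]] D.V i) ≃ₗ[R] (Fin (2 * g) → R)) :
    D.frameMatrix (mapFraming f φ) = (D.frameMatrix φ).map f := by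
  ext r c
  have h1 : D.coord S i (scalarMap f ((D.coord R i).symm (Pi.single c 1))) = Pi.single c 1 := by
    rw [coord_scalarMap, LinearEquiv.apply_symm_apply]
    funext j
    rw [Function.comp_apply, Pi.single_apply, Pi.single_apply]
    split_ifs <;> simp
  have h2 := D.frameMatrix_mulVec (mapFraming f φ)
    (scalarMap f ((D.coord R i).symm (Pi.single c 1)))
  rw [h1, mapFraming_scalarMap, ← frameMatrix_mulVec, LinearEquiv.apply_symm_apply,
    Matrix.mulVec_single_one, Matrix.mulVec_single_one] at h2
  exact congrFun h2 r

theorem frameInvMatrix_mapFraming (f : R →ₐ[ℤ[X]] S)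
    (φ : (R ⊗[ℤ[X]] D.V i) ≃ₗ[R] (Fin (2 * g) → R)) :
    D.frameInvMatrix (mapFraming f φ) = (D.frameInvMatrix φ).map f := by
  have h1 : (D.frameMatrix φ).map f * (D.frameInvMatrix φ).map f = 1 := by
    rw [← Matrix.map_mul, frameMatrix_mul_inv, Matrix.map_one _ (map_zero f) (map_one f)]
  refine left_inv_eq_right_inv (D.frameInvMatrix_mul (mapFraming f φ)) ?_
  rw [frameMatrix_mapFraming, h1]

/-- The trivialisation of `R ⊗ 𝒱_i` with given matrix and inverse matrix. -/
def frameOfMatrix (i : Fin (N + 1)) (Φ Ψ : Matrix (Fin (2 * g)) (Fin (2 * g)) R) (h : Φ * Ψ = 1) :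
    (R ⊗[ℤ[X]] D.V i) ≃ₗ[R] (Fin (2 * g) → R) :=
  D.coord R i ≪≫ₗ Matrix.toLin'OfInv (mul_eq_one_comm.1 h) h

theorem frameOfMatrix_apply (Φ Ψ : Matrix (Fin (2 * g)) (Fin (2 * g)) R) (h : Φ * Ψ = 1) (x) :
    D.frameOfMatrix i Φ Ψ h x = Φ.mulVec (D.coord R i x) := rfl

theorem frameMatrix_frameOfMatrix (Φ Ψ : Matrix (Fin (2 * g)) (Fin (2 * g)) R) (h : Φ * Ψ = 1) :
    D.frameMatrix (D.frameOfMatrix i Φ Ψ h) = Φ :=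
  matrix_ext_of_surjective (D.coord R i).surjective fun x => by
    rw [frameMatrix_mulVec, frameOfMatrix_apply]

theorem frameInvMatrix_frameOfMatrix (Φ Ψ : Matrix (Fin (2 * g)) (Fin (2 * g)) R) (h : Φ * Ψ = 1) :
    D.frameInvMatrix (D.frameOfMatrix i Φ Ψ h) = Ψ := by
  refine left_inv_eq_right_inv (D.frameInvMatrix_mul _) ?_
  rw [frameMatrix_frameOfMatrix, h]

end Frames

end SymplecticPartition

/-! ### Ideals of minors -/

section Minors

variable {R : Type} [CommRing R]

theorem det_mem_of_entries {n : ℕ} (hn : 0 < n) (I : Ideal R) (M : Matrix (Fin n) (Fin n) R)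
    (h : ∀ i j, M i j ∈ I) : M.det ∈ I := by
  rw [Matrix.det_apply]
  refine Ideal.sum_mem _ fun σ _ => ?_
  refine Submodule.smul_of_tower_mem I _ ?_
  exact Ideal.mem_of_dvd _ (Finset.dvd_prod_of_mem _ (Finset.mem_univ (⟨0, hn⟩ : Fin n))) (h _ _)

/-- The ideal generated by the minors of size `k`. -/
def minorIdeal (k : ℕ) {n : ℕ} (M : Matrix (Fin n) (Fin n) R) : Ideal R :=
  Ideal.span {a | ∃ r c : Fin k → Fin n, a = (M.submatrix r c).det}

theorem det_submatrix_mul_mem {k n : ℕ} (A B : Matrix (Fin n) (Fin n) R) (r c : Fin k → Fin n) :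
    ((A * B).submatrix r c).det ∈ minorIdeal k B := by
  have h : (A * B).submatrix r c = fun i => ∑ s, A (r i) s • fun j => B s (c j) := by
    ext i j
    simp [Matrix.mul_apply, Finset.sum_apply]
  have h1 : ((A * B).submatrix r c).det = Matrix.detRowAlternating.toMultilinearMap
      fun i => ∑ s, A (r i) s • fun j => B s (c j) := by
    rw [h]
    rfl
  rw [h1, MultilinearMap.map_sum]
  refine Ideal.sum_mem _ fun s _ => ?_
  rw [MultilinearMap.map_smul_univ, smul_eq_mul]
  exact Ideal.mul_mem_left _ _ (Ideal.subset_span ⟨s, c, rfl⟩)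

theorem minorIdeal_mul_le_right (k : ℕ) {n : ℕ} (A B : Matrix (Fin n) (Fin n) R) :
    minorIdeal k (A * B) ≤ minorIdeal k B := by
  refine Ideal.span_le.2 ?_
  rintro _ ⟨r, c, rfl⟩
  exact det_submatrix_mul_mem A B r c

theorem minorIdeal_transpose (k : ℕ) {n : ℕ} (A : Matrix (Fin n) (Fin n) R) :
    minorIdeal k A.transpose = minorIdeal k A := by
  have h : ∀ A : Matrix (Fin n) (Fin n) R, minorIdeal k A.transpose ≤ minorIdeal k A := by
    intro A
    refine Ideal.span_le.2 ?_
    rintro _ ⟨r, c, rfl⟩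
    refine Ideal.subset_span ⟨c, r, ?_⟩
    rw [← Matrix.det_transpose, Matrix.transpose_submatrix, Matrix.transpose_transpose]
  refine le_antisymm (h A) ?_
  conv_lhs => rw [← A.transpose_transpose]
  exact h _

theorem minorIdeal_mul_le_left (k : ℕ) {n : ℕ} (A B : Matrix (Fin n) (Fin n) R) :
    minorIdeal k (A * B) ≤ minorIdeal k A := by
  rw [← minorIdeal_transpose, Matrix.transpose_mul, ← minorIdeal_transpose k A]
  exact minorIdeal_mul_le_right k _ _

theorem minorIdeal_le_span_entries {k : ℕ} (hk : 0 < k) {n : ℕ} (A : Matrix (Fin n) (Fin n) R) :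
    minorIdeal k A ≤ Ideal.span {a | ∃ r c, a = A r c} := by
  refine Ideal.span_le.2 ?_
  rintro _ ⟨r, c, rfl⟩
  exact det_mem_of_entries hk _ _ fun i j => Ideal.subset_span ⟨r i, c j, rfl⟩

variable [Algebra ℤ[X] R]

theorem minorIdeal_shiftPow {n d : ℕ} (hd : d ≤ n) : minorIdeal (n - d) (shiftPow R n d) = ⊤ := by
  refine (Ideal.eq_top_iff_one _).2 (Ideal.subset_span ?_)
  refine ⟨fun i => ⟨i.val, by omega⟩, fun i => ⟨i.val + d, by omega⟩, ?_⟩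
  rw [← Matrix.det_one (n := Fin (n - d))]
  congr 1
  ext i j
  have := i.isLt
  have := j.isLt
  rw [Matrix.submatrix_apply, shiftPow, Matrix.map_apply, shiftMatrix_pow_apply n d hd,
    Matrix.one_apply]
  simp only [Fin.ext_iff]
  by_cases h : i.val = j.val
  · rw [if_pos h, if_pos (by omega), map_one]
  · rw [if_neg h, if_neg (by omega), if_neg (by omega), map_zero]

end Minors

/-! ### Matrices indexed by `ℤ/(N+1)ℤ` -/

section Periodic

variable {R : Type} [CommRing R]

theorem list_prod_ofFn_eq_segmentProd {n N m : ℕ}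
    (M : Fin (N + 1) → Matrix (Fin n) (Fin n) R) (F : Fin m → Matrix (Fin n) (Fin n) R) (i : ℕ)
    (h : ∀ k : Fin m, F k = M (Fin.ofNat (N + 1) (i + k.val))) :
    (List.ofFn F).prod = segmentProd (fun j => M (Fin.ofNat (N + 1) j)) i m := by
  rw [segmentProd]
  congr 1
  refine List.ext_getElem (by simp) fun k h1 h2 => ?_
  rw [List.getElem_ofFn, List.getElem_map, List.getElem_range, h]

theorem prod_cyclic {n N : ℕ} (M : Fin (N + 1) → Matrix (Fin n) (Fin n) R) (i : Fin (N + 1)) :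
    (List.ofFn fun k : Fin (N + 1) => M (i + k)).prod =
      segmentProd (fun j => M (Fin.ofNat (N + 1) j)) i.val (N + 1) :=
  list_prod_ofFn_eq_segmentProd M _ _ fun k => congrArg M (Fin.ext (by
    rw [Fin.val_add, Fin.val_ofNat]))

theorem prod_succ {n N : ℕ} (M : Fin (N + 1) → Matrix (Fin n) (Fin n) R) :
    (List.ofFn fun k : Fin N => M k.succ).prod =
      segmentProd (fun j => M (Fin.ofNat (N + 1) j)) 1 N :=
  list_prod_ofFn_eq_segmentProd M _ _ fun k => congrArg M (Fin.ext (by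
    rw [Fin.val_succ, Fin.val_ofNat, Nat.mod_eq_of_lt (by omega), add_comm]))

theorem ofNat_add_period (N j : ℕ) : Fin.ofNat (N + 1) (j + (N + 1)) = Fin.ofNat (N + 1) j :=
  Fin.ext (by rw [Fin.val_ofNat, Fin.val_ofNat, Nat.add_mod_right])

theorem ofNat_succ_sub_one (N j : ℕ) : Fin.ofNat (N + 1) (j + 1) - 1 = Fin.ofNat (N + 1) j := by
  rw [sub_eq_iff_eq_add]
  refine Fin.ext ?_
  rw [Fin.val_add, Fin.val_ofNat, Fin.val_ofNat, Nat.add_mod, Fin.val_one']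

theorem segmentProd_conj {n : ℕ} (P a Φ Ψ : ℕ → Matrix (Fin n) (Fin n) R) (h : ∀ j, Ψ j * Φ j = 1)
    (h' : ∀ j, Φ j * Ψ j = 1)
    (hP : ∀ j, P (j + 1) = Φ j * a (j + 1) * Ψ (j + 1)) (j m : ℕ) :
    segmentProd P (j + 1) m = Φ j * segmentProd a (j + 1) m * Ψ (j + m) := by
  induction m with
  | zero => simp [h']
  | succ m ih =>
    rw [segmentProd_succ, segmentProd_succ, ih, show j + 1 + m = j + m + 1 by omega, hP,
      show j + (m + 1) = j + m + 1 by omega]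
    simp only [Matrix.mul_assoc]
    rw [← Matrix.mul_assoc (Ψ (j + m)), h, Matrix.one_mul]

theorem segmentProd_shiftPow [Algebra ℤ[X] R] (n : ℕ) (e : ℕ → ℕ) (j m : ℕ) :
    segmentProd (fun i => shiftPow R n (e i)) j m =
      shiftPow R n (∑ k ∈ Finset.range m, e (j + k)) := by
  induction m with
  | zero => simp [shiftPow_zero]
  | succ m ih => rw [segmentProd_succ, ih, Finset.sum_range_succ, shiftPow_add]

end Periodic

namespace SymplecticPartition

variable {g N : ℕ} (D : SymplecticPartition g N)

theorem sum_step_succ : ∑ k ∈ Finset.range N, D.step (Fin.ofNat (N + 1) (1 + k)) = g := by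
  rw [Finset.sum_range]
  refine Eq.trans ?_ D.sum_d
  refine Finset.sum_congr rfl fun j _ => ?_
  have h : Fin.ofNat (N + 1) (1 + j.val) = j.succ := Fin.ext (by
    rw [Fin.val_ofNat, Fin.val_succ, Nat.mod_eq_of_lt (by omega), add_comm])
  rw [h]
  rfl

theorem sum_step (i : ℕ) :
    ∑ k ∈ Finset.range (N + 1), D.step (Fin.ofNat (N + 1) (i + k)) = 2 * g := by
  have h1 : ∀ k : Fin (N + 1), Fin.ofNat (N + 1) (i + k.val) = Fin.ofNat (N + 1) i + k := fun k =>
    Fin.ext (by simp [Fin.val_add])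
  rw [Finset.sum_range]
  simp only [h1]
  refine (Equiv.sum_comp (Equiv.addLeft (Fin.ofNat (N + 1) i)) D.step).trans ?_
  rw [Fin.sum_univ_succ, two_mul]
  exact congrArg (g + ·) D.sum_d

theorem step_le (i : Fin (N + 1)) : D.step i ≤ g := by
  refine Fin.cases le_rfl (fun j => ?_) i
  exact (Finset.single_le_sum (fun _ _ => Nat.zero_le _) (Finset.mem_univ j)).trans D.sum_d.le

theorem g_pos {g N : ℕ} (D : SymplecticPartition g N) (hN : 0 < N) : 0 < g :=
  (D.d_pos ⟨0, hN⟩).trans_le (D.step_le (Fin.succ ⟨0, hN⟩))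

end SymplecticPartition

/-! ### Transport of structure -/

section StandardFactor

variable {g : ℕ} {R : Type} [CommRing R]

/-- The preimage of `Ω` under a trivialisation, as a point of the Grassmannian. -/
def grassmannianOfFrame {V : Type} [AddCommGroup V] [Module R V]
    (φ : V ≃ₗ[R] (Fin (2 * g) → R)) : Module.Grassmannian R V g :=
  let q : V →ₗ[R] (Fin g → R) :=
    LinearMap.funLeft R R (fun j : Fin g => (⟨g + j.val, by omega⟩ : Fin (2 * g))) ∘ₗ φ.toLinearMap
  have hq : Function.Surjective q := by
    intro y
    obtain ⟨v, hv⟩ := φ.surjective fun j => if h : g ≤ j.val then y ⟨j.val - g, by omega⟩ else 0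
    refine ⟨v, funext fun j => ?_⟩
    change φ v ⟨g + j.val, by omega⟩ = y j
    rw [hv]
    exact (dif_pos (by simp)).trans (by simp)
  have hker : (standardFactor R g).comap φ.toLinearMap = LinearMap.ker q := by
    ext v
    rw [Submodule.mem_comap, LinearMap.mem_ker]
    constructor
    · intro h
      funext j
      exact h _ (by simp)
    · intro h j hj
      have h1 := congrFun h ⟨j.val - g, by omega⟩
      refine Eq.trans ?_ h1
      exact congrArg (φ v) (Fin.ext (show j.val = g + (j.val - g) by omega))
  have e : (V ⧸ (standardFactor R g).comap φ.toLinearMap) ≃ₗ[R] (Fin g → R) :=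
    Submodule.quotEquivOfEq _ _ hker ≪≫ₗ q.quotKerEquivOfSurjective hq
  { toSubmodule := (standardFactor R g).comap φ.toLinearMap
    finite_quotient := Module.Finite.equiv e.symm
    projective_quotient := Module.Projective.of_equiv e.symm
    rankAtStalk_eq := fun p => by
      have : Nontrivial R := p.nontrivial
      rw [Module.rankAtStalk_eq_of_equiv e, Module.rankAtStalk_eq_finrank_of_free]
      simp }

theorem dotProduct_mulVec_eq_zero (A : Matrix (Fin (2 * g)) (Fin (2 * g)) R)
    (hA : ∀ i j : Fin (2 * g), i.val < g → j.val < g → A i j = 0) {v w : Fin (2 * g) → R}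
    (hv : v ∈ standardFactor R g) (hw : w ∈ standardFactor R g) : v ⬝ᵥ A.mulVec w = 0 := by
  refine Finset.sum_eq_zero fun i _ => ?_
  rcases lt_or_ge i.val g with hi | hi
  · refine mul_eq_zero_of_right _ ?_
    change ∑ j, A i j * w j = 0
    refine Finset.sum_eq_zero fun j _ => ?_
    rcases lt_or_ge j.val g with hj | hj
    · rw [hA i j hi hj, zero_mul]
    · rw [hw j hj, mul_zero]
  · rw [hv i hi, zero_mul]

theorem mulVec_mem_standardFactor (A : Matrix (Fin (2 * g)) (Fin (2 * g)) R)
    (hA : ∀ r c : Fin (2 * g), g ≤ r.val → c.val < g → A r c = 0) {v : Fin (2 * g) → R}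
    (hv : v ∈ standardFactor R g) : A.mulVec v ∈ standardFactor R g := by
  intro r hr
  change ∑ c, A r c * v c = 0
  refine Finset.sum_eq_zero fun c _ => ?_
  rcases lt_or_ge c.val g with hc | hc
  · rw [hA r c hr hc, zero_mul]
  · rw [hv c hc, mul_zero]

end StandardFactor

section Transport

variable {g N : ℕ} {D : SymplecticPartition g N} {R : Type} [CommRing R] [Algebra ℤ[X] R]

theorem RigidifiedSp.ω_eq_comap (x : RigidifiedSp D R) (i : Fin (N + 1)) :
    (x.ω i).toSubmodule = (standardFactor R g).comap (x.φ i).toLinearMap := by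
  rw [← x.map_φ i, Submodule.comap_map_eq_of_injective]
  exact (x.φ i).injective

theorem RigidifiedSp.ext_φ {x y : RigidifiedSp D R} (h : x.φ = y.φ) : x = y := by
  refine RigidifiedSp.ext (funext fun i => Module.Grassmannian.ext ?_) h
  rw [x.ω_eq_comap, y.ω_eq_comap, h]

/-- Trivialisations `φ_i` give a point of the rigidified local model as soon as the matrices deduced
from the `α_i` and from the forms by transport of structure stabilise `Ω`, resp. vanish on `Ω`. -/
def RigidifiedSp.ofFrames (φ : ∀ i, (R ⊗[ℤ[X]] D.V i) ≃ₗ[R] (Fin (2 * g) → R))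
    (mat : Fin (N + 1) → Matrix (Fin (2 * g)) (Fin (2 * g)) R)
    (A₀ A_N : Matrix (Fin (2 * g)) (Fin (2 * g)) R)
    (hmat : ∀ i v, (mat i).mulVec (φ i v) = φ (i - 1) ((D.α i).baseChange R v))
    (hA₀ : ∀ v w, φ 0 v ⬝ᵥ A₀.mulVec (φ 0 w) = D.formZero.baseChange R v w)
    (hA_N : ∀ v w, φ (Fin.last N) v ⬝ᵥ A_N.mulVec (φ (Fin.last N) w) =
      D.formLast.baseChange R v w)
    (parabolic : ∀ i (r c : Fin (2 * g)), g ≤ r.val → c.val < g → mat i r c = 0)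
    (isotropic_zero : ∀ i j : Fin (2 * g), i.val < g → j.val < g → A₀ i j = 0)
    (isotropic_last : ∀ i j : Fin (2 * g), i.val < g → j.val < g → A_N i j = 0) :
    RigidifiedSp D R where
  ω i := grassmannianOfFrame (φ i)
  map_le i := by
    rintro _ ⟨v, hv, rfl⟩
    change φ (i - 1) ((D.α i).baseChange R v) ∈ standardFactor R g
    rw [← hmat]
    exact mulVec_mem_standardFactor _ (parabolic i) hv
  isotropic_zero v hv w hw := by
    rw [← hA₀]
    exact dotProduct_mulVec_eq_zero _ isotropic_zero hv hw
  isotropic_last v hv w hw := by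
    rw [← hA_N]
    exact dotProduct_mulVec_eq_zero _ isotropic_last hv hw
  φ := φ
  map_φ i := Submodule.map_comap_eq_of_surjective (φ i).surjective _

theorem exists_isTransport_of_frames (σ : SigmaDPoint D R)
    (φ : ∀ i, (R ⊗[ℤ[X]] D.V i) ≃ₗ[R] (Fin (2 * g) → R))
    (hmat : ∀ i v, (σ.mat i).mulVec (φ i v) = φ (i - 1) ((D.α i).baseChange R v))
    (hA₀ : ∀ v w, φ 0 v ⬝ᵥ σ.A₀.mulVec (φ 0 w) = D.formZero.baseChange R v w)
    (hA_N : ∀ v w, φ (Fin.last N) v ⬝ᵥ σ.A_N.mulVec (φ (Fin.last N) w) =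
      D.formLast.baseChange R v w) : ∃ x : RigidifiedSp D R, IsTransport x σ :=
  ⟨.ofFrames φ σ.mat σ.A₀ σ.A_N hmat hA₀ hA_N σ.parabolic σ.symplectic_zero.isotropic
    σ.symplectic_last.isotropic, ⟨hmat, hA₀, hA_N⟩⟩

/-- The matrix `Π_i = φ_{i-1} α_i φ_i⁻¹`. -/
def transportMat (φ : ∀ i, (R ⊗[ℤ[X]] D.V i) ≃ₗ[R] (Fin (2 * g) → R)) (i : Fin (N + 1)) :
    Matrix (Fin (2 * g)) (Fin (2 * g)) R :=
  D.frameMatrix (φ (i - 1)) * shiftPow R (2 * g) (D.step i) * D.frameInvMatrix (φ i)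

/-- The Gram matrix, in the basis given by a trivialisation `φ` of `R ⊗ 𝒱_i`, of the form with matrix
`A` in the coordinates `coord`. -/
def transportForm {i : Fin (N + 1)} (φ : (R ⊗[ℤ[X]] D.V i) ≃ₗ[R] (Fin (2 * g) → R))
    (A : Matrix (Fin (2 * g)) (Fin (2 * g)) R) : Matrix (Fin (2 * g)) (Fin (2 * g)) R :=
  (D.frameInvMatrix φ).transpose * A * D.frameInvMatrix φ

theorem transportMat_mulVec (φ : ∀ i, (R ⊗[ℤ[X]] D.V i) ≃ₗ[R] (Fin (2 * g) → R))
    (i : Fin (N + 1)) (v) :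
    (transportMat φ i).mulVec (φ i v) = φ (i - 1) ((D.α i).baseChange R v) := by
  rw [transportMat, ← Matrix.mulVec_mulVec, ← Matrix.mulVec_mulVec, D.frameInvMatrix_mulVec,
    ← D.coord_α, D.frameMatrix_mulVec]

theorem transportForm_apply {i : Fin (N + 1)} (φ : (R ⊗[ℤ[X]] D.V i) ≃ₗ[R] (Fin (2 * g) → R))
    (A : Matrix (Fin (2 * g)) (Fin (2 * g)) R) (v w) :
    φ v ⬝ᵥ (transportForm φ A).mulVec (φ w) = D.coord R i v ⬝ᵥ A.mulVec (D.coord R i w) := by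
  rw [transportForm, ← Matrix.mulVec_mulVec, ← Matrix.mulVec_mulVec, D.frameInvMatrix_mulVec,
    Matrix.dotProduct_mulVec, Matrix.vecMul_transpose, D.frameInvMatrix_mulVec]

theorem RigidifiedSp.transportMat_parabolic (x : RigidifiedSp D R) (i : Fin (N + 1))
    (r c : Fin (2 * g)) (hr : g ≤ r.val) (hc : c.val < g) : transportMat x.φ i r c = 0 := by
  obtain ⟨v, hv⟩ := (x.φ i).surjective (Pi.single c 1)
  have h1 : v ∈ (x.ω i).toSubmodule := by
    rw [x.ω_eq_comap]
    intro j hj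
    rw [LinearEquiv.coe_coe, hv, Pi.single_eq_of_ne]
    rintro rfl
    omega
  have h2 := x.map_le i ⟨v, h1, rfl⟩
  rw [x.ω_eq_comap] at h2
  have h3 := h2 r hr
  rw [LinearEquiv.coe_coe, ← transportMat_mulVec, hv, Matrix.mulVec_single_one] at h3
  exact h3

theorem RigidifiedSp.transportForm_isotropic (x : RigidifiedSp D R) (i : Fin (N + 1))
    (A : Matrix (Fin (2 * g)) (Fin (2 * g)) R)
    (h : ∀ v ∈ (x.ω i).toSubmodule, ∀ w ∈ (x.ω i).toSubmodule,
      D.coord R i v ⬝ᵥ A.mulVec (D.coord R i w) = 0) (r c : Fin (2 * g)) (hr : r.val < g)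
    (hc : c.val < g) : transportForm (x.φ i) A r c = 0 := by
  have h1 : ∀ c : Fin (2 * g), c.val < g → ∃ v ∈ (x.ω i).toSubmodule, x.φ i v = Pi.single c 1 := by
    intro c hc
    obtain ⟨v, hv⟩ := (x.φ i).surjective (Pi.single c 1)
    refine ⟨v, ?_, hv⟩
    rw [x.ω_eq_comap]
    intro j hj
    rw [LinearEquiv.coe_coe, hv, Pi.single_eq_of_ne]
    rintro rfl
    omega
  obtain ⟨v, hv, hv'⟩ := h1 r hr
  obtain ⟨w, hw, hw'⟩ := h1 c hc
  have h2 := h v hv w hw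
  rw [← transportForm_apply (x.φ i), hv', hw', Matrix.mulVec_single_one] at h2
  simpa using h2

end Transport

section Transport
variable {g N : ℕ} {D : SymplecticPartition g N} {R : Type} [CommRing R] [Algebra ℤ[X] R]

theorem isSymplecticGram_gramMatrix_conj {ε : R} (hε : ε * ε = 1)
    {Ψ Φ : Matrix (Fin (2 * g)) (Fin (2 * g)) R} (h : Φ * Ψ = 1)
    (hiso : ∀ i j : Fin (2 * g), i.val < g → j.val < g →
      (Ψ.transpose * (ε • gramMatrix R g) * Ψ) i j = 0) :
    IsSymplecticGram g (Ψ.transpose * (ε • gramMatrix R g) * Ψ) := by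
  have hdiag : ∀ i, (gramMatrix R g) i i = 0 := by
    intro i
    rw [gramMatrix, Matrix.map_apply, symplecticMatrix, Matrix.of_apply, if_neg (by omega), map_zero]
  have hskew : (gramMatrix R g).transpose = -gramMatrix R g := by
    ext i j
    have := i.isLt
    have := j.isLt
    simp only [gramMatrix, symplecticMatrix, Matrix.transpose_apply, Matrix.neg_apply,
      Matrix.map_apply, Matrix.of_apply]
    by_cases hij : i.val + j.val + 1 = 2 * g
    · rw [if_pos (by omega), if_pos hij]
      by_cases hi : i.val < g
      · rw [if_pos hi, if_neg (by omega)]; simp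
      · rw [if_neg hi, if_pos (by omega)]; simp
    · rw [if_neg (by omega), if_neg hij]; simp
  refine ⟨fun i => ?_, ?_, ?_, hiso⟩
  · have h1 := toBilin'_isAlt hdiag hskew (fun r => Ψ r i)
    have h2 := transpose_mul_mul_of_apply (ε • gramMatrix R g) (fun c r => Ψ r c) i i
    refine h2.trans ?_
    rw [map_smul, LinearMap.smul_apply, LinearMap.smul_apply, h1, smul_zero]
  · rw [Matrix.transpose_mul, Matrix.transpose_mul, Matrix.transpose_transpose,
      Matrix.transpose_smul, hskew, smul_neg, Matrix.neg_mul, Matrix.mul_neg, Matrix.mul_assoc]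
  · have h1 : IsUnit Ψ.det :=
      isUnit_of_mul_isUnit_right (by rw [← Matrix.det_mul, h, Matrix.det_one]; exact isUnit_one)
    rw [Matrix.det_mul, Matrix.det_mul, Matrix.det_transpose, Matrix.det_smul]
    exact (h1.mul (((IsUnit.of_mul_eq_one _ hε).pow _).mul (isUnit_det_gramMatrix g))).mul h1

/-- `J T ^ g = -(T ^ g)ᵀ J`; it suffices to check this over `ℤ[t]`, where `T ^ g` can be cancelled. -/
theorem transpose_shiftPow_mul_neg (g : ℕ) :
    (shiftPow R (2 * g) g).transpose * (-gramMatrix R g) =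
      gramMatrix R g * shiftPow R (2 * g) g := by
  have h : (shiftMatrix (2 * g) ^ g).transpose * (-symplecticMatrix g) =
      symplecticMatrix g * shiftMatrix (2 * g) ^ g := by
    have h1 : (shiftMatrix (2 * g) ^ g) * (shiftMatrix (2 * g) ^ g) =
        (Polynomial.X : ℤ[X]) • 1 := by rw [← pow_add, ← two_mul, shiftMatrix_pow_self]
    have h2 := congrArg (· * shiftMatrix (2 * g) ^ g) (transpose_shift_mul_symplectic g)
    simp only [Matrix.mul_assoc, h1, Matrix.mul_smul, Matrix.mul_one, Matrix.smul_mul] at h2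
    rw [Matrix.mul_neg]
    ext1 i j
    have h3 := mul_left_cancel₀ Polynomial.X_ne_zero (congrFun (congrFun h2 i) j)
    rw [Matrix.neg_apply, h3, Matrix.neg_mul, Matrix.neg_apply, neg_neg]
  have h' := congrArg (fun M => M.map (algebraMap ℤ[X] R)) h
  simp only [Matrix.map_mul] at h'
  refine Eq.trans ?_ h'
  congr 1
  ext i j
  simp [gramMatrix]

section CyclicProducts

variable (φ : ∀ i, (R ⊗[ℤ[X]] D.V i) ≃ₗ[R] (Fin (2 * g) → R))

theorem segmentProd_transportMat (j m : ℕ) :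
    segmentProd (fun k => transportMat φ (Fin.ofNat (N + 1) k)) (j + 1) m =
      D.frameMatrix (φ (Fin.ofNat (N + 1) j)) *
        shiftPow R (2 * g) (∑ k ∈ Finset.range m, D.step (Fin.ofNat (N + 1) (j + 1 + k))) *
        D.frameInvMatrix (φ (Fin.ofNat (N + 1) (j + m))) := by
  rw [← segmentProd_shiftPow (R := R) (2 * g) (fun k => D.step (Fin.ofNat (N + 1) k))]
  refine segmentProd_conj _ _ (fun j => D.frameMatrix (φ (Fin.ofNat (N + 1) j)))
    (fun j => D.frameInvMatrix (φ (Fin.ofNat (N + 1) j))) (fun j => D.frameInvMatrix_mul _)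
    (fun j => D.frameMatrix_mul_inv _) (fun j => ?_) j m
  have h := ofNat_succ_sub_one N j
  simp only [transportMat]
  rw [h]

theorem prod_transportMat (i : Fin (N + 1)) :
    (List.ofFn fun k : Fin (N + 1) => transportMat φ (i + k)).prod =
      algebraMap ℤ[X] R Polynomial.X • (1 : Matrix (Fin (2 * g)) (Fin (2 * g)) R) := by
  rw [prod_cyclic, segmentProd_congr (j := i.val + N + 1)
    (Q := fun k => transportMat φ (Fin.ofNat (N + 1) k)), segmentProd_transportMat,
    D.sum_step, shiftPow_self, Matrix.mul_smul, Matrix.mul_one, Matrix.smul_mul,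
    ofNat_add_period, D.frameMatrix_mul_inv]
  intro k _
  rw [show i.val + N + 1 + k = i.val + k + (N + 1) by omega, ofNat_add_period]

theorem prod_transportMat_succ :
    (List.ofFn fun k : Fin N => transportMat φ k.succ).prod =
      D.frameMatrix (φ 0) * shiftPow R (2 * g) g * D.frameInvMatrix (φ (Fin.last N)) := by
  have h0 : Fin.ofNat (N + 1) 0 = 0 := rfl
  have h1 : Fin.ofNat (N + 1) (0 + N) = Fin.last N :=
    Fin.ext (by rw [Fin.val_ofNat, zero_add, Nat.mod_eq_of_lt (by omega), Fin.val_last])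
  have h2 : ∑ k ∈ Finset.range N, D.step (Fin.ofNat (N + 1) (0 + 1 + k)) = g := D.sum_step_succ
  rw [prod_succ]
  refine (segmentProd_transportMat φ 0 N).trans ?_
  rw [h0, h1, h2]

end CyclicProducts

theorem minorIdeal_transportMat (φ : ∀ i, (R ⊗[ℤ[X]] D.V i) ≃ₗ[R] (Fin (2 * g) → R))
    (i : Fin (N + 1)) : minorIdeal (2 * g - D.step i) (transportMat φ i) = ⊤ := by
  have h : D.frameInvMatrix (φ (i - 1)) * transportMat φ i * D.frameMatrix (φ i) =
      shiftPow R (2 * g) (D.step i) := by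
    rw [transportMat]
    simp only [Matrix.mul_assoc]
    rw [D.frameInvMatrix_mul, Matrix.mul_one, ← Matrix.mul_assoc, D.frameInvMatrix_mul,
      Matrix.one_mul]
  rw [eq_top_iff, ← minorIdeal_shiftPow (R := R) (n := 2 * g) (d := D.step i)
    ((D.step_le i).trans (by omega)), ← h]
  exact (minorIdeal_mul_le_left _ _ _).trans (minorIdeal_mul_le_right _ _ _)

/-- The point of `Σ^{g,N}_{(d_i)}` deduced from a point of the rigidified local model by transport of
structure. -/
def RigidifiedSp.transport (hN : 0 < N) (x : RigidifiedSp D R) : SigmaDPoint D R where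
  mat := transportMat x.φ
  parabolic := x.transportMat_parabolic
  nowhere_zero i := by
    rw [eq_top_iff, ← minorIdeal_transportMat x.φ i]
    refine minorIdeal_le_span_entries ?_ _
    have := D.step_le i
    have := D.g_pos hN
    omega
  prod_eq := prod_transportMat x.φ
  A₀ := transportForm (x.φ 0) ((1 : R) • gramMatrix R g)
  A_N := transportForm (x.φ (Fin.last N)) ((-1 : R) • gramMatrix R g)
  symplectic_zero := isSymplecticGram_gramMatrix_conj (one_mul _) (D.frameMatrix_mul_inv (x.φ 0))
    (x.transportForm_isotropic 0 _ fun v hv w hw => by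
      rw [one_smul, ← D.formZero_eq, x.isotropic_zero v hv w hw])
  symplectic_last := isSymplecticGram_gramMatrix_conj (by ring)
    (D.frameMatrix_mul_inv (x.φ (Fin.last N)))
    (x.transportForm_isotropic (Fin.last N) _ fun v hv w hw => by
      rw [neg_one_smul, ← D.formLast_eq, x.isotropic_last v hv w hw])
  adjoint := by
    have h0 : (0 : Fin (N + 1)) - 1 = Fin.last N := Fin.ext (by simp)
    rw [prod_transportMat_succ, transportMat, h0, transportForm, transportForm, one_smul,
      neg_one_smul, Matrix.transpose_mul, Matrix.transpose_mul]
    have h1 : (D.frameMatrix (x.φ (Fin.last N))).transpose *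
        (D.frameInvMatrix (x.φ (Fin.last N))).transpose = 1 := by
      rw [← Matrix.transpose_mul, D.frameInvMatrix_mul, Matrix.transpose_one]
    have h2 : D.step 0 = g := rfl
    rw [h2]
    simp only [Matrix.mul_assoc]
    rw [← Matrix.mul_assoc (D.frameMatrix (x.φ (Fin.last N))).transpose, h1, Matrix.one_mul,
      ← Matrix.mul_assoc (D.frameInvMatrix (x.φ 0)) (D.frameMatrix _), D.frameInvMatrix_mul,
      Matrix.one_mul, ← Matrix.mul_assoc (shiftPow R (2 * g) g).transpose,
      transpose_shiftPow_mul_neg, Matrix.mul_assoc]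
  minors i := minorIdeal_transportMat x.φ i

theorem RigidifiedSp.isTransport_transport (hN : 0 < N) (x : RigidifiedSp D R) :
    IsTransport x (x.transport hN) where
  mat_eq i v := transportMat_mulVec x.φ i v
  zero_eq v w := by
    rw [D.formZero_eq]
    refine (transportForm_apply (x.φ 0) _ v w).trans ?_
    rw [one_smul]
  last_eq v w := by
    rw [D.formLast_eq]
    refine (transportForm_apply (x.φ (Fin.last N)) _ v w).trans ?_
    rw [neg_one_smul]

theorem gram_ext_of_surjective {R : Type} [CommRing R] {n : ℕ} {X : Type*} {e : X → Fin n → R}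
    (he : Function.Surjective e) {A B : Matrix (Fin n) (Fin n) R}
    (h : ∀ x y, e x ⬝ᵥ A.mulVec (e y) = e x ⬝ᵥ B.mulVec (e y)) : A = B := by
  ext i j
  obtain ⟨x, hx⟩ := he (Pi.single i 1)
  obtain ⟨y, hy⟩ := he (Pi.single j 1)
  have h1 := h x y
  rw [hx, hy, Matrix.mulVec_single_one, Matrix.mulVec_single_one] at h1
  simpa using h1

theorem IsTransport.unique {x : RigidifiedSp D R} {σ τ : SigmaDPoint D R} (hσ : IsTransport x σ)
    (hτ : IsTransport x τ) : σ = τ := by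
  refine SigmaDPoint.ext (funext fun i => ?_) ?_ ?_
  · exact matrix_ext_of_surjective (x.φ i).surjective fun v => by rw [hσ.mat_eq, hτ.mat_eq]
  · exact gram_ext_of_surjective (x.φ 0).surjective fun v w => by rw [hσ.zero_eq, hτ.zero_eq]
  · exact gram_ext_of_surjective (x.φ (Fin.last N)).surjective fun v w => by
      rw [hσ.last_eq, hτ.last_eq]

theorem IsTransport.map {S : Type} [CommRing S] [Algebra ℤ[X] S] (f : R →ₐ[ℤ[X]] S)
    {x : RigidifiedSp D R} {σ : SigmaDPoint D R} (h : IsTransport x σ) :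
    IsTransport (RigidifiedSp.map f x) (SigmaDPoint.map f σ) where
  mat_eq i v := by
    refine LinearMap.congr_fun (f := (Matrix.mulVecLin ((σ.mat i).map f)) ∘ₗ
      (mapFraming f (x.φ i)).toLinearMap) (g := (mapFraming f (x.φ (i - 1))).toLinearMap ∘ₗ
        (D.α i).baseChange S) (ext_scalarMap f fun w => ?_) v
    simp only [LinearMap.comp_apply, LinearEquiv.coe_coe, mapFraming_scalarMap,
      baseChange_scalarMap, Matrix.mulVecLin_apply, ← h.mat_eq]
    exact funext fun j => (RingHom.map_mulVec f.toRingHom _ _ j).symm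
  zero_eq v w := by
    rw [← Matrix.toBilin'_apply']
    refine LinearMap.congr_fun₂ (f := (Matrix.toBilin' (σ.A₀.map f)).compl₁₂
      (mapFraming f (x.φ 0)).toLinearMap (mapFraming f (x.φ 0)).toLinearMap)
      (g := D.formZero.baseChange S) (ext_scalarMap f fun v => ext_scalarMap f fun w => ?_) v w
    simp only [LinearMap.compl₁₂_apply, LinearEquiv.coe_coe, mapFraming_scalarMap, form_scalarMap,
      ← h.zero_eq, Matrix.toBilin'_apply']
    exact ((RingHom.map_dotProduct f.toRingHom _ _).trans (congrArg _
      (funext fun j => RingHom.map_mulVec f.toRingHom _ _ j))).symm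
  last_eq v w := by
    rw [← Matrix.toBilin'_apply']
    refine LinearMap.congr_fun₂ (f := (Matrix.toBilin' (σ.A_N.map f)).compl₁₂
      (mapFraming f (x.φ (Fin.last N))).toLinearMap (mapFraming f (x.φ (Fin.last N))).toLinearMap)
      (g := D.formLast.baseChange S) (ext_scalarMap f fun v => ext_scalarMap f fun w => ?_) v w
    simp only [LinearMap.compl₁₂_apply, LinearEquiv.coe_coe, mapFraming_scalarMap, form_scalarMap,
      ← h.last_eq, Matrix.toBilin'_apply']
    exact ((RingHom.map_dotProduct f.toRingHom _ _).trans (congrArg _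
      (funext fun j => RingHom.map_mulVec f.toRingHom _ _ j))).symm

theorem RigidifiedSp.transport_map (hN : 0 < N) {S : Type} [CommRing S] [Algebra ℤ[X] S]
    (f : R →ₐ[ℤ[X]] S) (x : RigidifiedSp D R) :
    (RigidifiedSp.map f x).transport hN = SigmaDPoint.map f (x.transport hN) :=
  (isTransport_transport hN _).unique ((x.isTransport_transport hN).map f)

/-! ### The action of `𝒬_t` -/

theorem RigidifiedSp.act_one (x : RigidifiedSp D R) : x.act 1 = x := ext_φ rfl

theorem RigidifiedSp.act_mul (γ δ : groupQ D R) (x : RigidifiedSp D R) :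
    x.act (γ * δ) = (x.act δ).act γ := ext_φ rfl

theorem RigidifiedSp.map_act {S : Type} [CommRing S] [Algebra ℤ[X] S]
    (f : R →ₐ[ℤ[X]] S) (γ : groupQ D R) (x : RigidifiedSp D R) :
    RigidifiedSp.map f (x.act γ) = (RigidifiedSp.map f x).act (groupQMap f γ) := by
  refine ext_φ (funext fun i => LinearEquiv.toLinearMap_injective (ext_scalarMap f fun v => ?_))
  refine (mapFraming_scalarMap f ((γ.1 i).symm ≪≫ₗ x.φ i) v).trans ?_
  change _ = mapFraming f (x.φ i) ((mapEquiv f (γ.1 i)).symm (scalarMap f v))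
  have h : (mapEquiv f (γ.1 i)).symm (scalarMap f v) = scalarMap f ((γ.1 i).symm v) := by
    rw [LinearEquiv.symm_apply_eq, mapEquiv_scalarMap, LinearEquiv.apply_symm_apply]
  rw [h, mapFraming_scalarMap]
  rfl

theorem groupQMap_one {S : Type} [CommRing S] [Algebra ℤ[X] S] (f : R →ₐ[ℤ[X]] S) :
    groupQMap f (1 : groupQ D R) = 1 := by
  refine Subtype.ext (funext fun i => LinearEquiv.toLinearMap_injective
    (ext_scalarMap f fun v => ?_))
  exact mapEquiv_scalarMap f _ v

theorem groupQMap_mul {S : Type} [CommRing S] [Algebra ℤ[X] S] (f : R →ₐ[ℤ[X]] S)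
    (γ δ : groupQ D R) : groupQMap f (γ * δ) = groupQMap f γ * groupQMap f δ := by
  refine Subtype.ext (funext fun i => LinearEquiv.toLinearMap_injective
    (ext_scalarMap f fun v => ?_))
  refine (mapEquiv_scalarMap f ((γ * δ).1 i) v).trans ?_
  change _ = mapEquiv f (γ.1 i) (mapEquiv f (δ.1 i) (scalarMap f v))
  rw [mapEquiv_scalarMap, mapEquiv_scalarMap]
  rfl

theorem RigidifiedSp.isTransport_act {x : RigidifiedSp D R} {σ : SigmaDPoint D R}
    (h : IsTransport x σ) (γ : groupQ D R) : IsTransport (x.act γ) σ where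
  mat_eq i v := by
    obtain ⟨w, rfl⟩ := (γ.1 i).surjective v
    have h1 := h.mat_eq i w
    have h2 := γ.2.1 i w
    change (σ.mat i).mulVec (x.φ i ((γ.1 i).symm (γ.1 i w))) = x.φ (i - 1) ((γ.1 (i - 1)).symm _)
    rw [← h2, LinearEquiv.symm_apply_apply, LinearEquiv.symm_apply_apply, h1]
  zero_eq v w := by
    obtain ⟨v, rfl⟩ := (γ.1 0).surjective v
    obtain ⟨w, rfl⟩ := (γ.1 0).surjective w
    change x.φ 0 ((γ.1 0).symm _) ⬝ᵥ σ.A₀.mulVec (x.φ 0 ((γ.1 0).symm _)) = _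
    rw [LinearEquiv.symm_apply_apply, LinearEquiv.symm_apply_apply, h.zero_eq, γ.2.2.1]
  last_eq v w := by
    obtain ⟨v, rfl⟩ := (γ.1 (Fin.last N)).surjective v
    obtain ⟨w, rfl⟩ := (γ.1 (Fin.last N)).surjective w
    change x.φ (Fin.last N) ((γ.1 (Fin.last N)).symm _) ⬝ᵥ
      σ.A_N.mulVec (x.φ (Fin.last N) ((γ.1 (Fin.last N)).symm _)) = _
    rw [LinearEquiv.symm_apply_apply, LinearEquiv.symm_apply_apply, h.last_eq, γ.2.2.2]

theorem RigidifiedSp.transport_act (hN : 0 < N) (γ : groupQ D R) (x : RigidifiedSp D R) :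
    (x.act γ).transport hN = x.transport hN :=
  (isTransport_transport hN _).unique (isTransport_act (x.isTransport_transport hN) γ)

/-- If `(ω_i, φ_i)` and `(ω'_i, φ'_i)` give the same point by transport of structure, the element of
`𝒬_t` which takes the second to the first is `(φ_i⁻¹ φ'_i)_i`. -/
theorem RigidifiedSp.existsUnique_act (hN : 0 < N) {x y : RigidifiedSp D R}
    (h : x.transport hN = y.transport hN) : ∃! γ : groupQ D R, y.act γ = x := by
  have hx := x.isTransport_transport hN
  have hy := y.isTransport_transport hN
  rw [← h] at hy
  let γ : ∀ i, (R ⊗[ℤ[X]] D.V i) ≃ₗ[R] (R ⊗[ℤ[X]] D.V i) := fun i => y.φ i ≪≫ₗ (x.φ i).symm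
  have hγ : ∀ i v, x.φ i (γ i v) = y.φ i v := fun i v => (x.φ i).apply_symm_apply _
  refine ⟨⟨γ, fun i v => ?_, fun v w => ?_, fun v w => ?_⟩, ext_φ (funext fun i => ?_),
    fun δ hδ => Subtype.ext (funext fun i => LinearEquiv.ext fun v => ?_)⟩
  · refine (x.φ (i - 1)).injective ?_
    rw [hγ, ← hx.mat_eq, hγ, hy.mat_eq]
  · rw [← hx.zero_eq, hγ, hγ, hy.zero_eq]
  · rw [← hx.last_eq, hγ, hγ, hy.last_eq]
  · refine LinearEquiv.ext fun v => ?_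
    obtain ⟨w, rfl⟩ := (γ i).surjective v
    change y.φ i ((γ i).symm _) = _
    rw [LinearEquiv.symm_apply_apply, hγ]
  · refine (x.φ i).injective ?_
    rw [hγ, ← hδ]
    change y.φ i ((δ.1 i).symm (δ.1 i v)) = _
    rw [LinearEquiv.symm_apply_apply]

/-! ### Existence of trivialisations over local rings -/

theorem exists_isUnit_of_span_eq_top {R : Type} [CommRing R] [IsLocalRing R] {s : Set R}
    (h : Ideal.span s = ⊤) :
    ∃ a ∈ s, IsUnit a := by
  by_contra! hs
  refine (IsLocalRing.maximalIdeal.isMaximal R).ne_top (eq_top_iff.2 ?_)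
  rw [← h, Ideal.span_le]
  exact fun a ha => (IsLocalRing.mem_maximalIdeal a).2 (hs a ha)

theorem SigmaDPoint.exists_unit_minor [IsLocalRing R] (σ : SigmaDPoint D R) (i : Fin (N + 1))
    {m : ℕ} (hm : 2 * g - D.step i = m) :
    ∃ r c : Fin m → Fin (2 * g), IsUnit ((σ.mat i).submatrix r c).det := by
  subst hm
  obtain ⟨_, ⟨r, c, rfl⟩, h⟩ := exists_isUnit_of_span_eq_top (σ.minors i)
  exact ⟨r, c, h⟩

/-- The polarized chain attached to a point of `Σ^{g,N}_{(d_i)}` over a local ring. -/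
def SigmaDPoint.polarizedChain [IsLocalRing R] (σ : SigmaDPoint D R) : PolarizedChain g N R where
  P k := σ.mat (Fin.ofNat (N + 1) k)
  o m := ∑ k ∈ Finset.range m, D.step (Fin.ofNat (N + 1) (1 + k))
  A₀ := σ.A₀
  A_N := σ.A_N
  periodic i := by rw [ofNat_add_period]
  prod_eq i := by
    rw [← σ.prod_eq (Fin.ofNat (N + 1) i), prod_cyclic]
    refine segmentProd_congr fun k _ => ?_
    congr 1
    exact Fin.ext (by simp)
  o_zero := rfl
  o_le_succ i _ := by
    rw [Finset.sum_range_succ]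
    exact Nat.le_add_right _ _
  o_last := D.sum_step_succ
  minor i _ := by
    refine σ.exists_unit_minor _ ?_
    rw [Finset.sum_range_succ, Nat.add_sub_cancel_left, add_comm i 1]
  minor_zero := σ.exists_unit_minor 0 (by change 2 * g - g = g; omega)
  symplectic_zero := σ.symplectic_zero
  symplectic_last := σ.symplectic_last
  adjoint := by
    rw [← prod_succ]
    exact σ.adjoint

theorem SigmaDPoint.exists_isTransport [IsLocalRing R] (σ : SigmaDPoint D R) :
    ∃ x : RigidifiedSp D R, IsTransport x σ := by
  obtain ⟨Φ, hΦ⟩ := σ.polarizedChain.exists_isTrivialization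
  let φ : ∀ i : Fin (N + 1), (R ⊗[ℤ[X]] D.V i) ≃ₗ[R] (Fin (2 * g) → R) := fun i =>
    D.frameOfMatrix i (Φ i.val) (Φ i.val)⁻¹ (Matrix.mul_nonsing_inv _ (hΦ.isUnit _ (by omega)))
  have hφ : ∀ i v, φ i v = (Φ i.val).mulVec (D.coord R i v) := fun i v => rfl
  refine exists_isTransport_of_frames σ φ (fun i v => ?_) (fun v w => ?_) (fun v w => ?_)
  · rw [hφ, hφ, D.coord_α, Matrix.mulVec_mulVec, Matrix.mulVec_mulVec]
    congr 1
    refine Fin.cases ?_ (fun j => ?_) i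
    · have h0 : (0 : Fin (N + 1)) - 1 = Fin.last N := Fin.ext (by simp)
      rw [h0]
      exact hΦ.mul_zero_eq
    · have h0 : j.succ - 1 = j.castSucc := Fin.ext (by simp [Fin.coe_sub_one])
      have h1 := hΦ.mul_eq j.val j.isLt
      have h2 : Fin.ofNat (N + 1) (j.val + 1) = j.succ := Fin.ext (by
        rw [Fin.val_ofNat, Fin.val_succ, Nat.mod_eq_of_lt (by omega)])
      have h3 : σ.polarizedChain.o (j.val + 1) - σ.polarizedChain.o j.val = D.step j.succ := by
        simp only [polarizedChain]
        rw [Finset.sum_range_succ, Nat.add_sub_cancel_left, add_comm 1, h2]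
      rw [h3] at h1
      have h4 : σ.mat (Fin.ofNat (N + 1) (j.val + 1)) * Φ (j.val + 1) = _ := h1
      rw [h2] at h4
      rw [h0]
      exact h4
  · rw [D.formZero_eq, ← hΦ.gram_zero, hφ, hφ, ← Matrix.mulVec_mulVec, ← Matrix.mulVec_mulVec,
      Matrix.dotProduct_mulVec (D.coord R 0 v), Matrix.vecMul_transpose]
    rfl
  · rw [D.formLast_eq, ← hΦ.gram_last, hφ, hφ, ← Matrix.mulVec_mulVec, ← Matrix.mulVec_mulVec,
      Matrix.dotProduct_mulVec (D.coord R (Fin.last N) v), Matrix.vecMul_transpose]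
    rfl

end Transport

/-! ### Functors of points defined by equations -/

section ClosedConditions

variable {k : Type} [CommRing k] {ι : Type}

/-- A condition on the points of the affine space `𝔸^ι`, with values in `k`-algebras, which is
equivalent to the vanishing of a set of polynomials. -/
def IsClosedCondition (k : Type) [CommRing k] {ι : Type}
    (P : ∀ (R : Type) [CommRing R] [Algebra k R], (ι → R) → Prop) : Prop :=
  ∃ s : Set (MvPolynomial ι k), ∀ (R : Type) [CommRing R] [Algebra k R] (v : ι → R),
    P R v ↔ ∀ p ∈ s, MvPolynomial.aeval v p = 0

namespace IsClosedCondition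

theorem and {P Q : ∀ (R : Type) [CommRing R] [Algebra k R], (ι → R) → Prop}
    (hP : IsClosedCondition k P) (hQ : IsClosedCondition k Q) :
    IsClosedCondition k fun R _ _ v => P R v ∧ Q R v := by
  obtain ⟨s, hs⟩ := hP
  obtain ⟨t, ht⟩ := hQ
  refine ⟨s ∪ t, fun R _ _ v => ?_⟩
  refine (and_congr (hs R v) (ht R v)).trans ?_
  constructor
  · rintro ⟨h1, h2⟩ p (hp | hp)
    exacts [h1 p hp, h2 p hp]
  · exact fun h => ⟨fun p hp => h p (.inl hp), fun p hp => h p (.inr hp)⟩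

theorem all {κ : Sort*} {P : κ → ∀ (R : Type) [CommRing R] [Algebra k R], (ι → R) → Prop}
    (hP : ∀ a, IsClosedCondition k (P a)) : IsClosedCondition k fun R _ _ v => ∀ a, P a R v := by
  choose s hs using hP
  refine ⟨⋃ a, s a, fun R _ _ v => ?_⟩
  simp only [hs, Set.mem_iUnion]
  exact ⟨fun h p ⟨a, hp⟩ => h a p hp, fun h a p hp => h p ⟨a, hp⟩⟩

/-- A function natural in the `k`-algebra is evaluation of its value at the generic point. -/
theorem eq_zero (L : ∀ (R : Type) [CommRing R] [Algebra k R], (ι → R) → R)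
    (hL : ∀ (R S : Type) [CommRing R] [Algebra k R] [CommRing S] [Algebra k S] (f : R →ₐ[k] S)
      (v : ι → R), L S (f ∘ v) = f (L R v)) :
    IsClosedCondition k fun R _ _ v => L R v = 0 := by
  refine ⟨{L (MvPolynomial ι k) MvPolynomial.X}, fun R _ _ v => ?_⟩
  have h := hL _ _ (MvPolynomial.aeval (R := k) v) MvPolynomial.X
  have h1 : MvPolynomial.aeval (R := k) v ∘ MvPolynomial.X = v :=
    funext fun i => MvPolynomial.aeval_X v i
  rw [h1] at h
  simp [← h]

theorem matrix_apply_eq_zero {n : Type}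
    (L : ∀ (R : Type) [CommRing R] [Algebra k R], (ι → R) → Matrix n n R)
    (hL : ∀ (R S : Type) [CommRing R] [Algebra k R] [CommRing S] [Algebra k S] (f : R →ₐ[k] S)
      (v : ι → R), L S (f ∘ v) = (L R v).map f) (i j : n) :
    IsClosedCondition k fun R _ _ v => L R v i j = 0 :=
  eq_zero (k := k) _ fun R S _ _ _ _ f v => by rw [hL, Matrix.map_apply]

theorem matrix_eq {n : Type}
    (L M : ∀ (R : Type) [CommRing R] [Algebra k R], (ι → R) → Matrix n n R)
    (hL : ∀ (R S : Type) [CommRing R] [Algebra k R] [CommRing S] [Algebra k S] (f : R →ₐ[k] S)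
      (v : ι → R), L S (f ∘ v) = (L R v).map f)
    (hM : ∀ (R S : Type) [CommRing R] [Algebra k R] [CommRing S] [Algebra k S] (f : R →ₐ[k] S)
      (v : ι → R), M S (f ∘ v) = (M R v).map f) :
    IsClosedCondition k fun R _ _ v => L R v = M R v := by
  have h := IsClosedCondition.all fun i : n => IsClosedCondition.all fun j : n =>
    eq_zero (k := k) (fun R _ _ v => L R v i j - M R v i j) fun R S _ _ _ _ f v => by
      rw [hL, hM, Matrix.map_apply, Matrix.map_apply, map_sub]
  obtain ⟨s, hs⟩ := h
  refine ⟨s, fun R _ _ v => ?_⟩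
  rw [← hs]
  simp only [sub_eq_zero, ← Matrix.ext_iff]

theorem map {P : ∀ (R : Type) [CommRing R] [Algebra k R], (ι → R) → Prop}
    (hP : IsClosedCondition k P) {R S : Type} [CommRing R] [Algebra k R] [CommRing S] [Algebra k S]
    (f : R →ₐ[k] S) {v : ι → R} (hv : P R v) : P S (f ∘ v) := by
  obtain ⟨s, hs⟩ := hP
  rw [hs] at hv ⊢
  intro p hp
  have h := MvPolynomial.map_aeval v (f : R →+* S) p
  rw [hv p hp, map_zero] at h
  rw [h, MvPolynomial.aeval_def, MvPolynomial.coe_eval₂Hom]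
  congr 1
  exact f.comp_algebraMap.symm

end IsClosedCondition

/-- A functor which embeds in an affine space as the locus of a closed condition is corepresented by
the quotient of the polynomial ring by the corresponding equations. -/
theorem exists_corepresentableBy [Finite ι] (F : CommAlgCat.{0} k ⥤ Type)
    (c : ∀ R : CommAlgCat.{0} k, F.obj R → ι → R)
    (hc : ∀ {R S : CommAlgCat.{0} k} (f : R ⟶ S) (x : F.obj R), c S (F.map f x) = f.hom ∘ c R x)
    (hinj : ∀ R, Function.Injective (c R))
    {P : ∀ (R : Type) [CommRing R] [Algebra k R], (ι → R) → Prop} (hP : IsClosedCondition k P)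
    (hrange : ∀ (R : CommAlgCat.{0} k) (v : ι → R), P R v ↔ ∃ x, c R x = v) :
    ∃ A : CommAlgCat.{0} k, Algebra.FiniteType k A ∧ Nonempty (F.CorepresentableBy A) := by
  obtain ⟨s, hs⟩ := hP
  let I : Ideal (MvPolynomial ι k) := Ideal.span s
  let A : CommAlgCat.{0} k := CommAlgCat.of k (MvPolynomial ι k ⧸ I)
  have hA : ∀ p, MvPolynomial.aeval (fun i => Ideal.Quotient.mk I (MvPolynomial.X i)) p =
      Ideal.Quotient.mkₐ k I p := by
    intro p
    have : MvPolynomial.aeval (fun i => Ideal.Quotient.mk I (MvPolynomial.X i)) =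
        Ideal.Quotient.mkₐ k I := MvPolynomial.algHom_ext fun i => by simp
    rw [this]
  obtain ⟨u, hu⟩ := (hrange A fun i => Ideal.Quotient.mk I (MvPolynomial.X i)).1 <|
    (hs A _).2 fun p hp => (hA p).trans (Ideal.Quotient.eq_zero_iff_mem.2 (Ideal.subset_span hp))
  have hbij : ∀ R : CommAlgCat.{0} k,
      Function.Bijective fun f : A ⟶ R => F.map f u := by
    refine fun R => ⟨fun f f' h => ?_, fun x => ?_⟩
    · have h1 := congrArg (c R) h
      simp only [hc, hu] at h1
      refine CommAlgCat.hom_ext (Ideal.Quotient.algHom_ext _ (MvPolynomial.algHom_ext fun i => ?_))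
      exact congrFun h1 i
    · have hx := (hs R _).1 ((hrange R (c R x)).2 ⟨x, rfl⟩)
      let l : (MvPolynomial ι k ⧸ I) →ₐ[k] R := Ideal.Quotient.liftₐ I
        (MvPolynomial.aeval (c R x)) fun p hp => by
          have h1 : I ≤ RingHom.ker (MvPolynomial.aeval (R := k) (c R x)) :=
            Ideal.span_le.2 fun p hp => hx p hp
          exact h1 hp
      refine ⟨CommAlgCat.ofHom l, hinj R ?_⟩
      simp only [hc, hu]
      funext i
      exact MvPolynomial.aeval_X (c R x) i
  refine ⟨A, inferInstanceAs (Algebra.FiniteType k (MvPolynomial ι k ⧸ I)), ⟨?_⟩⟩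
  exact
    { homEquiv := fun {R} => Equiv.ofBijective _ (hbij R)
      homEquiv_comp := fun g f => by simp }

/-- The functor of points of the closed subscheme of an affine space defined by a closed condition. -/
def closedFunctor {P : ∀ (R : Type) [CommRing R] [Algebra k R], (ι → R) → Prop}
    (hP : IsClosedCondition k P) : CommAlgCat.{0} k ⥤ Type where
  obj R := {v : ι → R // P R v}
  map f := ↾fun v => ⟨f.hom ∘ v.1, hP.map f.hom v.2⟩
  map_id _ := rfl
  map_comp _ _ := rfl

theorem closedFunctor_exists_corepresentableBy [Finite ι]
    {P : ∀ (R : Type) [CommRing R] [Algebra k R], (ι → R) → Prop} (hP : IsClosedCondition k P) :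
    ∃ A : CommAlgCat.{0} k, Algebra.FiniteType k A ∧
      Nonempty ((closedFunctor hP).CorepresentableBy A) :=
  exists_corepresentableBy _ (fun _ v => v.1) (fun _ _ => rfl)
    (fun _ => Subtype.val_injective) hP fun _ v => ⟨fun h => ⟨⟨v, h⟩, rfl⟩, fun ⟨x, hx⟩ => hx ▸ x.2⟩

end ClosedConditions

/-! ### Points of affine schemes over an affine base -/

section AffinePoints

open Opposite

variable {k : CommRingCat.{0}} {F : CommAlgCat.{0} k ⥤ Type} {A : CommAlgCat.{0} k}

/-- If `A` corepresents `F`, the morphisms `Y ⟶ Spec A` of schemes over the base are the elements of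
`F(Γ(Y))`, for all `Y`. -/
def specRepresentableBy (e : F.CorepresentableBy A) :
    ((algΓ k).leftOp ⋙ F).RepresentableBy ((algSpec k).obj (op A)) where
  homEquiv {Y} := (((algΓAlgSpecAdjunction k).homEquiv Y (op A)).symm.trans
    (opEquiv _ _)).trans e.homEquiv
  homEquiv_comp {X Y} f g := by
    simp only [Equiv.trans_apply, Adjunction.homEquiv_naturality_left_symm]
    exact e.homEquiv_comp _ _

/-- If `A` corepresents `F`, the points of `Spec A` over the affine base are given by `F`. -/
def specPointsIso (e : F.CorepresentableBy A) :
    (algSpec k).rightOp ⋙ yoneda.obj ((algSpec k).obj (op A)) ≅ F :=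
  NatIso.ofComponents (fun R => (((algSpec.fullyFaithful (R := k)).homEquiv (X := op R)
    (Y := op A)).symm.trans ((opEquiv _ _).trans e.homEquiv)).toIso) fun {R S} f => by
      refine ConcreteCategory.hom_ext _ _ fun y => ?_
      obtain ⟨y, rfl⟩ := (algSpec k).map_surjective y
      change e.homEquiv ((algSpec.fullyFaithful (R := k)).preimage
        ((algSpec k).map f.op ≫ (algSpec k).map y)).unop =
          F.map f (e.homEquiv ((algSpec.fullyFaithful (R := k)).preimage ((algSpec k).map y)).unop)
      rw [← Functor.map_comp, Functor.FullyFaithful.preimage_map,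
        Functor.FullyFaithful.preimage_map, unop_comp, e.homEquiv_comp]
      rfl

theorem specPointsIso_hom_app_map (e : F.CorepresentableBy A) {R : CommAlgCat.{0} k} (f : A ⟶ R) :
    (specPointsIso e).hom.app R ((algSpec k).map f.op) = e.homEquiv f := by
  change e.homEquiv ((algSpec.fullyFaithful (R := k)).preimage ((algSpec k).map f.op)).unop = _
  rw [Functor.FullyFaithful.preimage_map]
  rfl

variable (k) in
/-- The map from an algebra to the global functions on its spectrum. -/
def toΓSpec (R : CommAlgCat.{0} k) : R ⟶ ((algΓ k).obj ((algSpec k).obj (op R))).unop :=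
  ((algΓAlgSpecAdjunction k).counit.app (op R)).unop

instance (R : CommAlgCat.{0} k) : IsIso (toΓSpec k R) := by
  unfold toΓSpec
  infer_instance

/-- The two descriptions of morphisms `Spec R ⟶ Spec A` agree. -/
theorem specRepresentableBy_homEquiv (e : F.CorepresentableBy A) {R : CommAlgCat.{0} k}
    (y : (algSpec k).obj (op R) ⟶ (algSpec k).obj (op A)) :
    (specRepresentableBy e).homEquiv y = F.map (toΓSpec k R) ((specPointsIso e).hom.app R y) := by
  obtain ⟨f, rfl⟩ := (algSpec k).map_surjective y
  have h := specPointsIso_hom_app_map e f.unop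
  rw [Quiver.Hom.op_unop] at h
  rw [h, ← e.homEquiv_comp]
  change e.homEquiv (((algΓAlgSpecAdjunction k).homEquiv _ (op A)).symm ((algSpec k).map f)).unop = _
  rw [Adjunction.homEquiv_counit, ← Functor.comp_map, NatTrans.naturality]
  rfl

theorem map_toΓSpec_injective (F : CommAlgCat.{0} k ⥤ Type) (R : CommAlgCat.{0} k) :
    Function.Injective (F.map (toΓSpec k R)) :=
  ((isIso_iff_bijective _).1 (inferInstanceAs (IsIso (F.map (toΓSpec k R))))).1

end AffinePoints

/-! ### Open subschemes of affine schemes defined by ideals -/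

section OpenSubscheme

open Opposite

variable {k : CommRingCat.{0}} {A : CommAlgCat.{0} k} {κ : Type} [Finite κ]

/-- The locus where none of finitely many ideals is contained in the prime ideal. -/
def openLocus (I : κ → Ideal A) : ((algSpec k).obj (op A)).left.Opens :=
  ⟨{p : PrimeSpectrum A | ∀ a, ¬ I a ≤ p.asIdeal}, by
    have h : {p : PrimeSpectrum A | ∀ a, ¬ I a ≤ p.asIdeal} =
        ⋂ a, (PrimeSpectrum.zeroLocus (I a : Set A))ᶜ := by
      ext p
      simp [PrimeSpectrum.mem_zeroLocus]
    have h1 : IsOpen {p : PrimeSpectrum A | ∀ a, ¬ I a ≤ p.asIdeal} := by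
      rw [h]
      exact isOpen_iInter_of_finite fun a => (PrimeSpectrum.isClosed_zeroLocus _).isOpen_compl
    exact h1⟩

/-- The open subscheme of `Spec A` on the locus `openLocus I`. -/
def openSpec (I : κ → Ideal A) : Over (Spec k) :=
  Over.mk ((openLocus I).ι ≫ ((algSpec k).obj (op A)).hom)

/-- The inclusion of `openSpec I` in `Spec A`. -/
def openSpecι (I : κ → Ideal A) : openSpec I ⟶ (algSpec k).obj (op A) :=
  Over.homMk (openLocus I).ι rfl

instance (I : κ → Ideal A) : Mono (openSpecι I) :=
  (Over.forget (Spec k)).mono_of_mono_map (inferInstanceAs (Mono (openLocus I).ι))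

theorem mem_openLocus_of_map_eq_top (I : κ → Ideal A) {R : CommAlgCat.{0} k} (f : A ⟶ R)
    (h : ∀ a, (I a).map f.hom = ⊤) (q : ((algSpec k).obj (op R)).left) :
    ((algSpec k).map f.op).left q ∈ openLocus I := by
  intro a ha
  let q' : PrimeSpectrum R := q
  have h1 : I a ≤ Ideal.comap f.hom q'.asIdeal := ha
  have h2 : (I a).map f.hom ≤ q'.asIdeal := Ideal.map_le_iff_le_comap.2 h1
  exact q'.isPrime.ne_top (top_le_iff.1 ((h a).symm.trans_le h2))

theorem map_eq_top_of_mem_openLocus (I : κ → Ideal A) {R : CommAlgCat.{0} k} (f : A ⟶ R)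
    (h : ∀ q : ((algSpec k).obj (op R)).left, ((algSpec k).map f.op).left q ∈ openLocus I) (a : κ) :
    (I a).map f.hom = ⊤ := by
  by_contra hne
  obtain ⟨m, hm, hle⟩ := Ideal.exists_le_maximal _ hne
  exact h (⟨m, hm.isPrime⟩ : PrimeSpectrum R) a (Ideal.map_le_iff_le_comap.1 hle)

theorem exists_comp_openSpecι (I : κ → Ideal A) {Y : Over (Spec k)}
    (y : Y ⟶ (algSpec k).obj (op A))
    (h : ∀ a, (I a).map (((algΓAlgSpecAdjunction k).homEquiv Y (op A)).symm y).unop.hom = ⊤) :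
    ∃ y' : Y ⟶ openSpec I, y' ≫ openSpecι I = y := by
  set f := (((algΓAlgSpecAdjunction k).homEquiv Y (op A)).symm y) with hf
  have hy : y = (algΓAlgSpecAdjunction k).unit.app Y ≫ (algSpec k).map f :=
    (Equiv.apply_symm_apply _ y).symm.trans (Adjunction.homEquiv_unit _ _ _ _)
  have hr : Set.range y.left ⊆ Set.range (openLocus I).ι := by
    rw [Scheme.Opens.range_ι]
    rintro _ ⟨p, rfl⟩
    rw [hy]
    exact mem_openLocus_of_map_eq_top I f.unop h
      (((algΓAlgSpecAdjunction k).unit.app Y).left p)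
  obtain ⟨l, hl⟩ : ∃ l : Y.left ⟶ (openLocus I : Scheme), l ≫ (openLocus I).ι = y.left :=
    have : IsOpenImmersion (openLocus I).ι := inferInstance
    ⟨@IsOpenImmersion.lift _ _ _ _ _ this hr, @IsOpenImmersion.lift_fac _ _ _ _ _ this hr⟩
  refine ⟨Over.homMk l ?_, Over.OverMorphism.ext hl⟩
  exact (Category.assoc _ _ _).symm.trans ((congrArg (· ≫ _) hl).trans (Over.w y))

theorem map_eq_top_of_comp_openSpecι (I : κ → Ideal A) {R : CommAlgCat.{0} k}
    (y : (algSpec k).obj (op R) ⟶ openSpec I) (f : A ⟶ R)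
    (h : (algSpec k).map f.op = y ≫ openSpecι I) (a : κ) : (I a).map f.hom = ⊤ := by
  refine map_eq_top_of_mem_openLocus I f (fun q => ?_) a
  rw [h]
  exact (y.left q).2

end OpenSubscheme

/-! ### Equations for the three functors -/

section MatrixCoordinates

variable {κ : Type} {n : ℕ} {R S : Type}

/-- The family of matrices with given family of entries. -/
def coordMatrix (v : κ × Fin n × Fin n → R) (a : κ) : Matrix (Fin n) (Fin n) R :=
  Matrix.of fun r c => v (a, r, c)

/-- The family of entries of a family of matrices. -/
def matrixCoords (M : κ → Matrix (Fin n) (Fin n) R) : κ × Fin n × Fin n → R :=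
  fun p => M p.1 p.2.1 p.2.2

theorem matrixCoords_injective :
    Function.Injective (matrixCoords : (κ → Matrix (Fin n) (Fin n) R) → _) := fun M M' h => by
  funext a
  ext r c
  exact congrFun h (a, r, c)

variable [CommRing R] [Algebra ℤ[X] R] [CommRing S] [Algebra ℤ[X] S]

theorem shiftPow_map (f : R →ₐ[ℤ[X]] S) (n k : ℕ) : (shiftPow R n k).map f = shiftPow S n k := by
  ext r c
  simp [shiftPow]

theorem gramMatrix_map (f : R →ₐ[ℤ[X]] S) (g : ℕ) : (gramMatrix R g).map f = gramMatrix S g := by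
  ext r c
  simp [gramMatrix]

theorem neg_gramMatrix_map (f : R →ₐ[ℤ[X]] S) (g : ℕ) :
    (-gramMatrix R g).map f = -gramMatrix S g := by
  ext r c
  simp [gramMatrix]

end MatrixCoordinates

variable {g N : ℕ} (D : SymplecticPartition g N)

/-- The equations of the rigidified local model, in terms of the matrices of the `φ_i` and of
their inverses in the standard bases. -/
def IsRigidifiedCoord (R : Type) [CommRing R] [Algebra ℤ[X] R]
    (v : (Fin (N + 1) ⊕ Fin (N + 1)) × Fin (2 * g) × Fin (2 * g) → R) : Prop :=
  (∀ i, coordMatrix v (.inl i) * coordMatrix v (.inr i) = 1) ∧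
  (∀ (i : Fin (N + 1)) (r c : Fin (2 * g)), g ≤ r.val → c.val < g →
    (coordMatrix v (.inl (i - 1)) * shiftPow R (2 * g) (D.step i) * coordMatrix v (.inr i)) r c =
      0) ∧
  (∀ r c : Fin (2 * g), r.val < g → c.val < g → ((coordMatrix v (.inr 0)).transpose *
    gramMatrix R g * coordMatrix v (.inr 0)) r c = 0) ∧
  (∀ r c : Fin (2 * g), r.val < g → c.val < g → ((coordMatrix v (.inr (Fin.last N))).transpose *
    (-gramMatrix R g) * coordMatrix v (.inr (Fin.last N))) r c = 0)

theorem isClosedCondition_isRigidifiedCoord :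
    IsClosedCondition ℤ[X] fun R _ _ v => IsRigidifiedCoord D R v := by
  refine .and (.all fun i => ?_) (.and (.all fun i => .all fun r => .all fun c => .all fun _ =>
    .all fun _ => ?_) (.and (.all fun r => .all fun c => .all fun _ => .all fun _ => ?_)
      (.all fun r => .all fun c => .all fun _ => .all fun _ => ?_)))
  · refine .matrix_eq _ (fun _ _ _ _ => 1) (fun R S _ _ _ _ f v => ?_) fun R S _ _ _ _ f v => ?_
    · rw [Matrix.map_mul]
      rfl
    · rw [Matrix.map_one _ (map_zero f) (map_one f)]
  · refine .matrix_apply_eq_zero _ (fun R S _ _ _ _ f v => ?_) r c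
    rw [Matrix.map_mul, Matrix.map_mul, shiftPow_map]
    rfl
  · refine .matrix_apply_eq_zero _ (fun R S _ _ _ _ f v => ?_) r c
    rw [Matrix.map_mul, Matrix.map_mul, gramMatrix_map]
    rfl
  · refine .matrix_apply_eq_zero _ (fun R S _ _ _ _ f v => ?_) r c
    rw [Matrix.map_mul, Matrix.map_mul, neg_gramMatrix_map]
    rfl

section RigidifiedCoordinates

variable {D} {R S : Type} [CommRing R] [Algebra ℤ[X] R] [CommRing S] [Algebra ℤ[X] S]

/-- The entries of the matrices of the `φ_i` and of their inverses. -/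
def RigidifiedSp.coords (x : RigidifiedSp D R) :
    (Fin (N + 1) ⊕ Fin (N + 1)) × Fin (2 * g) × Fin (2 * g) → R :=
  matrixCoords (Sum.elim (fun i => D.frameMatrix (x.φ i)) (fun i => D.frameInvMatrix (x.φ i)))

theorem RigidifiedSp.coords_injective :
    Function.Injective (RigidifiedSp.coords : RigidifiedSp D R → _) := fun _ _ h =>
  RigidifiedSp.ext_φ (funext fun i =>
    D.frameMatrix_injective (congrFun (matrixCoords_injective h) (.inl i)))

theorem RigidifiedSp.coords_map (f : R →ₐ[ℤ[X]] S) (x : RigidifiedSp D R) :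
    (RigidifiedSp.map f x).coords = f ∘ x.coords := by
  have h : ∀ a, (Sum.elim (fun i => D.frameMatrix ((RigidifiedSp.map f x).φ i))
      (fun i => D.frameInvMatrix ((RigidifiedSp.map f x).φ i))) a =
      ((Sum.elim (fun i => D.frameMatrix (x.φ i)) (fun i => D.frameInvMatrix (x.φ i))) a).map
        f := by
    rintro (i | i)
    exacts [D.frameMatrix_mapFraming f _, D.frameInvMatrix_mapFraming f _]
  exact congrArg matrixCoords (funext h)

theorem RigidifiedSp.isRigidifiedCoord (x : RigidifiedSp D R) :
    IsRigidifiedCoord D R x.coords := by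
  refine ⟨fun i => D.frameMatrix_mul_inv (x.φ i), x.transportMat_parabolic,
    x.transportForm_isotropic 0 _ fun v hv w hw => ?_,
    x.transportForm_isotropic (Fin.last N) _ fun v hv w hw => ?_⟩
  · rw [← D.formZero_eq]
    exact x.isotropic_zero v hv w hw
  · rw [← D.formLast_eq]
    exact x.isotropic_last v hv w hw

theorem IsRigidifiedCoord.exists_coords_eq
    {v : (Fin (N + 1) ⊕ Fin (N + 1)) × Fin (2 * g) × Fin (2 * g) → R}
    (h : IsRigidifiedCoord D R v) : ∃ x : RigidifiedSp D R, x.coords = v := by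
  obtain ⟨h1, h2, h3, h4⟩ := h
  let φ : ∀ i, (R ⊗[ℤ[X]] D.V i) ≃ₗ[R] (Fin (2 * g) → R) := fun i =>
    D.frameOfMatrix i (coordMatrix v (.inl i)) (coordMatrix v (.inr i)) (h1 i)
  have hφ : ∀ i, D.frameMatrix (φ i) = coordMatrix v (.inl i) := fun i =>
    D.frameMatrix_frameOfMatrix _ _ _
  have hφ' : ∀ i, D.frameInvMatrix (φ i) = coordMatrix v (.inr i) := fun i =>
    D.frameInvMatrix_frameOfMatrix _ _ _
  refine ⟨RigidifiedSp.ofFrames φ (transportMat φ) (transportForm (φ 0) (gramMatrix R g))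
    (transportForm (φ (Fin.last N)) (-gramMatrix R g)) (transportMat_mulVec φ)
    (fun x y => ?_) (fun x y => ?_) (fun i r c hr hc => ?_) (fun r c hr hc => ?_)
    fun r c hr hc => ?_, ?_⟩
  · rw [transportForm_apply, D.formZero_eq]
  · rw [transportForm_apply, D.formLast_eq]
  · rw [transportMat, hφ, hφ', h2 i r c hr hc]
  · rw [transportForm, hφ', h3 r c hr hc]
  · rw [transportForm, hφ', h4 r c hr hc]
  · have h : (Sum.elim (fun i => D.frameMatrix (φ i)) (fun i => D.frameInvMatrix (φ i))) =
        coordMatrix v := by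
      funext a
      rcases a with i | i
      exacts [hφ i, hφ' i]
    exact congrArg matrixCoords h

end RigidifiedCoordinates

theorem rigidifiedFunctor_exists_corepresentableBy :
    ∃ A : CommAlgCat.{0} ℤ[X], Algebra.FiniteType ℤ[X] A ∧
      Nonempty ((rigidifiedFunctor D).CorepresentableBy A) :=
  exists_corepresentableBy (rigidifiedFunctor D) (fun _ x => RigidifiedSp.coords x)
    (fun f x => RigidifiedSp.coords_map f.hom x) (fun _ => RigidifiedSp.coords_injective)
    (isClosedCondition_isRigidifiedCoord D) fun _ _ =>
      ⟨fun h => h.exists_coords_eq, fun ⟨x, hx⟩ => hx ▸ RigidifiedSp.isRigidifiedCoord x⟩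

/-- The equations of `𝒬_t`, in terms of the matrices of the `γ_i` and of their inverses in the
standard bases. -/
def IsGroupQCoord (R : Type) [CommRing R] [Algebra ℤ[X] R]
    (v : (Fin (N + 1) ⊕ Fin (N + 1)) × Fin (2 * g) × Fin (2 * g) → R) : Prop :=
  (∀ i, coordMatrix v (.inl i) * coordMatrix v (.inr i) = 1) ∧
  (∀ i : Fin (N + 1), coordMatrix v (.inl (i - 1)) * shiftPow R (2 * g) (D.step i) =
    shiftPow R (2 * g) (D.step i) * coordMatrix v (.inl i)) ∧
  (coordMatrix v (.inl 0)).transpose * gramMatrix R g * coordMatrix v (.inl 0) = gramMatrix R g ∧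
  (coordMatrix v (.inl (Fin.last N))).transpose * (-gramMatrix R g) *
    coordMatrix v (.inl (Fin.last N)) = -gramMatrix R g

theorem isClosedCondition_isGroupQCoord :
    IsClosedCondition ℤ[X] fun R _ _ v => IsGroupQCoord D R v := by
  refine .and (.all fun i => ?_) (.and (.all fun i => ?_) (.and ?_ ?_))
  · refine .matrix_eq _ (fun _ _ _ _ => 1) (fun R S _ _ _ _ f v => ?_) fun R S _ _ _ _ f v => ?_
    · rw [Matrix.map_mul]
      rfl
    · rw [Matrix.map_one _ (map_zero f) (map_one f)]
  · refine .matrix_eq _ _ (fun R S _ _ _ _ f v => ?_) fun R S _ _ _ _ f v => ?_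
    · rw [Matrix.map_mul, shiftPow_map]
      rfl
    · rw [Matrix.map_mul, shiftPow_map]
      rfl
  · refine .matrix_eq _ (fun R _ _ _ => gramMatrix R g) (fun R S _ _ _ _ f v => ?_)
      fun R S _ _ _ _ f v => (gramMatrix_map f g).symm
    rw [Matrix.map_mul, Matrix.map_mul, gramMatrix_map]
    rfl
  · refine .matrix_eq _ (fun R _ _ _ => -gramMatrix R g) (fun R S _ _ _ _ f v => ?_)
      fun R S _ _ _ _ f v => (neg_gramMatrix_map f g).symm
    rw [Matrix.map_mul, Matrix.map_mul, neg_gramMatrix_map]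
    rfl

section GroupFrames

variable {D} {R S : Type} [CommRing R] [Algebra ℤ[X] R] [CommRing S] [Algebra ℤ[X] S]

theorem mapEquiv_trans_coord (f : R →ₐ[ℤ[X]] S) {i : Fin (N + 1)}
    (e : (R ⊗[ℤ[X]] D.V i) ≃ₗ[R] (R ⊗[ℤ[X]] D.V i)) :
    mapEquiv f e ≪≫ₗ D.coord S i = mapFraming f (e ≪≫ₗ D.coord R i) := by
  refine LinearEquiv.toLinearMap_injective (ext_scalarMap f fun v => ?_)
  refine Eq.trans ?_ (mapFraming_scalarMap f (e ≪≫ₗ D.coord R i) v).symm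
  change D.coord S i (mapEquiv f e (scalarMap f v)) = _
  rw [mapEquiv_scalarMap, D.coord_scalarMap]
  rfl

theorem frameMatrix_trans_mulVec {i : Fin (N + 1)} (e : (R ⊗[ℤ[X]] D.V i) ≃ₗ[R] (R ⊗[ℤ[X]] D.V i))
    (x : R ⊗[ℤ[X]] D.V i) :
    (D.frameMatrix (e ≪≫ₗ D.coord R i)).mulVec (D.coord R i x) = D.coord R i (e x) :=
  D.frameMatrix_mulVec (e ≪≫ₗ D.coord R i) x

theorem dotProduct_transpose_mul_mul {R : Type} [CommRing R] {n : ℕ}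
    (A B : Matrix (Fin n) (Fin n) R) (v w : Fin n → R) :
    v ⬝ᵥ (B.transpose * A * B).mulVec w = B.mulVec v ⬝ᵥ A.mulVec (B.mulVec w) := by
  rw [← Matrix.mulVec_mulVec, ← Matrix.mulVec_mulVec, Matrix.dotProduct_mulVec,
    Matrix.vecMul_transpose]

/-- The entries of the matrices of the `γ_i` and of their inverses. -/
def groupQCoords (γ : groupQ D R) : (Fin (N + 1) ⊕ Fin (N + 1)) × Fin (2 * g) × Fin (2 * g) → R :=
  matrixCoords (Sum.elim (fun i => D.frameMatrix (γ.1 i ≪≫ₗ D.coord R i))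
    (fun i => D.frameInvMatrix (γ.1 i ≪≫ₗ D.coord R i)))

theorem groupQCoords_injective :
    Function.Injective (groupQCoords : groupQ D R → _) := fun γ δ h => by
  refine Subtype.ext (funext fun i => LinearEquiv.ext fun v => (D.coord R i).injective ?_)
  exact LinearEquiv.congr_fun
    (D.frameMatrix_injective (congrFun (matrixCoords_injective h) (.inl i))) v

theorem groupQCoords_map (f : R →ₐ[ℤ[X]] S) (γ : groupQ D R) :
    groupQCoords (groupQMap f γ) = f ∘ groupQCoords γ := by
  have h : ∀ a, (Sum.elim (fun i => D.frameMatrix ((groupQMap f γ).1 i ≪≫ₗ D.coord S i))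
      (fun i => D.frameInvMatrix ((groupQMap f γ).1 i ≪≫ₗ D.coord S i))) a =
      ((Sum.elim (fun i => D.frameMatrix (γ.1 i ≪≫ₗ D.coord R i))
        (fun i => D.frameInvMatrix (γ.1 i ≪≫ₗ D.coord R i))) a).map f := by
    rintro (i | i)
    · exact (congrArg D.frameMatrix (mapEquiv_trans_coord f (γ.1 i))).trans
        (D.frameMatrix_mapFraming f _)
    · exact (congrArg D.frameInvMatrix (mapEquiv_trans_coord f (γ.1 i))).trans
        (D.frameInvMatrix_mapFraming f _)
  exact congrArg matrixCoords (funext h)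

theorem isGroupQCoord_groupQCoords (γ : groupQ D R) : IsGroupQCoord D R (groupQCoords γ) := by
  refine ⟨fun i => D.frameMatrix_mul_inv (γ.1 i ≪≫ₗ D.coord R i),
    fun i => matrix_ext_of_surjective (D.coord R i).surjective fun x => ?_,
    gram_ext_of_surjective (D.coord R 0).surjective fun x y => ?_,
    gram_ext_of_surjective (D.coord R (Fin.last N)).surjective fun x y => ?_⟩
  · change (D.frameMatrix (γ.1 (i - 1) ≪≫ₗ D.coord R (i - 1)) * _).mulVec _ =
      (_ * D.frameMatrix (γ.1 i ≪≫ₗ D.coord R i)).mulVec _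
    rw [← Matrix.mulVec_mulVec, ← Matrix.mulVec_mulVec, ← D.coord_α, frameMatrix_trans_mulVec,
      frameMatrix_trans_mulVec, ← D.coord_α, γ.2.1]
  · refine (dotProduct_transpose_mul_mul _ (D.frameMatrix (γ.1 0 ≪≫ₗ D.coord R 0)) _ _).trans ?_
    rw [frameMatrix_trans_mulVec, frameMatrix_trans_mulVec, ← D.formZero_eq, ← D.formZero_eq,
      γ.2.2.1]
  · refine (dotProduct_transpose_mul_mul _
      (D.frameMatrix (γ.1 (Fin.last N) ≪≫ₗ D.coord R (Fin.last N))) _ _).trans ?_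
    rw [frameMatrix_trans_mulVec, frameMatrix_trans_mulVec, ← D.formLast_eq, ← D.formLast_eq,
      γ.2.2.2]

theorem IsGroupQCoord.exists_coords_eq
    {v : (Fin (N + 1) ⊕ Fin (N + 1)) × Fin (2 * g) × Fin (2 * g) → R}
    (h : IsGroupQCoord D R v) : ∃ γ : groupQ D R, groupQCoords γ = v := by
  obtain ⟨h1, h2, h3, h4⟩ := h
  let γ : ∀ i, (R ⊗[ℤ[X]] D.V i) ≃ₗ[R] (R ⊗[ℤ[X]] D.V i) := fun i =>
    D.frameOfMatrix i (coordMatrix v (.inl i)) (coordMatrix v (.inr i)) (h1 i) ≪≫ₗ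
      (D.coord R i).symm
  have hγ : ∀ i x, D.coord R i (γ i x) = (coordMatrix v (.inl i)).mulVec (D.coord R i x) :=
    fun i x => (D.coord R i).apply_symm_apply _
  have hγ' : ∀ i, γ i ≪≫ₗ D.coord R i =
      D.frameOfMatrix i (coordMatrix v (.inl i)) (coordMatrix v (.inr i)) (h1 i) := fun i =>
    LinearEquiv.ext (hγ i)
  refine ⟨⟨γ, fun i x => (D.coord R (i - 1)).injective ?_, fun x y => ?_, fun x y => ?_⟩, ?_⟩
  · rw [hγ, D.coord_α, D.coord_α, hγ, Matrix.mulVec_mulVec, Matrix.mulVec_mulVec, h2]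
  · rw [D.formZero_eq, D.formZero_eq, hγ, hγ, ← dotProduct_transpose_mul_mul, h3]
  · rw [D.formLast_eq, D.formLast_eq, hγ, hγ, ← dotProduct_transpose_mul_mul, h4]
  · have h : (Sum.elim (fun i => D.frameMatrix (γ i ≪≫ₗ D.coord R i))
        (fun i => D.frameInvMatrix (γ i ≪≫ₗ D.coord R i))) = coordMatrix v := by
      funext a
      rcases a with i | i
      · exact (congrArg D.frameMatrix (hγ' i)).trans (D.frameMatrix_frameOfMatrix _ _ _)
      · exact (congrArg D.frameInvMatrix (hγ' i)).trans (D.frameInvMatrix_frameOfMatrix _ _ _)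
    exact congrArg matrixCoords h

end GroupFrames

theorem groupQFunctor_exists_corepresentableBy :
    ∃ A : CommAlgCat.{0} ℤ[X], Algebra.FiniteType ℤ[X] A ∧
      Nonempty ((groupQFunctor D).CorepresentableBy A) :=
  exists_corepresentableBy (groupQFunctor D) (fun _ γ => groupQCoords γ)
    (fun f γ => groupQCoords_map f.hom γ) (fun _ => groupQCoords_injective)
    (isClosedCondition_isGroupQCoord D) fun _ _ =>
      ⟨fun h => h.exists_coords_eq, fun ⟨γ, hγ⟩ => hγ ▸ isGroupQCoord_groupQCoords γ⟩

/-- The closed conditions in the definition of `Σ^{g,N}_{(d_i)}`, in terms of the matrices `Π_i` and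
of the Gram matrices of the forms `( , )_0` and `( , )_N`. -/
def IsSigmaCoord (g N : ℕ) (R : Type) [CommRing R] [Algebra ℤ[X] R]
    (v : (Fin (N + 1) ⊕ Bool) × Fin (2 * g) × Fin (2 * g) → R) : Prop :=
  (∀ (i : Fin (N + 1)) (r c : Fin (2 * g)), g ≤ r.val → c.val < g →
    coordMatrix v (.inl i) r c = 0) ∧
  (∀ i : Fin (N + 1), (List.ofFn fun k : Fin (N + 1) => coordMatrix v (.inl (i + k))).prod =
    algebraMap ℤ[X] R Polynomial.X • (1 : Matrix (Fin (2 * g)) (Fin (2 * g)) R)) ∧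
  (∀ (b : Bool) (r : Fin (2 * g)), coordMatrix v (.inr b) r r = 0) ∧
  (∀ b : Bool, (coordMatrix v (.inr b)).transpose = -coordMatrix v (.inr b)) ∧
  (∀ (b : Bool) (r c : Fin (2 * g)), r.val < g → c.val < g → coordMatrix v (.inr b) r c = 0) ∧
  (coordMatrix v (.inl 0)).transpose * coordMatrix v (.inr true) =
    coordMatrix v (.inr false) * (List.ofFn fun k : Fin N => coordMatrix v (.inl k.succ)).prod

theorem isClosedCondition_isSigmaCoord (g N : ℕ) :
    IsClosedCondition ℤ[X] fun R _ _ v => IsSigmaCoord g N R v := by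
  refine .and (.all fun i => .all fun r => .all fun c => .all fun _ => .all fun _ => ?_)
    (.and (.all fun i => ?_) (.and (.all fun b => .all fun r => ?_) (.and (.all fun b => ?_)
      (.and (.all fun b => .all fun r => .all fun c => .all fun _ => .all fun _ => ?_) ?_))))
  · exact .matrix_apply_eq_zero _ (fun R S _ _ _ _ f v => rfl) r c
  · refine .matrix_eq _
      (fun R _ _ _ => algebraMap ℤ[X] R Polynomial.X • (1 : Matrix (Fin (2 * g)) (Fin (2 * g)) R))
      (fun R S _ _ _ _ f v => ?_) fun R S _ _ _ _ f v => ?_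
    · rw [← map_list_prod_ofFn f]
      rfl
    · ext r c
      by_cases h : r = c
      · subst h
        rw [Matrix.map_apply, Matrix.smul_apply, Matrix.smul_apply, Matrix.one_apply_eq,
          Matrix.one_apply_eq, smul_eq_mul, smul_eq_mul, mul_one, mul_one, AlgHom.commutes]
      · simp [h]
  · exact .matrix_apply_eq_zero _ (fun R S _ _ _ _ f v => rfl) r r
  · refine .matrix_eq _ _ (fun R S _ _ _ _ f v => rfl) fun R S _ _ _ _ f v => ?_
    ext r c
    exact (map_neg f _).symm
  · exact .matrix_apply_eq_zero _ (fun R S _ _ _ _ f v => rfl) r c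
  · refine .matrix_eq _ _ (fun R S _ _ _ _ f v => ?_) fun R S _ _ _ _ f v => ?_
    · rw [Matrix.map_mul]
      rfl
    · rw [Matrix.map_mul, ← map_list_prod_ofFn f]
      rfl

section SigmaCoordinates

variable {D} {R S : Type} [CommRing R] [Algebra ℤ[X] R] [CommRing S] [Algebra ℤ[X] S]

/-- The matrix entries of a point of `Σ^{g,N}_{(d_i)}`. -/
def SigmaDPoint.coords (σ : SigmaDPoint D R) :
    (Fin (N + 1) ⊕ Bool) × Fin (2 * g) × Fin (2 * g) → R :=
  matrixCoords (Sum.elim σ.mat fun b : Bool => if b then σ.A_N else σ.A₀)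

theorem SigmaDPoint.coords_injective :
    Function.Injective (SigmaDPoint.coords : SigmaDPoint D R → _) := fun σ τ h => by
  have h1 := matrixCoords_injective h
  exact SigmaDPoint.ext (funext fun i => congrFun h1 (.inl i)) (congrFun h1 (.inr false))
    (congrFun h1 (.inr true))

theorem SigmaDPoint.coords_map (f : R →ₐ[ℤ[X]] S) (σ : SigmaDPoint D R) :
    (SigmaDPoint.map f σ).coords = f ∘ σ.coords := by
  have h : ∀ a, (Sum.elim (SigmaDPoint.map f σ).mat fun b : Bool =>
      if b then (SigmaDPoint.map f σ).A_N else (SigmaDPoint.map f σ).A₀) a =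
      ((Sum.elim σ.mat fun b : Bool => if b then σ.A_N else σ.A₀) a).map f := by
    rintro (i | (b | b)) <;> rfl
  exact congrArg matrixCoords (funext h)

theorem SigmaDPoint.isSigmaCoord (σ : SigmaDPoint D R) : IsSigmaCoord g N R σ.coords := by
  refine ⟨σ.parabolic, σ.prod_eq, ?_, ?_, ?_, σ.adjoint⟩
  · rintro (b | b)
    exacts [σ.symplectic_zero.diag, σ.symplectic_last.diag]
  · rintro (b | b)
    exacts [σ.symplectic_zero.skew, σ.symplectic_last.skew]
  · rintro (b | b)
    exacts [σ.symplectic_zero.isotropic, σ.symplectic_last.isotropic]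

variable (D) in
/-- The ideals whose being the unit ideal defines `Σ^{g,N}_{(d_i)}` inside the closed subscheme
given by `IsSigmaCoord`: the determinant of the forms and the minors of size `2g - d_i` of `Π_i`. -/
def sigmaIdeal (v : (Fin (N + 1) ⊕ Bool) × Fin (2 * g) × Fin (2 * g) → R) :
    Option (Fin (N + 1)) → Ideal R
  | none => Ideal.span {(coordMatrix v (.inr false)).det * (coordMatrix v (.inr true)).det}
  | some i => minorIdeal (2 * g - D.step i) (coordMatrix v (.inl i))

theorem sigmaIdeal_map (f : R →ₐ[ℤ[X]] S)
    (v : (Fin (N + 1) ⊕ Bool) × Fin (2 * g) × Fin (2 * g) → R) (a : Option (Fin (N + 1))) :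
    (sigmaIdeal D v a).map f = sigmaIdeal D (f ∘ v) a := by
  have hdet : ∀ {n : ℕ} (M : Matrix (Fin n) (Fin n) R), f M.det = (M.map f).det := fun M =>
    AlgHom.map_det f M
  cases a with
  | none =>
    change Ideal.map f (Ideal.span _) = Ideal.span _
    rw [Ideal.map_span, Set.image_singleton, map_mul, hdet, hdet]
    rfl
  | some i =>
    change Ideal.map f (Ideal.span _) = Ideal.span _
    rw [Ideal.map_span]
    congr 1
    ext s
    constructor
    · rintro ⟨_, ⟨r, c, rfl⟩, rfl⟩
      exact ⟨r, c, hdet _⟩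
    · rintro ⟨r, c, rfl⟩
      exact ⟨_, ⟨r, c, rfl⟩, hdet _⟩

/-- A family of matrices satisfying the closed conditions is a point of `Σ^{g,N}_{(d_i)}` if and only
if finitely many ideals are the unit ideal. That the entries of `Π_i` generate the unit ideal follows
from the condition on minors, as `2g - d_i > 0`. -/
theorem exists_coords_eq_iff (hN : 0 < N)
    {v : (Fin (N + 1) ⊕ Bool) × Fin (2 * g) × Fin (2 * g) → R} (hv : IsSigmaCoord g N R v) :
    (∃ σ : SigmaDPoint D R, σ.coords = v) ↔ ∀ a, sigmaIdeal D v a = ⊤ := by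
  constructor
  · rintro ⟨σ, rfl⟩ (_ | i)
    · exact Ideal.span_singleton_eq_top.2
        (σ.symplectic_zero.nondegenerate.mul σ.symplectic_last.nondegenerate)
    · exact σ.minors i
  · intro h
    obtain ⟨h1, h2, h3, h4, h5, h6⟩ := hv
    have hdet := isUnit_of_mul_isUnit_left (Ideal.span_singleton_eq_top.1 (h none))
    have hdet' := isUnit_of_mul_isUnit_right (Ideal.span_singleton_eq_top.1 (h none))
    refine ⟨{ mat := fun i => coordMatrix v (.inl i)
              parabolic := h1
              nowhere_zero := fun i => ?_
              prod_eq := h2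
              minors := fun i => h (some i)
              A₀ := coordMatrix v (.inr false)
              A_N := coordMatrix v (.inr true)
              symplectic_zero := ⟨h3 false, h4 false, hdet, h5 false⟩
              symplectic_last := ⟨h3 true, h4 true, hdet', h5 true⟩
              adjoint := h6 }, ?_⟩
    · have h7 : minorIdeal (2 * g - D.step i) (coordMatrix v (.inl i)) = ⊤ := h (some i)
      rw [eq_top_iff, ← h7]
      refine minorIdeal_le_span_entries ?_ _
      have := D.step_le i
      have := D.g_pos hN
      omega
    · have h8 : (Sum.elim (fun i => coordMatrix v (.inl i)) fun b : Bool =>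
          if b then coordMatrix v (.inr true) else coordMatrix v (.inr false)) = coordMatrix v := by
        funext a
        rcases a with i | (b | b) <;> rfl
      exact congrArg matrixCoords h8

end SigmaCoordinates

/-! ### Functors of points of open subschemes -/

section OpenPoints

open Opposite

variable {k : CommRingCat.{0}} {F G : CommAlgCat.{0} k ⥤ Type} {A : CommAlgCat.{0} k}
  (e : F.CorepresentableBy A) {κ : Type} [Finite κ] (I : κ → Ideal A) (c : G ⟶ F)

/-- The subfunctor `G` of `F = Hom(A, -)` consists of the morphisms `A ⟶ R` which send the ideals
`I a` to sets generating the unit ideal. -/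
def IsOpenSubfunctor : Prop :=
  (∀ R, Function.Injective (c.app R)) ∧ ∀ (R : CommAlgCat.{0} k) (f : A ⟶ R),
    (∃ x, c.app R x = e.homEquiv f) ↔ ∀ a, (I a).map f.hom = ⊤

variable {e I c}

namespace IsOpenSubfunctor

/-- An element of `G(Γ(Y))` defines a morphism from `Y` to the open subscheme. -/
theorem exists_hom (h : IsOpenSubfunctor e I c) {Y : Over (Spec k)}
    (x : G.obj ((algΓ k).obj Y).unop) :
    ∃ y : Y ⟶ openSpec I, (specRepresentableBy e).homEquiv (y ≫ openSpecι I) = c.app _ x := by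
  obtain ⟨y, hy⟩ := (specRepresentableBy e).homEquiv.surjective (c.app _ x)
  obtain ⟨z, hz⟩ := exists_comp_openSpecι I y fun a => by
    refine (h.2 _ _).1 ⟨x, ?_⟩ a
    exact hy.symm
  exact ⟨z, (congrArg _ hz).trans hy⟩

theorem exists_app_eq (h : IsOpenSubfunctor e I c) {R : CommAlgCat.{0} k}
    (y : (algSpec k).obj (op R) ⟶ openSpec I) :
    ∃ x, c.app R x = (specPointsIso e).hom.app R (y ≫ openSpecι I) := by
  obtain ⟨f, hf⟩ := (algSpec k).map_surjective (y ≫ openSpecι I)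
  rw [← hf]
  obtain ⟨x, hx⟩ := (h.2 R f.unop).2 fun a => map_eq_top_of_comp_openSpecι I y f.unop hf a
  exact ⟨x, hx.trans (specPointsIso_hom_app_map e f.unop).symm⟩

theorem exists_comp_eq (h : IsOpenSubfunctor e I c) {R : CommAlgCat.{0} k} (x : G.obj R) :
    ∃ y : (algSpec k).obj (op R) ⟶ openSpec I,
      (specPointsIso e).hom.app R (y ≫ openSpecι I) = c.app R x := by
  obtain ⟨y, hy⟩ := h.exists_hom (Y := (algSpec k).obj (op R)) (G.map (toΓSpec k R) x)
  refine ⟨y, map_toΓSpec_injective F R ?_⟩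
  rw [← specRepresentableBy_homEquiv, hy, NatTrans.naturality_apply]

/-- The points of the open subscheme are given by `G`. -/
theorem exists_pointsIso (h : IsOpenSubfunctor e I c) :
    ∃ ρ : (algSpec k).rightOp ⋙ yoneda.obj (openSpec I) ≅ G, ∀ (R : CommAlgCat.{0} k)
      (y : (algSpec k).obj (op R) ⟶ openSpec I),
      c.app R (ρ.hom.app R y) = (specPointsIso e).hom.app R (y ≫ openSpecι I) := by
  choose x hx using fun (R : CommAlgCat.{0} k) (y : (algSpec k).obj (op R) ⟶ openSpec I) =>
    h.exists_app_eq y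
  have hinj : ∀ R, Function.Injective ((specPointsIso e).hom.app R) := fun R =>
    ((isIso_iff_bijective ((specPointsIso e).hom.app R)).1 inferInstance).1
  have hbij : ∀ R, Function.Bijective (x R) := by
    refine fun R => ⟨fun y z hyz => ?_, fun w => ?_⟩
    · refine (cancel_mono (openSpecι I)).1 (hinj R ?_)
      exact (hx R y).symm.trans ((congrArg (c.app R) hyz).trans (hx R z))
    · obtain ⟨y, hy⟩ := h.exists_comp_eq w
      exact ⟨y, h.1 R ((hx R y).trans hy)⟩
  refine ⟨NatIso.ofComponents (fun R => (Equiv.ofBijective _ (hbij R)).toIso) fun {R S} f => ?_, hx⟩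
  refine ConcreteCategory.hom_ext _ _ fun y => h.1 S ?_
  let z : (algSpec k).obj (op R) ⟶ openSpec I := y
  have h1 : (specPointsIso e).hom.app S ((algSpec k).map f.op ≫ z ≫ openSpecι I) =
      F.map f ((specPointsIso e).hom.app R (z ≫ openSpecι I)) :=
    NatTrans.naturality_apply (specPointsIso e).hom f _
  have h2 := NatTrans.naturality_apply c f (x R y)
  refine (hx S _).trans (Eq.trans ?_ h2.symm)
  refine Eq.trans ?_ (h1.trans (congrArg (F.map f) (hx R y).symm))
  exact congrArg ((specPointsIso e).hom.app S) (Category.assoc _ _ _)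

end IsOpenSubfunctor

end OpenPoints

/-! ### The group scheme and its action -/

section GlobalPoints

open Opposite

variable {g N : ℕ} {D : SymplecticPartition g N} {A B : CommAlgCat.{0} (CommRingCat.of ℤ[X])}
  (eQ : (groupQFunctor D).CorepresentableBy A) (eM : (rigidifiedFunctor D).CorepresentableBy B)
  {Y Z : Over (Spec (CommRingCat.of ℤ[X]))}

/-- The algebra of global functions of a scheme over the affine line. -/
abbrev globalAlg (Y : Over (Spec (CommRingCat.of ℤ[X]))) : CommAlgCat.{0} ℤ[X] :=
  ((algΓ (CommRingCat.of ℤ[X])).obj Y).unop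

/-- Pullback of global functions. -/
def globalMap (f : Y ⟶ Z) : globalAlg Z →ₐ[ℤ[X]] globalAlg Y :=
  CommAlgCat.Hom.hom (((algΓ (CommRingCat.of ℤ[X])).map f).unop)

/-- The element of `𝒬_t(Γ(Y))` given by a morphism from `Y` to the scheme representing `𝒬_t`. -/
def globalGroupQ (γ : Y ⟶ (algSpec (CommRingCat.of ℤ[X])).obj (op A)) : groupQ D (globalAlg Y) :=
  (specRepresentableBy (k := CommRingCat.of ℤ[X])
    (F := groupQFunctor D) eQ).homEquiv γ

/-- The `Γ(Y)`-point of the rigidified local model given by a morphism from `Y` to the scheme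
representing it. -/
def globalRigidified (x : Y ⟶ (algSpec (CommRingCat.of ℤ[X])).obj (op B)) :
    RigidifiedSp D (globalAlg Y) :=
  (specRepresentableBy (k := CommRingCat.of ℤ[X])
    (F := rigidifiedFunctor D) eM).homEquiv x

theorem globalGroupQ_bijective : Function.Bijective (globalGroupQ eQ (Y := Y)) :=
  (specRepresentableBy (k := CommRingCat.of ℤ[X])
    (F := groupQFunctor D) eQ).homEquiv.bijective

theorem globalRigidified_bijective : Function.Bijective (globalRigidified eM (Y := Y)) :=
  (specRepresentableBy (k := CommRingCat.of ℤ[X])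
    (F := rigidifiedFunctor D) eM).homEquiv.bijective

theorem globalGroupQ_comp (f : Y ⟶ Z) (γ : Z ⟶ (algSpec (CommRingCat.of ℤ[X])).obj (op A)) :
    globalGroupQ eQ (f ≫ γ) = groupQMap (globalMap f) (globalGroupQ eQ γ) :=
  (specRepresentableBy (k := CommRingCat.of ℤ[X])
    (F := groupQFunctor D) eQ).homEquiv_comp f γ

theorem globalRigidified_comp (f : Y ⟶ Z) (x : Z ⟶ (algSpec (CommRingCat.of ℤ[X])).obj (op B)) :
    globalRigidified eM (f ≫ x) = RigidifiedSp.map (globalMap f) (globalRigidified eM x) :=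
  (specRepresentableBy (k := CommRingCat.of ℤ[X])
    (F := rigidifiedFunctor D) eM).homEquiv_comp f x

theorem globalGroupQ_spec {R : CommAlgCat.{0} ℤ[X]}
    (γ : (algSpec (CommRingCat.of ℤ[X])).obj (op R) ⟶
      (algSpec (CommRingCat.of ℤ[X])).obj (op A)) :
    globalGroupQ eQ γ = groupQMap (toΓSpec (CommRingCat.of ℤ[X]) R).hom
      (toGroupQ (specPointsIso eQ) γ) :=
  specRepresentableBy_homEquiv (k := CommRingCat.of ℤ[X]) (F := groupQFunctor D) eQ γ

theorem globalRigidified_spec {R : CommAlgCat.{0} ℤ[X]}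
    (x : (algSpec (CommRingCat.of ℤ[X])).obj (op R) ⟶
      (algSpec (CommRingCat.of ℤ[X])).obj (op B)) :
    globalRigidified eM x = RigidifiedSp.map (toΓSpec (CommRingCat.of ℤ[X]) R).hom
      (toRigidified (specPointsIso eM) x) :=
  specRepresentableBy_homEquiv (k := CommRingCat.of ℤ[X]) (F := rigidifiedFunctor D) eM x

theorem groupQMap_toΓSpec_injective (R : CommAlgCat.{0} ℤ[X]) : Function.Injective
    (groupQMap (D := D) (toΓSpec (CommRingCat.of ℤ[X]) R).hom) :=
  map_toΓSpec_injective (k := CommRingCat.of ℤ[X]) (groupQFunctor D) R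

theorem rigidifiedMap_toΓSpec_injective (R : CommAlgCat.{0} ℤ[X]) : Function.Injective
    (RigidifiedSp.map (D := D) (toΓSpec (CommRingCat.of ℤ[X]) R).hom) :=
  map_toΓSpec_injective (k := CommRingCat.of ℤ[X]) (rigidifiedFunctor D) R

variable (D) in
/-- The functor of points of `𝒬_t`, with values in groups. -/
def groupQGrp : CommAlgCat.{0} ℤ[X] ⥤ GrpCat.{0} where
  obj R := GrpCat.of (groupQ D R)
  map f := GrpCat.ofHom
    { toFun := groupQMap f.hom
      map_one' := groupQMap_one f.hom
      map_mul' := groupQMap_mul f.hom }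
  map_id _ := GrpCat.hom_ext (MonoidHom.ext fun x => groupQMap_id x)
  map_comp f h := GrpCat.hom_ext (MonoidHom.ext fun x => groupQMap_comp f.hom h.hom x)

/-- A scheme representing `𝒬_t` is a group scheme. Its group law is characterised on all schemes
over the affine line, not only on the affine ones. -/
theorem exists_grpObj : ∃ _ : GrpObj ((algSpec (CommRingCat.of ℤ[X])).obj (op A)),
    (∀ (Y : Over (Spec (CommRingCat.of ℤ[X])))
      (γ δ : Y ⟶ (algSpec (CommRingCat.of ℤ[X])).obj (op A)),
      globalGroupQ eQ (lift γ δ ≫ MonObj.mul) = globalGroupQ eQ γ * globalGroupQ eQ δ) ∧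
    ∀ Y : Over (Spec (CommRingCat.of ℤ[X])),
      globalGroupQ eQ (toUnit Y ≫ MonObj.one) = 1 := by
  let G : (Over (Spec (CommRingCat.of ℤ[X])))ᵒᵖ ⥤ GrpCat.{0} :=
    (algΓ (CommRingCat.of ℤ[X])).leftOp ⋙ groupQGrp D
  let r : (G ⋙ forget _).RepresentableBy ((algSpec (CommRingCat.of ℤ[X])).obj (op A)) :=
    { homEquiv := fun {Y} => Equiv.ofBijective _ (globalGroupQ_bijective eQ)
      homEquiv_comp := fun f γ => globalGroupQ_comp eQ f γ }
  let _ := GrpObj.ofRepresentableBy _ G r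
  refine ⟨inferInstance, fun Y γ δ => ?_, fun Y => ?_⟩
  · have h : globalGroupQ eQ (MonObj.mul (X := (algSpec (CommRingCat.of ℤ[X])).obj (op A))) =
        globalGroupQ eQ (fst _ _) * globalGroupQ eQ (snd _ _) :=
      r.homEquiv.apply_symm_apply _
    rw [globalGroupQ_comp, h, groupQMap_mul, ← globalGroupQ_comp, ← globalGroupQ_comp, lift_fst,
      lift_snd]
  · have h : globalGroupQ eQ (MonObj.one (X := (algSpec (CommRingCat.of ℤ[X])).obj (op A))) = 1 :=
      r.homEquiv.apply_symm_apply _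
    rw [globalGroupQ_comp, h, groupQMap_one]

/-- The action on points comes from an action on the representing schemes, by Yoneda. -/
theorem exists_action : ∃ a : (algSpec (CommRingCat.of ℤ[X])).obj (op A) ⊗
      (algSpec (CommRingCat.of ℤ[X])).obj (op B) ⟶ (algSpec (CommRingCat.of ℤ[X])).obj (op B),
    ∀ (Y : Over (Spec (CommRingCat.of ℤ[X])))
      (γ : Y ⟶ (algSpec (CommRingCat.of ℤ[X])).obj (op A))
      (x : Y ⟶ (algSpec (CommRingCat.of ℤ[X])).obj (op B)),
      globalRigidified eM (lift γ x ≫ a) = (globalRigidified eM x).act (globalGroupQ eQ γ) := by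
  obtain ⟨a, ha⟩ := (globalRigidified_bijective eM).2
    ((globalRigidified eM (snd ((algSpec (CommRingCat.of ℤ[X])).obj (op A))
      ((algSpec (CommRingCat.of ℤ[X])).obj (op B)))).act (globalGroupQ eQ (fst _ _)))
  refine ⟨a, fun Y γ x => ?_⟩
  rw [globalRigidified_comp, ha, RigidifiedSp.map_act, ← globalRigidified_comp,
    ← globalGroupQ_comp, lift_fst, lift_snd]

end GlobalPoints

/-! ### Principal homogeneous spaces -/

section PrincipalHomogeneous

theorem whiskerRight_eq_lift {C : Type*} [Category C] [CartesianMonoidalCategory C] {G Y : C}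
    (m : G ⊗ G ⟶ G) : m ▷ Y = lift (lift (fst _ _ ≫ fst _ _) (fst _ _ ≫ snd _ _) ≫ m)
      (snd _ _) := by
  have h : lift (fst (G ⊗ G) Y ≫ fst G G) (fst _ _ ≫ snd _ _) = fst _ _ := by ext <;> simp
  ext <;> simp [h]

theorem associator_comp_whiskerLeft {C : Type*} [Category C] [CartesianMonoidalCategory C]
    {G Y : C} (a : G ⊗ Y ⟶ Y) : (α_ G G Y).hom ≫ (G ◁ a) =
      lift (fst _ _ ≫ fst _ _) (lift (fst _ _ ≫ snd _ _) (snd _ _) ≫ a) := by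
  have h : (α_ G G Y).hom ≫ snd _ _ = lift (fst _ _ ≫ snd _ _) (snd _ _) := by ext <;> simp
  ext
  · simp
  · simp [← h]

/-- The condition on `(γ, y) ↦ (γ y, y)` in the definition of a principal homogeneous space can be
tested on generalised points. -/
theorem isPullback_of_existsUnique {C : Type*} [Category C] [CartesianMonoidalCategory C]
    {G Y Z : C} {a : G ⊗ Y ⟶ Y} {π : Y ⟶ Z} (w : a ≫ π = snd G Y ≫ π)
    (h : ∀ (W : C) (x y : W ⟶ Y), x ≫ π = y ≫ π → ∃! γ : W ⟶ G, lift γ y ≫ a = x) :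
    IsPullback a (snd G Y) π π := by
  refine ⟨⟨w⟩, ⟨Limits.PullbackCone.IsLimit.mk w
    (fun s => lift (h _ s.fst s.snd s.condition).choose s.snd) (fun s => ?_) (fun s => ?_)
    fun s m h1 h2 => ?_⟩⟩
  · exact (h _ s.fst s.snd s.condition).choose_spec.1
  · exact lift_snd _ _
  · have h3 : m = lift (m ≫ fst _ _) s.snd := by
      ext
      · simp
      · simpa using h2
    rw [h3]
    congr 1
    refine (h _ s.fst s.snd s.condition).choose_spec.2 _ ?_
    change lift (m ≫ fst _ _) s.snd ≫ a = s.fst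
    rw [← h3, h1]

/-- A morphism `Y ⟶ Z` locally of finite type has a section near a point `z` of a locally noetherian
scheme as soon as it has one over the spectrum of the local ring of `z`. -/
theorem exists_section_of_stalk {Y Z : Scheme.{0}} (π : Y ⟶ Z) [LocallyOfFiniteType π]
    [IsLocallyNoetherian Z] (z : Z)
    (h : ∃ y : Spec (Z.presheaf.stalk z) ⟶ Y, y ≫ π = Z.fromSpecStalk z) :
    ∃ U : Z.Opens, z ∈ U ∧ ∃ s : (U : Scheme) ⟶ Y, s ≫ π = U.ι := by
  obtain ⟨y, hy⟩ := h
  obtain ⟨U, hU, s, -, hs⟩ := spread_out_of_isGermInjective' (𝟙 Z) π y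
    (hy.trans (Category.comp_id _).symm)
  exact ⟨U, hU, s, hs.trans (Category.comp_id _)⟩

/-- The spectrum of the local ring at a point of a scheme over an affine base, as the spectrum of
an algebra. -/
theorem exists_algSpec_stalk {k : CommRingCat.{0}} (Z : Over (Spec k)) (z : Z.left) :
    ∃ (R : CommAlgCat.{0} k) (_ : IsLocalRing R) (f : (algSpec k).obj (.op R) ⟶ Z)
      (i : Spec (Z.left.presheaf.stalk z) ⟶ ((algSpec k).obj (.op R)).left),
      i ≫ f.left = Z.left.fromSpecStalk z := by
  obtain ⟨φ, hφ⟩ := Spec.map_surjective (Z.left.fromSpecStalk z ≫ Z.hom)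
  let _ : Algebra k (Z.left.presheaf.stalk z) := φ.hom.toAlgebra
  refine ⟨CommAlgCat.of k (Z.left.presheaf.stalk z),
    inferInstanceAs (IsLocalRing (Z.left.presheaf.stalk z)),
    Over.homMk (Z.left.fromSpecStalk z) hφ.symm, 𝟙 (Spec (Z.left.presheaf.stalk z)), ?_⟩
  exact Category.id_comp _

end PrincipalHomogeneous

/-! ### The scheme `Σ^{g,N}_{(d_i)}` and the morphism to it -/

section SigmaScheme

open Opposite

variable {g N : ℕ} {D : SymplecticPartition g N} {A B : CommAlgCat.{0} (CommRingCat.of ℤ[X])}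

/-- The functor of points of the closed subscheme of an affine space in which `Σ^{g,N}_{(d_i)}` is
open. -/
abbrev sigmaClosure (g N : ℕ) : CommAlgCat.{0} ℤ[X] ⥤ Type :=
  closedFunctor (isClosedCondition_isSigmaCoord g N)

variable (D) in
/-- The coordinates of the points of `Σ^{g,N}_{(d_i)}`. -/
def sigmaCoords : sigmaDFunctor D ⟶ sigmaClosure g N where
  app R := ↾fun σ : SigmaDPoint D R => ⟨σ.coords, σ.isSigmaCoord⟩
  naturality R S f := by
    refine ConcreteCategory.hom_ext _ _ fun σ => Subtype.ext ?_
    exact SigmaDPoint.coords_map f.hom σ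

variable (D) in
/-- The ideals defining `Σ^{g,N}_{(d_i)}` as an open subscheme of its closure. -/
def genericIdeal (e : (sigmaClosure g N).CorepresentableBy A) : Option (Fin (N + 1)) → Ideal A :=
  sigmaIdeal D (R := A) (e.homEquiv (𝟙 A)).1

theorem isOpenSubfunctor_sigmaCoords (hN : 0 < N) (e : (sigmaClosure g N).CorepresentableBy A) :
    IsOpenSubfunctor (k := CommRingCat.of ℤ[X]) (F := sigmaClosure g N) e (genericIdeal D e)
      (sigmaCoords D) := by
  refine ⟨fun R σ τ h => SigmaDPoint.coords_injective (congrArg Subtype.val h), fun R f => ?_⟩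
  have h : (e.homEquiv f).1 = f.hom ∘ (e.homEquiv (𝟙 A)).1 :=
    congrArg Subtype.val (e.homEquiv_eq f)
  have h1 := exists_coords_eq_iff (D := D) (R := R) hN (e.homEquiv f).2
  have h2 : ∀ a, Ideal.map f.hom (genericIdeal D e a) =
      sigmaIdeal D (R := R) (e.homEquiv f).1 a := fun a => by
    rw [h]
    exact sigmaIdeal_map f.hom _ a
  constructor
  · rintro ⟨σ, hσ⟩ a
    exact (h2 a).trans (h1.1 ⟨σ, congrArg Subtype.val hσ⟩ a)
  · intro h3
    obtain ⟨σ, hσ⟩ := h1.2 fun a => (h2 a).symm.trans (h3 a)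
    exact ⟨σ, Subtype.ext hσ⟩

variable (eM : (rigidifiedFunctor D).CorepresentableBy B)

/-- Transport of structure defines a morphism to `Σ^{g,N}_{(d_i)}`. -/
theorem exists_transport_hom (hN : 0 < N) (e : (sigmaClosure g N).CorepresentableBy A) :
    ∃ π : (algSpec (CommRingCat.of ℤ[X])).obj (op B) ⟶
      openSpec (k := CommRingCat.of ℤ[X]) (genericIdeal D e),
      ∀ (Y : Over (Spec (CommRingCat.of ℤ[X])))
        (x : Y ⟶ (algSpec (CommRingCat.of ℤ[X])).obj (op B)),
        (specRepresentableBy (k := CommRingCat.of ℤ[X]) (F := sigmaClosure g N) e).homEquiv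
          (x ≫ π ≫ openSpecι (k := CommRingCat.of ℤ[X]) (genericIdeal D e)) =
            (sigmaCoords D).app (globalAlg Y) ((globalRigidified eM x).transport hN) := by
  obtain ⟨π, hπ⟩ := (isOpenSubfunctor_sigmaCoords (D := D) hN e).exists_hom
    ((globalRigidified eM (𝟙 _)).transport hN)
  refine ⟨π, fun Y x => ?_⟩
  refine ((specRepresentableBy (k := CommRingCat.of ℤ[X])
    (F := sigmaClosure g N) e).homEquiv_comp x _).trans ?_
  refine (congrArg _ hπ).trans ?_
  refine (NatTrans.naturality_apply (sigmaCoords D)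
    (((algΓ (CommRingCat.of ℤ[X])).map x).unop) _).symm.trans ?_
  refine congrArg ((sigmaCoords D).app (globalAlg Y)) ?_
  refine (RigidifiedSp.transport_map hN (globalMap x) _).symm.trans ?_
  rw [← globalRigidified_comp, Category.comp_id]

end SigmaScheme

/-! ### Finiteness properties -/

section FiniteType

open Opposite

variable {k : CommRingCat.{0}} {A : CommAlgCat.{0} k}

theorem locallyOfFiniteType_algSpec (h : Algebra.FiniteType k A) :
    LocallyOfFiniteType ((algSpec k).obj (op A)).hom := by
  change LocallyOfFiniteType (Spec.map (CommRingCat.ofHom (algebraMap k A)))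
  refine (HasRingHomProperty.Spec_iff (P := @LocallyOfFiniteType)).2 ?_
  exact (RingHom.finiteType_algebraMap (A := k) (B := A)).2 h

theorem isLocallyNoetherian_openSpec [IsNoetherianRing k] (h : Algebra.FiniteType k A) {κ : Type}
    [Finite κ] (I : κ → Ideal A) : IsLocallyNoetherian (openSpec I).left := by
  have : IsNoetherianRing A := Algebra.FiniteType.isNoetherianRing k A
  have : IsLocallyNoetherian ((algSpec k).obj (op A)).left :=
    inferInstanceAs (IsLocallyNoetherian (Spec (CommRingCat.of A)))
  exact inferInstanceAs (IsLocallyNoetherian (openLocus I : Scheme))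

end FiniteType

end SymplecticLocalModel

end

theorem proposition2p3p4 {g N : ℕ} (hN : 0 < N) (D : SymplecticPartition g N) :
    ∃ (Q M S : Over (Spec (CommRingCat.of ℤ[X]))) (_ : GrpObj Q)
      (ρQ : pointsFunctor Q ≅ groupQFunctor D)
      (ρM : pointsFunctor M ≅ rigidifiedFunctor D)
      (ρS : pointsFunctor S ≅ sigmaDFunctor D)
      (a : Q ⊗ M ⟶ M) (π : M ⟶ S),
      (∀ (R : CommAlgCat.{0} ℤ[X]) (γ δ : (algSpec (CommRingCat.of ℤ[X])).obj (.op R) ⟶ Q),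
        toGroupQ ρQ (lift γ δ ≫ MonObj.mul) = toGroupQ ρQ γ * toGroupQ ρQ δ) ∧
      (∀ (R : CommAlgCat.{0} ℤ[X]) (γ : (algSpec (CommRingCat.of ℤ[X])).obj (.op R) ⟶ Q)
        (x : (algSpec (CommRingCat.of ℤ[X])).obj (.op R) ⟶ M),
        toRigidified ρM (lift γ x ≫ a) = (toRigidified ρM x).act (toGroupQ ρQ γ)) ∧
      (∀ (R : CommAlgCat.{0} ℤ[X]) (x : (algSpec (CommRingCat.of ℤ[X])).obj (.op R) ⟶ M),
        IsTransport (toRigidified ρM x) (toSigmaD ρS (x ≫ π))) ∧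
      IsPrincipalHomogeneousSpace a π := by
  obtain ⟨A, -, ⟨eQ⟩⟩ := groupQFunctor_exists_corepresentableBy D
  obtain ⟨B, hB, ⟨eM⟩⟩ := rigidifiedFunctor_exists_corepresentableBy D
  obtain ⟨C, hC, ⟨eS⟩⟩ := closedFunctor_exists_corepresentableBy
    (isClosedCondition_isSigmaCoord g N)
  obtain ⟨grp, hmul, hone⟩ := exists_grpObj eQ
  obtain ⟨a, ha⟩ := exists_action eQ eM
  have hS := isOpenSubfunctor_sigmaCoords (D := D) hN eS
  obtain ⟨π, hπ⟩ := exists_transport_hom eM hN eS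
  obtain ⟨ρS, hρS⟩ := hS.exists_pointsIso
  let ρQ : pointsFunctor ((algSpec (CommRingCat.of ℤ[X])).obj (.op A)) ≅ groupQFunctor D :=
    specPointsIso (k := CommRingCat.of ℤ[X]) eQ
  let ρM : pointsFunctor ((algSpec (CommRingCat.of ℤ[X])).obj (.op B)) ≅ rigidifiedFunctor D :=
    specPointsIso (k := CommRingCat.of ℤ[X]) eM
  have hπeq : ∀ (Y : Over (Spec (CommRingCat.of ℤ[X])))
      (x y : Y ⟶ (algSpec (CommRingCat.of ℤ[X])).obj (.op B)), x ≫ π = y ≫ π ↔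
        (globalRigidified eM x).transport hN = (globalRigidified eM y).transport hN := by
    intro Y x y
    constructor
    · intro h
      refine hS.1 (globalAlg Y) ((hπ Y x).symm.trans (Eq.trans ?_ (hπ Y y)))
      rw [← Category.assoc, ← Category.assoc, h]
    · intro h
      refine (cancel_mono (openSpecι (k := CommRingCat.of ℤ[X]) (genericIdeal D eS))).1 ?_
      refine (specRepresentableBy (k := CommRingCat.of ℤ[X]) eS).homEquiv.injective ?_
      rw [Category.assoc, Category.assoc]
      refine (hπ Y x).trans (Eq.trans ?_ (hπ Y y).symm)
      rw [h]
  have htransport : ∀ (R : CommAlgCat.{0} ℤ[X])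
      (x : (algSpec (CommRingCat.of ℤ[X])).obj (.op R) ⟶
        (algSpec (CommRingCat.of ℤ[X])).obj (.op B)),
      IsTransport (toRigidified ρM x) (toSigmaD ρS (x ≫ π)) := by
    intro R x
    have h : toSigmaD ρS (x ≫ π) = (toRigidified ρM x).transport hN := by
      refine hS.1 R (map_toΓSpec_injective (k := CommRingCat.of ℤ[X]) (sigmaClosure g N) R ?_)
      refine (congrArg _ (hρS R (x ≫ π))).trans ?_
      refine (specRepresentableBy_homEquiv (k := CommRingCat.of ℤ[X]) eS _).symm.trans ?_
      rw [Category.assoc]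
      refine (hπ _ x).trans ?_
      refine Eq.trans ?_ (NatTrans.naturality_apply (sigmaCoords D)
        (toΓSpec (CommRingCat.of ℤ[X]) R) _)
      refine congrArg ((sigmaCoords D).app _) ?_
      rw [globalRigidified_spec]
      exact RigidifiedSp.transport_map hN _ _
    rw [h]
    exact RigidifiedSp.isTransport_transport hN _
  have hact : a ≫ π = snd _ _ ≫ π := by
    rw [hπeq, ← Category.id_comp a, ← lift_fst_snd, ha, RigidifiedSp.transport_act]
  refine ⟨_, _, openSpec (k := CommRingCat.of ℤ[X]) (genericIdeal D eS), grp, ρQ, ρM, ρS, a, π,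
    fun R γ δ => ?_, fun R γ x => ?_, htransport, ?_⟩
  · refine groupQMap_toΓSpec_injective R ?_
    rw [groupQMap_mul, ← globalGroupQ_spec, ← globalGroupQ_spec, ← globalGroupQ_spec, hmul]
  · refine rigidifiedMap_toΓSpec_injective R ?_
    rw [RigidifiedSp.map_act, ← globalGroupQ_spec, ← globalRigidified_spec,
      ← globalRigidified_spec, ha]
  · refine ⟨(globalRigidified_bijective eM).1 ?_, (globalRigidified_bijective eM).1 ?_, hact,
      isPullback_of_existsUnique hact fun W x y h => ?_, fun z => ?_⟩
    · rw [ha, hone, RigidifiedSp.act_one]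
    · rw [whiskerRight_eq_lift, ← Category.assoc (α_ _ _ _).hom, associator_comp_whiskerLeft, ha, ha,
        ha, hmul, RigidifiedSp.act_mul]
    · obtain ⟨γ, hγ, hγ'⟩ := RigidifiedSp.existsUnique_act hN ((hπeq W x y).1 h)
      obtain ⟨γ, rfl⟩ := (globalGroupQ_bijective eQ).2 γ
      refine ⟨γ, (globalRigidified_bijective eM).1 ((ha W γ y).trans hγ), fun δ hδ => ?_⟩
      refine (globalGroupQ_bijective eQ).1 (hγ' _ ?_)
      exact (ha W δ y).symm.trans (congrArg _ hδ)
    · have : LocallyOfFiniteType ((algSpec (CommRingCat.of ℤ[X])).obj (.op B)).hom :=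
        locallyOfFiniteType_algSpec (k := CommRingCat.of ℤ[X]) hB
      have : LocallyOfFiniteType (π.left ≫ (openSpec (k := CommRingCat.of ℤ[X])
          (genericIdeal D eS)).hom) := by rwa [Over.w]
      have : LocallyOfFiniteType π.left := locallyOfFiniteType_of_comp _
        (openSpec (k := CommRingCat.of ℤ[X]) (genericIdeal D eS)).hom
      have : IsNoetherianRing (CommRingCat.of ℤ[X]) := inferInstanceAs (IsNoetherianRing ℤ[X])
      have : IsLocallyNoetherian (openSpec (k := CommRingCat.of ℤ[X]) (genericIdeal D eS)).left :=
        isLocallyNoetherian_openSpec (k := CommRingCat.of ℤ[X]) hC _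
      refine exists_section_of_stalk π.left z ?_
      obtain ⟨R, hR, f, i, hi⟩ := exists_algSpec_stalk _ z
      obtain ⟨x, hx⟩ := SigmaDPoint.exists_isTransport (toSigmaD ρS f)
      obtain ⟨y, hy⟩ : ∃ y : (algSpec (CommRingCat.of ℤ[X])).obj (.op R) ⟶
          (algSpec (CommRingCat.of ℤ[X])).obj (.op B), toRigidified ρM y = x :=
        ((isIso_iff_bijective (ρM.hom.app R)).1 inferInstance).2 x
      have hf : y ≫ π = f := ((isIso_iff_bijective (ρS.hom.app R)).1 inferInstance).1
        ((htransport R y).unique (hy ▸ hx))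
      exact ⟨i ≫ y.left, by rw [Category.assoc, ← Over.comp_left, hf, hi]⟩
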